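/- Let $p_1,p_2\ge 1$ and $p=p_1p_2$. Let $\mathcal S_n$ be the space of real symmetric $n\times n$ matrices, $\mathcal S_n^{++}$ its open subset of positive definite matrices, and $\mathcal S_{p_1,p_2}^{++}=\{\Sigma_2\otimes\Sigma_1:\Sigma_i\in\mathcal S_{p_i}^{++}\}$. For $M\in\mathbb R^{p\times p}$ with $p_1\times p_1$ blocks $M_{[i,j]}$ ($i,j\le p_2$) put $\mathrm{tr}_1(M)=\sum_i M_{[i,i]}$ and $\mathrm{tr}_2(M)=(\mathrm{tr}\,M_{[i,j]})_{ij}$. For $\Sigma\in\mathcal S_p^{++}$ let $$d(K_2\otimes K_1\mid\Sigma)=\mathrm{tr}\big(\Sigma (K_2\otimes K_1)^{-1}\big)+p_1\log|K_2|+p_2\log|K_1| ,$$ and let $k(\Sigma)$ be the minimizer of $d(\cdot\mid\Sigma)$ over $\mathcal S_{p_1,p_2}^{++}$. Let $\mathcal C_{p_1,p_2}^{++}=\{C\in\mathcal S_p^{++}:k(C)=I_p\}$. Let $h$ be either the symmetric positive definite square root or the (lower triangular, positive diagonal) Cholesky factor, and put $c(\Sigma)=h(k(\Sigma))^{-1}\,\Sigma\,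 h(k(\Sigma))^{-\top}$ and $f(\Sigma)=(k(\Sigma),c(\Sigma))$. Below $X^{1/2}$ always denotes the symmetric square root. Let $\mathcal E=\{(\Sigma_1,\Sigma_2)\in\mathcal S_{p_1}^{++}\times\mathcal S_{p_2}^{++}:|\Sigma_1|=1\}$, with tangent spaces $T_{(\Sigma_1,\Sigma_2)}\mathcal E=\{(U_1,U_2)\in\mathcal S_{p_1}\times\mathcal S_{p_2}:\mathrm{tr}(\Sigma_1^{-1}U_1)=0\}$ and with the metric $p_2\,\mathrm{tr}(\Sigma_1^{-1}U_1\Sigma_1^{-1}W_1)+p_1\,\mathrm{tr}(\Sigma_2^{-1}U_2\Sigma_2^{-1}W_2)$, which is induced through $(\Sigma_1,\Sigma_2)\mapsto\Sigma_2\otimes\Sigma_1$ by the affine-invariant metric $\mathrm{tr}(K^{-1}UK^{-1}W)$. The geodesic of $\mathcal E$ from $(\Sigma_1,\Sigma_2)$ with velocity $(W_1,W_2)$ is $t\mapsto\big(\Sigma_i^{1/2}\exp(t\,\Sigma_i^{-1/2}W_i\Sigma_i^{-1/2})\Sigma_i^{1/2}\big)_{i=1,2}$. (1) For every $\Sigma\in\mathcal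 S_p^{++}$ the minimizer $k(\Sigma)$ exists and is unique. The maps $h$ (on $\mathcal S_p^{++}$), $k:\mathcal S_p^{++}\to\mathcal S_{p_1,p_2}^{++}$, $c$ and $f$ are smooth, for either choice of $h$, and $f:\mathcal S_p^{++}\to\mathcal S_{p_1,p_2}^{++}\times\mathcal C_{p_1,p_2}^{++}$ is a diffeomorphism with inverse $g(K,C)=h(K)\,C\,h(K)^\top$. (2) For every $\Sigma\in\mathcal S_p^{++}$ the function $(K_1,K_2)\mapsto d(K_2\otimes K_1\mid\Sigma)$ is strictly geodesically convex on $\mathcal E$, and there is exactly one $(\Sigma_1,\Sigma_2)\in\mathcal E$ with $k(\Sigma)=\Sigma_2\otimes\Sigma_1$. For $C\in\mathcal C_{p_1,p_2}^{++}$ put $$\mathcal R_C(U_1,U_2)=\Big(U_1+\tfrac1{p_2}\Sigma_1^{1/2}M_1\Sigma_1^{1/2}-\tfrac1{p_2}\mathrm{tr}\big(\Sigma_2^{-1/2}U_2\Sigma_2^{-1/2}\big)\Sigma_1,\ \ U_2+\tfrac1{p_1}\Sigma_2^{1/2}M_2\Sigma_2^{1/2}\Big),$$ $$M_1=\sum_{i,j=1}^{p_2}(\Sigma_2^{-1/2}U_2\Sigma_2^{-1/2})_{ij}\,C_{[j,i]},\qquad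 (M_2)_{ij}=\mathrm{tr}\big(C_{[i,j]}\,\Sigma_1^{-1/2}U_1\Sigma_1^{-1/2}\big).$$ For $C=c(\Sigma)$, with either choice of $h$, $\mathcal R_C$ is a bijection of $T_{(\Sigma_1,\Sigma_2)}\mathcal E$ onto itself. For $C_{\rm s}=k(\Sigma)^{-1/2}\,\Sigma\, k(\Sigma)^{-1/2}$ (the core for the symmetric square root), $\mathcal R_{C_{\rm s}}$ is the Riemannian Hessian operator of $d(\cdot\mid\Sigma)$ on $\mathcal E$ at $(\Sigma_1,\Sigma_2)$. (3) Let $V\in\mathcal S_p$ and $\tilde V=(\Sigma_2^{1/2}\otimes\Sigma_1^{1/2})^{-1}V(\Sigma_2^{1/2}\otimes\Sigma_1^{1/2})^{-1}$. Then $dk(\Sigma)[V]=U_2\otimes\Sigma_1+\Sigma_2\otimes U_1$, where $(U_1,U_2)$ is the unique element of $T_{(\Sigma_1,\Sigma_2)}\mathcal E$ with $$\mathcal R_{C_{\rm s}}(U_1,U_2)=\Big(\tfrac1{p_2}\Sigma_1^{1/2}\big[\mathrm{tr}_1(\tilde V)-\tfrac{\mathrm{tr}(\tilde V)}{p_1}I_{p_1}\big]\Sigma_1^{1/2},\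 \tfrac1{p_1}\Sigma_2^{1/2}\,\mathrm{tr}_2(\tilde V)\,\Sigma_2^{1/2}\Big).\qquad(*)$$ For either choice of $h$, with $C=c(\Sigma)$, $H=h(k(\Sigma))$ and $D=dh(k(\Sigma))\big[dk(\Sigma)[V]\big]$, $$dc(\Sigma)[V]=H^{-1}VH^{-\top}-H^{-1}DC-CD^\top H^{-\top},\qquad df(\Sigma)[V]=(dk(\Sigma)[V],dc(\Sigma)[V]).$$ (4) For either choice of $h$, $c(\Sigma)=I_p$ if and only if $\Sigma=k(\Sigma)$. In this case $\mathcal R_{I_p}$ is the identity on $T_{(\Sigma_1,\Sigma_2)}\mathcal E$, $(U_1,U_2)$ is the right-hand side of $(*)$, $$dk(\Sigma)[V]=\tfrac1{p_1}\big(\Sigma_2^{1/2}\mathrm{tr}_2(\tilde V)\Sigma_2^{1/2}\big)\otimes\Sigma_1+\tfrac1{p_2}\Sigma_2\otimes\big(\Sigma_1^{1/2}\mathrm{tr}_1(\tilde V)\Sigma_1^{1/2}\big)-\tfrac{\mathrm{tr}(\tilde V)}{p}\Sigma,$$ and $dc(\Sigma)[V]=H^{-1}VH^{-\top}-\tilde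 R-\tilde R^\top$. For the Cholesky factor, with $L_i$ the Cholesky factor of $\Sigma_i$, $$\tilde R=\big(I_{p_2}\otimes L_1^{-1}U_1L_1^{-\top}+L_2^{-1}U_2L_2^{-\top}\otimes I_{p_1}\big)_{1/2},$$ where $(M)_{1/2}$ is the strictly lower triangular part of $M$ plus half of its diagonal. For the symmetric square root and any eigendecompositions $\Sigma_i=\Gamma_i\Lambda_i\Gamma_i^\top$ ($\Gamma_i$ orthogonal, $\Lambda_i$ diagonal), $$\tilde R=(\Gamma_2\otimes\Gamma_1)(\Lambda_2^{-1/2}\otimes\Lambda_1^{-1/2})\big[\Lambda^-\circ(\Lambda_2\otimes\Gamma_1^\top U_1\Gamma_1+\Gamma_2^\top U_2\Gamma_2\otimes\Lambda_1)\big](\Gamma_2\otimes\Gamma_1)^\top,$$ where $\circ$ is the entrywise product and $\Lambda^-$ is the entrywise inverse of the $p\times p$ matrix $(s_a+s_b)_{a,b}$, with $s$ the vector of diagonal entries of $\Lambda_2^{1/2}\otimes\Lambda_1^{1/2}$. -/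

import Mathlib

open scoped Kronecker ContDiff Matrix.Norms.Operator

noncomputable section

namespace KroneckerCore

/-! ### Symmetric matrices and smooth maps between subsets of normed spaces -/

/-- The real vector space of symmetric matrices. All norms on it are equivalent. -/
def Sym (n : Type) : Submodule ℝ (Matrix n n ℝ) where
  carrier := {A | A.IsSymm}
  add_mem' := fun ha hb => Matrix.IsSymm.add ha hb
  zero_mem' := Matrix.isSymm_zero
  smul_mem' := fun c _ ha => Matrix.IsSymm.smul ha c

/-- The congruence `A ↦ X A Xᵀ` on symmetric matrices. -/
def congruence {n : Type} [Fintype n] (X : Matrix n n ℝ) (A : Sym n) : Sym n :=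
  ⟨X * (A : Matrix n n ℝ) * X.transpose, by
    have h : (A : Matrix n n ℝ).transpose = A := A.2
    change (X * (A : Matrix n n ℝ) * X.transpose).transpose = _
    rw [Matrix.transpose_mul, Matrix.transpose_mul, Matrix.transpose_transpose, h,
      Matrix.mul_assoc]⟩

/-- Symmetric positive definite matrices, a subset of the space of symmetric matrices. -/
def SPD (n : Type) : Set (Sym n) := {A | (A : Matrix n n ℝ).PosDef}

/-- Smoothness of a map on a subset `M` of a normed space: near every point of `M` the map agrees
on `M` with a smooth map defined on an open set of the ambient space. For embedded submanifolds
this is smoothness in the sense of manifolds. -/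
def SmoothOnSubset {E F : Type*} [NormedAddCommGroup E] [NormedSpace ℝ E]
    [NormedAddCommGroup F] [NormedSpace ℝ F] (f : E → F) (M : Set E) : Prop :=
  ∀ x ∈ M, ∃ U : Set E, IsOpen U ∧ x ∈ U ∧
    ∃ G : E → F, ContDiffOn ℝ ∞ G U ∧ Set.EqOn G f (M ∩ U)

/-- `f` restricts to a diffeomorphism from `M` onto `N`, with inverse `g`. -/
structure IsDiffeoWithInverse {E F : Type*} [NormedAddCommGroup E] [NormedSpace ℝ E]
    [NormedAddCommGroup F] [NormedSpace ℝ F] (f : E → F) (g : F → E)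
    (M : Set E) (N : Set F) : Prop where
  mapsTo : Set.MapsTo f M N
  mapsTo_inv : Set.MapsTo g N M
  left_inv : Set.LeftInvOn g f M
  right_inv : Set.RightInvOn g f N
  smooth : SmoothOnSubset f M
  smooth_inv : SmoothOnSubset g N

/-! ### Square roots -/

/-- `X` is the symmetric positive definite square root of `A`. -/
def IsSymmSqrt {n : Type} [Fintype n] (A X : Matrix n n ℝ) : Prop :=
  X.PosDef ∧ X * X = A

/-- `X` is the Cholesky factor of `A`: lower triangular (for the order of the indices given by the
key `b`) with positive diagonal and `X Xᵀ = A`. -/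
def IsCholesky {n : Type} [Fintype n] {α : Type} [LT α] (b : n → α) (A X : Matrix n n ℝ) : Prop :=
  (∀ i j, b i < b j → X i j = 0) ∧ (∀ i, 0 < X i i) ∧ X * X.transpose = A

/-- The symmetric square root. -/
def symmSqrt {n : Type} [Fintype n] (A : Matrix n n ℝ) : Matrix n n ℝ :=
  Classical.epsilon (IsSymmSqrt A)

/-- The Cholesky factor. -/
def choleskyFactor {n : Type} [Fintype n] {α : Type} [LT α] (b : n → α) (A : Matrix n n ℝ) :
    Matrix n n ℝ :=
  Classical.epsilon (IsCholesky b A)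

/-- The two choices of a square root. -/
inductive SqrtKind
  | symmetric
  | cholesky

variable {p₁ p₂ : ℕ}

/-- Index set of the `p × p` matrices with `p = p₁ p₂`: the pair `(i, a)` is row `a` of block
row `i`, so that the linear order of `1, …, p` is the lexicographic order of the pairs. -/
abbrev Idx (p₁ p₂ : ℕ) : Type := Fin p₂ × Fin p₁

/-- `X` is the square root of `K` of the given kind. -/
def IsSqrt (κ : SqrtKind) (K X : Matrix (Idx p₁ p₂) (Idx p₁ p₂) ℝ) : Prop :=
  match κ with
  | .symmetric => IsSymmSqrt K X
  | .cholesky => IsCholesky (fun x : Idx p₁ p₂ => toLex x) K X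

/-- The square root map `h` of the given kind, on all positive definite `p × p` matrices. -/
def sqrtMap (κ : SqrtKind) (K : Sym (Idx p₁ p₂)) : Matrix (Idx p₁ p₂) (Idx p₁ p₂) ℝ :=
  match κ with
  | .symmetric => symmSqrt (K : Matrix (Idx p₁ p₂) (Idx p₁ p₂) ℝ)
  | .cholesky => choleskyFactor (fun x : Idx p₁ p₂ => toLex x)
      (K : Matrix (Idx p₁ p₂) (Idx p₁ p₂) ℝ)

/-! ### Blocks and partial traces -/

/-- The block `M_[i,j]`, a `p₁ × p₁` matrix. -/
def block (M : Matrix (Idx p₁ p₂) (Idx p₁ p₂) ℝ) (i j : Fin p₂) : Matrix (Fin p₁) (Fin p₁) ℝ :=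
  Matrix.of fun a b => M (i, a) (j, b)

/-- The partial trace `tr₁ M = ∑ᵢ M_[i,i]`. -/
def ptrace₁ (M : Matrix (Idx p₁ p₂) (Idx p₁ p₂) ℝ) : Matrix (Fin p₁) (Fin p₁) ℝ :=
  ∑ i, block M i i

/-- The partial trace `(tr₂ M)ᵢⱼ = tr M_[i,j]`. -/
def ptrace₂ (M : Matrix (Idx p₁ p₂) (Idx p₁ p₂) ℝ) : Matrix (Fin p₂) (Fin p₂) ℝ :=
  Matrix.of fun i j => (block M i j).trace

/-! ### The Kronecker map and the core map -/

/-- Pairs `(K₁, K₂)` of a `p₁ × p₁` and a `p₂ × p₂` matrix. -/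
abbrev Pair (p₁ p₂ : ℕ) : Type := Matrix (Fin p₁) (Fin p₁) ℝ × Matrix (Fin p₂) (Fin p₂) ℝ

/-- The Kullback–Leibler objective
`d(K₂ ⊗ K₁ | S) = tr (S (K₂ ⊗ K₁)⁻¹) + p₁ log |K₂| + p₂ log |K₁|`. -/
def klObjective (S : Sym (Idx p₁ p₂)) (X : Pair p₁ p₂) : ℝ :=
  ((S : Matrix (Idx p₁ p₂) (Idx p₁ p₂) ℝ) * (X.2 ⊗ₖ X.1)⁻¹).trace
    + p₁ * Real.log X.2.det + p₂ * Real.log X.1.det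

/-- The separable positive definite matrices `Σ₂ ⊗ Σ₁`. -/
def KronSPD (p₁ p₂ : ℕ) : Set (Sym (Idx p₁ p₂)) :=
  {K | ∃ X : Pair p₁ p₂, X.1.PosDef ∧ X.2.PosDef ∧
    (K : Matrix (Idx p₁ p₂) (Idx p₁ p₂) ℝ) = X.2 ⊗ₖ X.1}

/-- `K` minimizes `d(· | S)` over the separable positive definite matrices. -/
def IsKronMinimizer (S K : Sym (Idx p₁ p₂)) : Prop :=
  ∃ X : Pair p₁ p₂, X.1.PosDef ∧ X.2.PosDef ∧
    (K : Matrix (Idx p₁ p₂) (Idx p₁ p₂) ℝ) = X.2 ⊗ₖ X.1 ∧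
    ∀ Y : Pair p₁ p₂, Y.1.PosDef → Y.2.PosDef → klObjective S X ≤ klObjective S Y

/-- The Kronecker map `k`: the minimizer of `d(· | S)`. -/
def kronMap (S : Sym (Idx p₁ p₂)) : Sym (Idx p₁ p₂) :=
  Classical.epsilon (IsKronMinimizer S)

/-- The core covariance matrices: positive definite with `k(C) = I`. -/
def Core (p₁ p₂ : ℕ) : Set (Sym (Idx p₁ p₂)) :=
  {C | C ∈ SPD (Idx p₁ p₂) ∧ (kronMap C : Matrix (Idx p₁ p₂) (Idx p₁ p₂) ℝ) = 1}

/-- The core map `c(S) = h(k(S))⁻¹ S h(k(S))⁻ᵀ`. -/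
def coreMap (κ : SqrtKind) (S : Sym (Idx p₁ p₂)) : Sym (Idx p₁ p₂) :=
  congruence (sqrtMap κ (kronMap S))⁻¹ S

/-- The map `f(S) = (k(S), c(S))`. -/
def kcd (κ : SqrtKind) (S : Sym (Idx p₁ p₂)) : Sym (Idx p₁ p₂) × Sym (Idx p₁ p₂) :=
  (kronMap S, coreMap κ S)

/-- The map `g(K, C) = h(K) C h(K)ᵀ`. -/
def kcdInv (κ : SqrtKind) (X : Sym (Idx p₁ p₂) × Sym (Idx p₁ p₂)) : Sym (Idx p₁ p₂) :=
  congruence (sqrtMap κ X.1) X.2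

/-! ### The manifold of normalized factors with the affine-invariant metric -/

/-- Pairs of positive definite matrices `(Σ₁, Σ₂)` with `|Σ₁| = 1`. -/
def Factors (p₁ p₂ : ℕ) : Set (Pair p₁ p₂) :=
  {X | X.1.PosDef ∧ X.1.det = 1 ∧ X.2.PosDef}

/-- The tangent space of `Factors` at `X`. -/
def tangent (X : Pair p₁ p₂) : Set (Pair p₁ p₂) :=
  {U | U.1.IsSymm ∧ (X.1⁻¹ * U.1).trace = 0 ∧ U.2.IsSymm}

/-- The metric on `Factors` induced through `(Σ₁, Σ₂) ↦ Σ₂ ⊗ Σ₁` by the affine-invariant metric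
`tr (K⁻¹ U K⁻¹ V)`. -/
def metric (X U V : Pair p₁ p₂) : ℝ :=
  p₂ * (X.1⁻¹ * U.1 * X.1⁻¹ * V.1).trace + p₁ * (X.2⁻¹ * U.2 * X.2⁻¹ * V.2).trace

/-- `γ` is a geodesic of `Factors` on the open interval `I`: a smooth curve in `Factors` that
satisfies the Euler–Lagrange equation of the energy `½ ∫ g_γ(γ', γ')` in all tangent
directions. -/
def IsGeodesic (I : Set ℝ) (γ : ℝ → Pair p₁ p₂) : Prop :=
  IsOpen I ∧ I.OrdConnected ∧ ContDiffOn ℝ ∞ γ I ∧ Set.MapsTo γ I (Factors p₁ p₂) ∧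
    ∀ t ∈ I, ∀ Z ∈ tangent (γ t),
      deriv (fun s => metric (γ s) (deriv γ s) Z) t
        = (1 / 2) * deriv (fun ε : ℝ => metric (γ t + ε • Z) (deriv γ t) (deriv γ t)) 0

/-- The curve `t ↦ (Xᵢ^{1/2} exp(t Xᵢ^{-1/2} Wᵢ Xᵢ^{-1/2}) Xᵢ^{1/2})ᵢ`. -/
def expCurve (X W : Pair p₁ p₂) (t : ℝ) : Pair p₁ p₂ :=
  (symmSqrt X.1 * NormedSpace.exp (t • ((symmSqrt X.1)⁻¹ * W.1 * (symmSqrt X.1)⁻¹))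
      * symmSqrt X.1,
   symmSqrt X.2 * NormedSpace.exp (t • ((symmSqrt X.2)⁻¹ * W.2 * (symmSqrt X.2)⁻¹))
      * symmSqrt X.2)

/-- Strict geodesic convexity on `Factors`: strict convexity along geodesics of non-zero speed. -/
def StrictGeodesicallyConvex (φ : Pair p₁ p₂ → ℝ) : Prop :=
  ∀ (I : Set ℝ) (γ : ℝ → Pair p₁ p₂), IsGeodesic I γ → (∀ t ∈ I, deriv γ t ≠ 0) →
    StrictConvexOn ℝ I (φ ∘ γ)

/-- `H` is the Riemannian Hessian operator of `φ` at `X`: the self-adjoint operator on the tangent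
space whose quadratic form is the second derivative of `φ` along geodesics. -/
structure IsRiemannianHessian (φ : Pair p₁ p₂ → ℝ) (X : Pair p₁ p₂)
    (H : Pair p₁ p₂ → Pair p₁ p₂) : Prop where
  mapsTo : Set.MapsTo H (tangent X) (tangent X)
  selfAdjoint : ∀ U ∈ tangent X, ∀ V ∈ tangent X, metric X (H U) V = metric X U (H V)
  second_deriv : ∀ (I : Set ℝ) (γ : ℝ → Pair p₁ p₂), IsGeodesic I γ → (0 : ℝ) ∈ I → γ 0 = X →
    iteratedDeriv 2 (φ ∘ γ) 0 = metric X (H (deriv γ 0)) (deriv γ 0)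

/-! ### The operator `R_C` and the differentials -/

/-- `∑ᵢⱼ (Σ₂^{-1/2} U₂ Σ₂^{-1/2})ᵢⱼ C_[j,i]`. -/
def opM₁ (X : Pair p₁ p₂) (C : Matrix (Idx p₁ p₂) (Idx p₁ p₂) ℝ) (U : Pair p₁ p₂) :
    Matrix (Fin p₁) (Fin p₁) ℝ :=
  ∑ i, ∑ j, ((symmSqrt X.2)⁻¹ * U.2 * (symmSqrt X.2)⁻¹) i j • block C j i

/-- The matrix with entries `tr (C_[i,j] Σ₁^{-1/2} U₁ Σ₁^{-1/2})`. -/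
def opM₂ (X : Pair p₁ p₂) (C : Matrix (Idx p₁ p₂) (Idx p₁ p₂) ℝ) (U : Pair p₁ p₂) :
    Matrix (Fin p₂) (Fin p₂) ℝ :=
  Matrix.of fun i j => (block C i j * ((symmSqrt X.1)⁻¹ * U.1 * (symmSqrt X.1)⁻¹)).trace

/-- The operator `R_C` at `X = (Σ₁, Σ₂)`. -/
def opR (X : Pair p₁ p₂) (C : Matrix (Idx p₁ p₂) (Idx p₁ p₂) ℝ) (U : Pair p₁ p₂) : Pair p₁ p₂ :=
  (U.1 + (1 / (p₂ : ℝ)) • (symmSqrt X.1 * opM₁ X C U * symmSqrt X.1)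
      - (((symmSqrt X.2)⁻¹ * U.2 * (symmSqrt X.2)⁻¹).trace / p₂) • X.1,
   U.2 + (1 / (p₁ : ℝ)) • (symmSqrt X.2 * opM₂ X C U * symmSqrt X.2))

/-- `Ṽ = K^{-1/2} V K^{-1/2}` with the symmetric root `K^{1/2} = Σ₂^{1/2} ⊗ Σ₁^{1/2}`. -/
def whiten (X : Pair p₁ p₂) (V : Matrix (Idx p₁ p₂) (Idx p₁ p₂) ℝ) :
    Matrix (Idx p₁ p₂) (Idx p₁ p₂) ℝ :=
  (symmSqrt X.2 ⊗ₖ symmSqrt X.1)⁻¹ * V * (symmSqrt X.2 ⊗ₖ symmSqrt X.1)⁻¹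

/-- The right-hand side of the linear equation for the differential of `k`. -/
def rhs (X : Pair p₁ p₂) (V : Matrix (Idx p₁ p₂) (Idx p₁ p₂) ℝ) : Pair p₁ p₂ :=
  ((1 / (p₂ : ℝ)) • (symmSqrt X.1
      * (ptrace₁ (whiten X V) - ((whiten X V).trace / p₁) • (1 : Matrix (Fin p₁) (Fin p₁) ℝ))
      * symmSqrt X.1),
   (1 / (p₁ : ℝ)) • (symmSqrt X.2 * ptrace₂ (whiten X V) * symmSqrt X.2))

/-- The tangent vector `U₂ ⊗ Σ₁ + Σ₂ ⊗ U₁` of the separable matrices at `Σ₂ ⊗ Σ₁`. -/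
def kronTangent (X U : Pair p₁ p₂) : Matrix (Idx p₁ p₂) (Idx p₁ p₂) ℝ :=
  U.2 ⊗ₖ X.1 + X.2 ⊗ₖ U.1

/-- `(M)_{1/2}`: strictly lower triangular part plus half of the diagonal. -/
def lowerHalf (M : Matrix (Idx p₁ p₂) (Idx p₁ p₂) ℝ) : Matrix (Idx p₁ p₂) (Idx p₁ p₂) ℝ :=
  Matrix.of fun x y => if toLex y < toLex x then M x y else if x = y then M x y / 2 else 0

/-- `R̃` for the Cholesky root. -/
def tildeRChol (X U : Pair p₁ p₂) : Matrix (Idx p₁ p₂) (Idx p₁ p₂) ℝ :=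
  let L₁ := choleskyFactor (id : Fin p₁ → Fin p₁) X.1
  let L₂ := choleskyFactor (id : Fin p₂ → Fin p₂) X.2
  lowerHalf ((1 : Matrix (Fin p₂) (Fin p₂) ℝ) ⊗ₖ (L₁⁻¹ * U.1 * L₁⁻¹.transpose)
    + (L₂⁻¹ * U.2 * L₂⁻¹.transpose) ⊗ₖ (1 : Matrix (Fin p₁) (Fin p₁) ℝ))

/-- `Γᵢ diag(lᵢ) Γᵢᵀ` is an eigendecomposition of the two components of `X`. -/
def IsEigenPair (X Γ : Pair p₁ p₂) (l₁ : Fin p₁ → ℝ) (l₂ : Fin p₂ → ℝ) : Prop :=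
  Γ.1 ∈ Matrix.orthogonalGroup (Fin p₁) ℝ ∧ Γ.2 ∈ Matrix.orthogonalGroup (Fin p₂) ℝ ∧
    X.1 = Γ.1 * Matrix.diagonal l₁ * Γ.1.transpose ∧
    X.2 = Γ.2 * Matrix.diagonal l₂ * Γ.2.transpose

/-- `Λ⁻`, the entrywise inverse of `1 λ₂ᵀ ⊗ 1 λ₁ᵀ + λ₂ 1ᵀ ⊗ λ₁ 1ᵀ`, where `λᵢ` is the vector of
the square roots of the eigenvalues `lᵢ`. -/
def lambdaInv (l₁ : Fin p₁ → ℝ) (l₂ : Fin p₂ → ℝ) : Matrix (Idx p₁ p₂) (Idx p₁ p₂) ℝ :=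
  Matrix.of fun x y =>
    (Real.sqrt (l₂ y.1) * Real.sqrt (l₁ y.2) + Real.sqrt (l₂ x.1) * Real.sqrt (l₁ x.2))⁻¹

/-- `R̃` for the symmetric root, in terms of an eigendecomposition. -/
def tildeRSymm (Γ : Pair p₁ p₂) (l₁ : Fin p₁ → ℝ) (l₂ : Fin p₂ → ℝ) (U : Pair p₁ p₂) :
    Matrix (Idx p₁ p₂) (Idx p₁ p₂) ℝ :=
  (Γ.2 ⊗ₖ Γ.1)
    * (Matrix.diagonal (fun i => (Real.sqrt (l₂ i))⁻¹)
        ⊗ₖ Matrix.diagonal (fun a => (Real.sqrt (l₁ a))⁻¹))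
    * Matrix.hadamard (lambdaInv l₁ l₂)
        (Matrix.diagonal l₂ ⊗ₖ (Γ.1.transpose * U.1 * Γ.1)
          + (Γ.2.transpose * U.2 * Γ.2) ⊗ₖ Matrix.diagonal l₁)
    * (Γ.2 ⊗ₖ Γ.1).transpose

/-- The differential `dk(S)[V]` as a matrix. -/
def dk (S V : Sym (Idx p₁ p₂)) : Matrix (Idx p₁ p₂) (Idx p₁ p₂) ℝ :=
  (fderiv ℝ kronMap S V : Sym (Idx p₁ p₂))

/-- The differential `dc(S)[V]` as a matrix. -/
def dc (κ : SqrtKind) (S V : Sym (Idx p₁ p₂)) : Matrix (Idx p₁ p₂) (Idx p₁ p₂) ℝ :=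
  (fderiv ℝ (coreMap κ) S V : Sym (Idx p₁ p₂))

end KroneckerCore

end

namespace KroneckerCore

open Matrix Topology

set_option linter.unusedSectionVars false

/-! ### Positive definite matrices and their two square roots. -/

section Generic

variable {n : Type} [Fintype n]

/-! Everything is reduced to the identity by whitening with `Σ₂^{1/2} ⊗ Σ₁^{1/2}`: a separable
congruence changes the objective only by an additive constant (`dualObjective_congr`). Setting the
gradient at a minimizer to zero says that the whitened matrix has the partial traces of the identity
(`IsCoreMatrix`). Conversely, let `C` be such a matrix and diagonalize the two inverse factors, with
eigenvalues `α`, `β`. The partial trace conditions turn the objective minus `p₁p₂` into a sum of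
terms `C'_{(i,a),(i,a)} (β_i α_a - 1 - log (β_i α_a))`, where `C'` is `C` in the eigenbases. Each
term is nonnegative and vanishes only if `β_i α_a = 1` (`IsCoreMatrix.le_dualObjective`). So
stationarity characterizes the minimizer and uniqueness needs no convexity; existence is a
compactness argument (`exists_dual_minimizer`).

One quadratic form carries the differential statements. For `W = u₂ ⊗ 1 + 1 ⊗ u₁` and positive
definite `C`, `tr (Wᵀ C W)` is positive unless `W = 0`, and `W = 0` forces `u₁ = u₂ = 0` when `tr u₁
= 0`. This form is the second derivative of the objective along geodesics
(`IsGeodesic.hasDerivAt_deriv_klObjective`), hence strict convexity. For a core matrix it is also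
the form of `R_C` (`metric_opR_self`), hence the Hessian. Its definiteness also makes the linearized
stationarity equations injective (`IsCoreMatrix.linearized_eq_zero`). This gives the bijectivity of
`R_C`, and through the implicit function theorem the smoothness of `k` (`exists_local_factors`);
differentiating the same equations gives `dk` (`exists_dk_eq`).

The diffeomorphism rests on two facts: both roots of a separable matrix are separable
(`exists_sqrtMap_eq_kronecker`), and `k` is equivariant under separable congruences
(`kronMap_congruence`). The formula for `dc` is the product rule for `Σ = H c(Σ) Hᵀ`. In the
separable case `R_I` is the identity, and `H⁻¹ dH` is found from triangularity for the Cholesky root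
and from a Sylvester equation, diagonal in the eigenbasis, for the symmetric root. -/

theorem _root_.Matrix.PosDef.transpose_eq {A : Matrix n n ℝ} (hA : A.PosDef) : Aᵀ = A := by
  simpa [conjTranspose_eq_transpose_of_trivial] using hA.isHermitian.eq

theorem _root_.Matrix.PosSemidef.transpose_eq {A : Matrix n n ℝ} (hA : A.PosSemidef) : Aᵀ = A := by
  simpa [conjTranspose_eq_transpose_of_trivial] using hA.isHermitian.eq

theorem posDef_iff_real {A : Matrix n n ℝ} :
    A.PosDef ↔ Aᵀ = A ∧ ∀ x : n → ℝ, x ≠ 0 → 0 < x ⬝ᵥ A *ᵥ x := by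
  rw [posDef_iff_dotProduct_mulVec, IsHermitian, conjTranspose_eq_transpose_of_trivial]
  simp

theorem posSemidef_iff_real {A : Matrix n n ℝ} :
    A.PosSemidef ↔ Aᵀ = A ∧ ∀ x : n → ℝ, 0 ≤ x ⬝ᵥ A *ᵥ x := by
  rw [posSemidef_iff_dotProduct_mulVec, IsHermitian, conjTranspose_eq_transpose_of_trivial]
  simp

variable [DecidableEq n]

theorem _root_.Matrix.PosDef.isUnit_det {A : Matrix n n ℝ} (hA : A.PosDef) : IsUnit A.det :=
  hA.det_pos.ne'.isUnit

/-- The transport of positive definiteness along an invertible congruence. -/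
theorem _root_.Matrix.PosDef.congr {A : Matrix n n ℝ} (hA : A.PosDef) {B : Matrix n n ℝ}
    (hB : IsUnit B.det) : (B * A * Bᵀ).PosDef := by
  have := hA.mul_mul_conjTranspose_same (B := B)
    (vecMul_injective_iff_isUnit.2 ((isUnit_iff_isUnit_det B).2 hB))
  simpa [conjTranspose_eq_transpose_of_trivial] using this

theorem exists_orthogonal_diagonal {A : Matrix n n ℝ} (hA : Aᵀ = A) :
    ∃ (O : Matrix n n ℝ) (d : n → ℝ), O * Oᵀ = 1 ∧ Oᵀ * O = 1 ∧ A = O * diagonal d * Oᵀ := by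
  have hH : A.IsHermitian := by
    rw [IsHermitian, conjTranspose_eq_transpose_of_trivial, hA]
  refine ⟨hH.eigenvectorUnitary, hH.eigenvalues, ?_, ?_, ?_⟩
  · simpa [star_eq_conjTranspose, conjTranspose_eq_transpose_of_trivial] using
      (Unitary.mul_star_self_of_mem hH.eigenvectorUnitary.2)
  · simpa [star_eq_conjTranspose, conjTranspose_eq_transpose_of_trivial] using
      (Unitary.star_mul_self_of_mem hH.eigenvectorUnitary.2)
  · conv_lhs => rw [hH.spectral_theorem]
    simp [Unitary.conjStarAlgAut_apply, star_eq_conjTranspose,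
      conjTranspose_eq_transpose_of_trivial]

theorem isUnit_det_of_mul_transpose {O : Matrix n n ℝ} (h : O * Oᵀ = 1) : IsUnit O.det :=
  (isUnit_iff_isUnit_det O).1 (IsUnit.of_mul_eq_one _ h)

theorem exists_orthogonal_diagonal_pos {A : Matrix n n ℝ} (hA : A.PosDef) :
    ∃ (O : Matrix n n ℝ) (d : n → ℝ), O * Oᵀ = 1 ∧ Oᵀ * O = 1 ∧ (∀ i, 0 < d i) ∧
      A = O * diagonal d * Oᵀ := by
  obtain ⟨O, d, h1, h2, h3⟩ := exists_orthogonal_diagonal hA.transpose_eq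
  refine ⟨O, d, h1, h2, ?_, h3⟩
  have h := hA.congr (B := Oᵀ) (by rw [det_transpose]; exact isUnit_det_of_mul_transpose h1)
  have e : Oᵀ * A * Oᵀᵀ = diagonal d := by
    rw [h3, transpose_transpose]
    calc Oᵀ * (O * diagonal d * Oᵀ) * O = (Oᵀ * O) * diagonal d * (Oᵀ * O) := by
          simp only [Matrix.mul_assoc]
      _ = diagonal d := by rw [h2]; simp
  rw [e] at h
  exact posDef_diagonal_iff.1 h

theorem posDef_orthogonal_diagonal {O : Matrix n n ℝ} (hO : O * Oᵀ = 1) {d : n → ℝ}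
    (hd : ∀ i, 0 < d i) : (O * diagonal d * Oᵀ).PosDef :=
  (PosDef.diagonal hd).congr (isUnit_det_of_mul_transpose hO)

/-! ### The symmetric square root -/

theorem exists_isSymmSqrt {A : Matrix n n ℝ} (hA : A.PosDef) : ∃ X, IsSymmSqrt A X := by
  obtain ⟨O, d, h1, h2, hd, h3⟩ := exists_orthogonal_diagonal_pos hA
  refine ⟨O * diagonal (fun i => √(d i)) * Oᵀ,
    posDef_orthogonal_diagonal h1 fun i => Real.sqrt_pos.2 (hd i), ?_⟩
  calc O * diagonal (fun i => √(d i)) * Oᵀ * (O * diagonal (fun i => √(d i)) * Oᵀ)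
      = O * diagonal (fun i => √(d i)) * (Oᵀ * O) * diagonal (fun i => √(d i)) * Oᵀ := by
        simp only [Matrix.mul_assoc]
    _ = A := by
        rw [h2, Matrix.mul_one, Matrix.mul_assoc O, diagonal_mul_diagonal, h3]
        simp only [Real.mul_self_sqrt (hd _).le]

theorem symmSqrt_spec {A : Matrix n n ℝ} (hA : A.PosDef) : IsSymmSqrt A (symmSqrt A) :=
  Classical.epsilon_spec (exists_isSymmSqrt hA)

theorem symmSqrt_posDef {A : Matrix n n ℝ} (hA : A.PosDef) : (symmSqrt A).PosDef :=
  (symmSqrt_spec hA).1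

theorem symmSqrt_mul_self {A : Matrix n n ℝ} (hA : A.PosDef) : symmSqrt A * symmSqrt A = A :=
  (symmSqrt_spec hA).2

theorem eq_zero_of_trace_transpose_mul_self {m : Type} [Fintype m] {M : Matrix m n ℝ}
    (h : (Mᵀ * M).trace = 0) : M = 0 := by
  rwa [← conjTranspose_eq_transpose_of_trivial, trace_conjTranspose_mul_self_eq_zero_iff] at h

theorem trace_transpose_mul_self_nonneg {m : Type} [Fintype m] (M : Matrix m n ℝ) :
    0 ≤ (Mᵀ * M).trace := by
  rw [← conjTranspose_eq_transpose_of_trivial]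
  exact (posSemidef_conjTranspose_mul_self M).trace_nonneg

/-- The trace is the squared Frobenius norm of `C^{1/2} M`, hence nonnegative, and zero only for `M
= 0`. The nondegeneracy arguments below come down to this. -/
theorem trace_conj_eq_sqrt {C : Matrix n n ℝ} (hC : C.PosDef) (M : Matrix n n ℝ) :
    (Mᵀ * C * M).trace = ((symmSqrt C * M)ᵀ * (symmSqrt C * M)).trace := by
  rw [transpose_mul, (symmSqrt_posDef hC).transpose_eq]
  conv_lhs => rw [← symmSqrt_mul_self hC]
  simp only [Matrix.mul_assoc]

theorem trace_conj_nonneg {C : Matrix n n ℝ} (hC : C.PosDef) (M : Matrix n n ℝ) :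
    0 ≤ (Mᵀ * C * M).trace := by
  rw [trace_conj_eq_sqrt hC]; exact trace_transpose_mul_self_nonneg _

theorem eq_zero_of_trace_conj {C : Matrix n n ℝ} (hC : C.PosDef) {M : Matrix n n ℝ}
    (h : (Mᵀ * C * M).trace = 0) : M = 0 := by
  rw [trace_conj_eq_sqrt hC] at h
  have h := eq_zero_of_trace_transpose_mul_self h
  have h2 : (symmSqrt C)⁻¹ * (symmSqrt C * M) = 0 := by rw [h, Matrix.mul_zero]
  rwa [nonsing_inv_mul_cancel_left _ _ (symmSqrt_posDef hC).isUnit_det] at h2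

/-- The homogeneous Sylvester equation with positive definite coefficients. -/
theorem sylvester_eq_zero {X Y D : Matrix n n ℝ} (hX : X.PosDef) (hY : Y.PosDef)
    (h : X * D + D * Y = 0) : D = 0 := by
  -- Pairing the equation with `Dᵀ` writes zero as a sum of two nonnegative quadratic forms in `D`.
  have h1 : (Dᵀ * X * D).trace + (Dᵀᵀ * Y * Dᵀ).trace = 0 := by
    rw [transpose_transpose, trace_mul_comm (D * Y), ← trace_add, Matrix.mul_assoc,
      ← Matrix.mul_add, h]
    simp
  have h2 := trace_conj_nonneg hX D
  have h3 := trace_conj_nonneg hY Dᵀ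
  exact eq_zero_of_trace_conj hX (by linarith)

/-- `X (X - Y) + (X - Y) Y = X² - Y²`, so the difference of two roots solves the homogeneous
Sylvester equation. -/
theorem IsSymmSqrt.unique {A X Y : Matrix n n ℝ} (hX : IsSymmSqrt A X) (hY : IsSymmSqrt A Y) :
    X = Y := by
  refine sub_eq_zero.1 (sylvester_eq_zero hX.1 hY.1 ?_)
  rw [Matrix.mul_sub, Matrix.sub_mul, hX.2, hY.2]
  abel

theorem symmSqrt_eq {A X : Matrix n n ℝ} (hX : IsSymmSqrt A X) : symmSqrt A = X :=
  IsSymmSqrt.unique (Classical.epsilon_spec ⟨X, hX⟩) hX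

theorem symmSqrt_one : symmSqrt (1 : Matrix n n ℝ) = 1 :=
  symmSqrt_eq ⟨PosDef.one, by simp⟩

theorem symmSqrt_kronecker {m : Type} [Fintype m] [DecidableEq m] {A : Matrix n n ℝ}
    {B : Matrix m m ℝ} (hA : A.PosDef) (hB : B.PosDef) :
    symmSqrt (A ⊗ₖ B) = symmSqrt A ⊗ₖ symmSqrt B :=
  symmSqrt_eq ⟨(symmSqrt_posDef hA).kronecker (symmSqrt_posDef hB), by
    rw [← mul_kronecker_mul, symmSqrt_mul_self hA, symmSqrt_mul_self hB]⟩

/-! ### The Cholesky factor -/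

theorem isUnit_det_of_isCholesky {α : Type} [LinearOrder α] {b : n → α} {A X : Matrix n n ℝ}
    (hA : A.PosDef) (hX : IsCholesky b A X) : IsUnit X.det := by
  have h := hA.det_pos
  rw [← hX.2.2, det_mul] at h
  exact (left_ne_zero_of_mul h.ne').isUnit

/-- `BlockTriangular` means upper triangular, so lower triangularity for `b` is expressed with the
dual order of the keys. -/
theorem isCholesky_inv_lower {α : Type} [LinearOrder α] {b : n → α} {X : Matrix n n ℝ}
    (hX : ∀ i j, b i < b j → X i j = 0) (hu : IsUnit X.det) {i j : n} (hij : b i < b j) :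
    X⁻¹ i j = 0 := by
  have : Invertible X := X.invertibleOfIsUnitDet hu
  have h : X.BlockTriangular (OrderDual.toDual ∘ b) := fun i j h => hX i j h
  exact blockTriangular_inv_of_blockTriangular h hij

theorem lower_mul {α : Type} [LinearOrder α] {b : n → α} {X Y : Matrix n n ℝ}
    (hX : ∀ i j, b i < b j → X i j = 0) (hY : ∀ i j, b i < b j → Y i j = 0) (i j : n)
    (hij : b i < b j) : (X * Y) i j = 0 := by
  have h : X.BlockTriangular (OrderDual.toDual ∘ b) := fun i j h => hX i j h
  have h' : Y.BlockTriangular (OrderDual.toDual ∘ b) := fun i j h => hY i j h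
  exact h.mul h' hij

theorem lower_mul_diag {α : Type} [LinearOrder α] {b : n → α} (hb : Function.Injective b)
    {X Y : Matrix n n ℝ} (hX : ∀ i j, b i < b j → X i j = 0)
    (hY : ∀ i j, b i < b j → Y i j = 0) (i : n) : (X * Y) i i = X i i * Y i i := by
  rw [mul_apply, Finset.sum_eq_single i]
  · intro j _ hj
    rcases lt_or_gt_of_ne (hb.ne hj) with h | h
    · rw [hY _ _ h, mul_zero]
    · rw [hX _ _ h, zero_mul]
  · simp

/-- `M = Y⁻¹ X` is lower triangular and orthogonal, so `M⁻¹ = Mᵀ` is lower triangular too and `M` is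
diagonal. Its diagonal is positive with squares one. -/
theorem IsCholesky.unique {α : Type} [LinearOrder α] {b : n → α} (hb : Function.Injective b)
    {A X Y : Matrix n n ℝ} (hA : A.PosDef) (hX : IsCholesky b A X) (hY : IsCholesky b A Y) :
    X = Y := by
  have uX := isUnit_det_of_isCholesky hA hX
  have uY := isUnit_det_of_isCholesky hA hY
  set M := Y⁻¹ * X with hM
  have hlow : ∀ i j, b i < b j → M i j = 0 :=
    lower_mul (fun i j => isCholesky_inv_lower hY.1 uY) hX.1
  have hinv : M * Mᵀ = 1 := by
    rw [hM, transpose_mul, transpose_nonsing_inv]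
    calc Y⁻¹ * X * (Xᵀ * Yᵀ⁻¹) = Y⁻¹ * (X * Xᵀ) * Yᵀ⁻¹ := by simp only [Matrix.mul_assoc]
      _ = (Y⁻¹ * Y) * (Yᵀ * Yᵀ⁻¹) := by rw [hX.2.2, ← hY.2.2]; simp only [Matrix.mul_assoc]
      _ = 1 := by
        rw [nonsing_inv_mul _ uY, mul_nonsing_inv _ (by rwa [det_transpose]), Matrix.mul_one]
  have uM := isUnit_det_of_mul_transpose hinv
  have hMi : M⁻¹ = Mᵀ := inv_eq_right_inv hinv
  have hup : ∀ i j, b i < b j → M j i = 0 := fun i j h => by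
    have := isCholesky_inv_lower hlow uM h
    rwa [hMi] at this
  have hYM : Y * M = X := by rw [hM, mul_nonsing_inv_cancel_left _ _ uY]
  have hMd : ∀ i, M i i = 1 := fun i => by
    have h1 : (M * M) i i = M i i * M i i := lower_mul_diag hb hlow hlow i
    have hsym : Mᵀ = M := by
      ext i j
      rcases lt_trichotomy (b i) (b j) with h | h | h
      · rw [transpose_apply, hup _ _ h, hlow _ _ h]
      · rw [hb h]; rfl
      · rw [transpose_apply, hup _ _ h, hlow _ _ h]
    rw [hsym] at hinv
    rw [hinv, one_apply_eq] at h1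
    have h2 : X i i = Y i i * M i i := by rw [← hYM, lower_mul_diag hb hY.1 hlow]
    have h3 := hX.2.1 i
    have h4 := hY.2.1 i
    have h5 : 0 < M i i := by
      rw [h2] at h3; exact (pos_iff_pos_of_mul_pos h3).1 h4
    nlinarith
  have hM1 : M = 1 := by
    ext i j
    rcases lt_trichotomy (b i) (b j) with h | h | h
    · rw [hlow _ _ h, one_apply_ne (fun e => by rw [e] at h; exact lt_irrefl _ h)]
    · rw [hb h, hMd, one_apply_eq]
    · rw [hup _ _ h, one_apply_ne (fun e => by rw [e] at h; exact lt_irrefl _ h)]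
  rw [← hYM, hM1, Matrix.mul_one]

end Generic

/-- The factor comes from the LDL decomposition for the order pulled back along `b`, with the square
roots of the positive diagonal entries absorbed into `L`. -/
theorem exists_isCholesky {n : Type} [Fintype n] {α : Type} [LinearOrder α] {b : n → α} (hb : Function.Injective b)
    {A : Matrix n n ℝ} (hA : A.PosDef) : ∃ X, IsCholesky b A X := by
  let _ : LinearOrder n := LinearOrder.lift' b hb
  let _ : LocallyFiniteOrderBot n := by
    classical
    exact LocallyFiniteOrderBot.ofIic n (fun a => Finset.univ.filter (· ≤ a)) (by simp)
  set L := LDL.lower hA with hL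
  have uLi : IsUnit (LDL.lowerInv hA).det :=
    (isUnit_iff_isUnit_det _).1 (isUnit_of_invertible (LDL.lowerInv hA))
  have uL : IsUnit L.det := by
    rw [hL, LDL.lower, isUnit_nonsing_inv_det_iff]; exact uLi
  have hlow : ∀ i j, b i < b j → L i j = 0 := fun i j h =>
    isCholesky_inv_lower (b := b) (fun i j h => LDL.lowerInv_triangular hA h) uLi h
  have hD : (LDL.diag hA).PosDef := by
    rw [LDL.diag_eq_lowerInv_conj, conjTranspose_eq_transpose_of_trivial]
    exact hA.congr uLi
  have hd : ∀ i, 0 < LDL.diagEntries hA i := posDef_diagonal_iff.1 hD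
  have hdiag : ∀ i, L i i ≠ 0 := by
    have h : L.BlockTriangular (OrderDual.toDual ∘ b) := fun i j h => hlow i j h
    have h2 : L.det = ∏ i, L i i := det_of_isLowerTriangular L (fun i j h => hlow i j h)
    rw [h2] at uL
    exact fun i => (Finset.prod_ne_zero_iff.1 uL.ne_zero) i (Finset.mem_univ i)
  -- Only `L i i ≠ 0` has been shown. Multiplying each column by the sign of its diagonal entry
  -- makes the diagonal positive and cancels in `X Xᵀ`.
  refine ⟨L * diagonal (fun i => √(LDL.diagEntries hA i) * SignType.sign (L i i)), ?_, ?_, ?_⟩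
  · intro i j h
    rw [mul_diagonal, hlow _ _ h, zero_mul]
  · intro i
    rw [mul_diagonal]
    have h1 := Real.sqrt_pos.2 (hd i)
    have h2 : 0 < L i i * SignType.sign (L i i) := by
      rw [self_mul_sign]; exact abs_pos.2 (hdiag i)
    calc 0 < √(LDL.diagEntries hA i) * (L i i * SignType.sign (L i i)) := mul_pos h1 h2
      _ = _ := by ring
  · conv_rhs => rw [← LDL.lower_conj_diag hA]
    rw [transpose_mul, diagonal_transpose, conjTranspose_eq_transpose_of_trivial, ← hL,
      ← Matrix.mul_assoc, Matrix.mul_assoc L, diagonal_mul_diagonal, LDL.diag]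
    congr 3
    ext i
    have h1 : (SignType.sign (L i i) : ℝ) * SignType.sign (L i i) = 1 := by
      rcases lt_or_gt_of_ne (hdiag i) with h | h
      · simp [sign_neg h]
      · simp [sign_pos h]
    calc _ = (√(LDL.diagEntries hA i) * √(LDL.diagEntries hA i)) *
          ((SignType.sign (L i i) : ℝ) * SignType.sign (L i i)) := by ring
      _ = _ := by rw [h1, Real.mul_self_sqrt (hd i).le, mul_one]

section Generic

variable {n : Type} [Fintype n] [DecidableEq n]

theorem choleskyFactor_spec {α : Type} [LinearOrder α] {b : n → α} (hb : Function.Injective b)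
    {A : Matrix n n ℝ} (hA : A.PosDef) : IsCholesky b A (choleskyFactor b A) :=
  Classical.epsilon_spec (exists_isCholesky hb hA)

theorem choleskyFactor_eq {α : Type} [LinearOrder α] {b : n → α} (hb : Function.Injective b)
    {A X : Matrix n n ℝ} (hA : A.PosDef) (hX : IsCholesky b A X) : choleskyFactor b A = X :=
  IsCholesky.unique hb hA (choleskyFactor_spec hb hA) hX

end Generic

theorem toLex_idx_injective (p₁ p₂ : ℕ) : Function.Injective (fun x : Idx p₁ p₂ => toLex x) :=
  toLex.injective

/-- For the lexicographic order of the pairs, an index inequality is strict in the first coordinate,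
or equal there and strict in the second. Accordingly the entry of one of the two triangular factors
vanishes. -/
theorem choleskyFactor_kronecker {p₁ p₂ : ℕ} {A : Matrix (Fin p₁) (Fin p₁) ℝ}
    {B : Matrix (Fin p₂) (Fin p₂) ℝ} (hA : A.PosDef) (hB : B.PosDef) :
    choleskyFactor (fun x : Idx p₁ p₂ => toLex x) (B ⊗ₖ A)
      = choleskyFactor (id : Fin p₂ → Fin p₂) B ⊗ₖ choleskyFactor (id : Fin p₁ → Fin p₁) A := by
  have sA := choleskyFactor_spec Function.injective_id hA
  have sB := choleskyFactor_spec Function.injective_id hB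
  refine choleskyFactor_eq (toLex_idx_injective p₁ p₂) (hB.kronecker hA) ⟨?_, ?_, ?_⟩
  · rintro ⟨i, a⟩ ⟨j, c⟩ h
    rw [kroneckerMap_apply]
    rcases Prod.Lex.lt_iff.1 h with h | ⟨h1, h2⟩
    · exact mul_eq_zero_of_left (sB.1 i j h) _
    · exact mul_eq_zero_of_right _ (sA.1 a c h2)
  · rintro ⟨i, a⟩
    exact mul_pos (sB.2.1 i) (sA.2.1 a)
  · rw [← kroneckerMap_transpose, ← mul_kronecker_mul, sA.2.2, sB.2.2]

/-! ### Differential calculus of matrix-valued maps. -/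

section Calculus

variable {E F G : Type*} [NormedAddCommGroup E] [NormedSpace ℝ E] [NormedAddCommGroup F]
  [NormedSpace ℝ F] [NormedAddCommGroup G] [NormedSpace ℝ G]

theorem hasDerivAt_linearMap [FiniteDimensional ℝ E] (l : E →ₗ[ℝ] F) {f : ℝ → E} {f' : E} {t : ℝ}
    (h : HasDerivAt f f' t) : HasDerivAt (fun s => l (f s)) (l f') t :=
  (LinearMap.toContinuousLinearMap l).hasFDerivAt.comp_hasDerivAt t h

theorem contDiff_linearMap [FiniteDimensional ℝ E] (l : E →ₗ[ℝ] F) : ContDiff ℝ ∞ l :=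
  (LinearMap.toContinuousLinearMap l).contDiff

theorem hasDerivAt_bilinear [FiniteDimensional ℝ E] [FiniteDimensional ℝ F]
    (l : E →ₗ[ℝ] F →ₗ[ℝ] G) {f : ℝ → E} {f' : E} {g : ℝ → F} {g' : F} {t : ℝ}
    (hf : HasDerivAt f f' t) (hg : HasDerivAt g g' t) :
    HasDerivAt (fun s => l (f s) (g s)) (l f' (g t) + l (f t) g') t :=
  (l.toContinuousBilinearMap.hasFDerivAt.comp_hasDerivAt t hf).clm_apply hg

theorem contDiffAt_bilinear {H : Type*} [NormedAddCommGroup H] [NormedSpace ℝ H]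
    [FiniteDimensional ℝ E] [FiniteDimensional ℝ F]
    (l : E →ₗ[ℝ] F →ₗ[ℝ] G) {f : H → E} {g : H → F} {x : H}
    (hf : ContDiffAt ℝ ∞ f x) (hg : ContDiffAt ℝ ∞ g x) :
    ContDiffAt ℝ ∞ (fun s => l (f s) (g s)) x :=
  (l.toContinuousBilinearMap.contDiff.contDiffAt.comp x hf).clm_apply hg

/-- The implicit function theorem for an equation `Φ (x, y) = 0` with as many equations as
unknowns, in finite dimension. -/
theorem exists_implicit [FiniteDimensional ℝ E] [FiniteDimensional ℝ F]
    {Φ : E × F → F} {u : E × F} (hΦ : ContDiffAt ℝ ∞ Φ u) (h0 : Φ u = 0)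
    (hinj : ∀ w : F, fderiv ℝ Φ u (0, w) = 0 → w = 0) :
    ∃ ψ : E → F, ContDiffAt ℝ ∞ ψ u.1 ∧ ψ u.1 = u.2 ∧ (∀ᶠ x in 𝓝 u.1, Φ (x, ψ x) = 0) ∧
      ∀ᶠ v in 𝓝 u, Φ v = 0 → ψ v.1 = v.2 := by
  have : CompleteSpace E := FiniteDimensional.complete ℝ E
  have : CompleteSpace F := FiniteDimensional.complete ℝ F
  have hne : (∞ : ℕ∞ω) ≠ 0 := by simp
  have hinv : (fderiv ℝ Φ u ∘L .inr ℝ E F).IsInvertible := by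
    -- Unknowns and equations live in the same finite-dimensional space, so injectivity of the
    -- partial derivative is enough for invertibility.
    have hi : Function.Injective (fderiv ℝ Φ u ∘L .inr ℝ E F).toLinearMap := by
      rw [← LinearMap.ker_eq_bot, LinearMap.ker_eq_bot']
      exact fun w hw => hinj w hw
    refine ⟨(LinearEquiv.ofInjectiveEndo _ hi).toContinuousLinearEquiv, ?_⟩
    ext w
    rfl
  refine ⟨hΦ.implicitFunction hne hinv, hΦ.contDiffAt_implicitFunction hne hinv,
    hΦ.implicitFunction_apply_self hne hinv, ?_, ?_⟩
  · simpa only [h0] using hΦ.eventually_apply_implicitFunction hne hinv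
  -- Local uniqueness: zeros of `Φ` near `u` lie on the graph of `ψ`. It is what later forces an
  -- implicitly defined matrix to be symmetric.
  · filter_upwards [hΦ.eventually_apply_eq_iff_implicitFunction hne hinv] with v hv h
    exact hv.1 (by rw [h, h0])

/-- Evaluates a Fréchet derivative along a curve, so that the injectivity hypothesis of the implicit
function theorem is checked by one-variable calculus. -/
theorem fderiv_apply_eq_of_hasDerivAt {f : E → F} {x v : E} {f' : F} {c : ℝ → E}
    (hf : DifferentiableAt ℝ f x) (hc : HasDerivAt c v 0) (h0 : c 0 = x)
    (h : HasDerivAt (fun t : ℝ => f (c t)) f' 0) : fderiv ℝ f x v = f' := by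
  subst h0
  exact (hf.hasFDerivAt.comp_hasDerivAt (0 : ℝ) hc).unique h

theorem hasDerivAt_line {f : E → F} {x : E} (v : E) (hf : DifferentiableAt ℝ f x) :
    HasDerivAt (fun t : ℝ => f (x + t • v)) (fderiv ℝ f x v) 0 := by
  have h1 : HasDerivAt (fun t : ℝ => x + t • v) v 0 := by
    simpa using ((hasDerivAt_id (0 : ℝ)).smul_const v).const_add x
  have h2 : HasFDerivAt f (fderiv ℝ f x) (x + (0 : ℝ) • v) := by
    simpa using hf.hasFDerivAt
  exact h2.comp_hasDerivAt (0 : ℝ) h1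

theorem tendsto_line (x v : E) : Filter.Tendsto (fun t : ℝ => x + t • v) (𝓝 0) (𝓝 x) := by
  have : Continuous (fun t : ℝ => x + t • v) := by fun_prop
  simpa using this.tendsto 0

theorem hasDerivAt_line_self (x v : E) (t : ℝ) : HasDerivAt (fun t : ℝ => x + t • v) v t := by
  simpa using ((hasDerivAt_id t).smul_const v).const_add x

variable {n m : Type} [Fintype n] [DecidableEq n] [Fintype m] [DecidableEq m]

theorem hasDerivAt_transpose {A : ℝ → Matrix n n ℝ} {A' : Matrix n n ℝ} {t : ℝ}
    (h : HasDerivAt A A' t) : HasDerivAt (fun s => (A s)ᵀ) A'ᵀ t :=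
  hasDerivAt_linearMap (transposeLinearEquiv n n ℝ ℝ).toLinearMap h

theorem hasDerivAt_trace {A : ℝ → Matrix n n ℝ} {A' : Matrix n n ℝ} {t : ℝ}
    (h : HasDerivAt A A' t) : HasDerivAt (fun s => (A s).trace) A'.trace t :=
  hasDerivAt_linearMap (traceLinearMap n ℝ ℝ) h

/-- The Kronecker product of square matrices as a bilinear map. -/
noncomputable def kroneckerLinear (n m : Type) [Fintype n] [Fintype m] :
    Matrix n n ℝ →ₗ[ℝ] Matrix m m ℝ →ₗ[ℝ] Matrix (n × m) (n × m) ℝ :=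
  LinearMap.mk₂ ℝ (fun A B => A ⊗ₖ B) add_kronecker (fun c A B => smul_kronecker c A B)
    kronecker_add (fun c A B => kronecker_smul c A B)

theorem hasDerivAt_kronecker {A : ℝ → Matrix n n ℝ} {A' : Matrix n n ℝ} {B : ℝ → Matrix m m ℝ}
    {B' : Matrix m m ℝ} {t : ℝ} (hA : HasDerivAt A A' t) (hB : HasDerivAt B B' t) :
    HasDerivAt (fun s => A s ⊗ₖ B s) (A' ⊗ₖ B t + A t ⊗ₖ B') t := by
  have h := hasDerivAt_bilinear (kroneckerLinear n m) hA hB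
  exact h

theorem contDiffAt_kronecker {f : E → Matrix n n ℝ} {g : E → Matrix m m ℝ} {x : E}
    (hf : ContDiffAt ℝ ∞ f x) (hg : ContDiffAt ℝ ∞ g x) :
    ContDiffAt ℝ ∞ (fun s => f s ⊗ₖ g s) x := by
  have h := contDiffAt_bilinear (kroneckerLinear n m) hf hg
  exact h

theorem contDiffAt_matrix_inv {f : E → Matrix n n ℝ} {x : E} (hf : ContDiffAt ℝ ∞ f x)
    (hu : IsUnit (f x).det) : ContDiffAt ℝ ∞ (fun s => (f s)⁻¹) x := by
  obtain ⟨u, hu⟩ := (isUnit_iff_isUnit_det _).2 hu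
  have h := contDiffAt_ringInverse ℝ (n := ∞) u
  rw [hu] at h
  simp only [nonsing_inv_eq_ringInverse]
  exact h.comp x hf

theorem hasDerivAt_matrix_inv {A : ℝ → Matrix n n ℝ} {A' : Matrix n n ℝ} {t : ℝ}
    (h : HasDerivAt A A' t) (hu : IsUnit (A t).det) :
    HasDerivAt (fun s => (A s)⁻¹) (-((A t)⁻¹ * A' * (A t)⁻¹)) t := by
  obtain ⟨u, hu⟩ := (isUnit_iff_isUnit_det _).2 hu
  have h1 := hasFDerivAt_ringInverse (𝕜 := ℝ) u
  have h2 : ((u⁻¹ : (Matrix n n ℝ)ˣ) : Matrix n n ℝ) = (A t)⁻¹ := by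
    rw [← hu, coe_units_inv]
  rw [hu, h2] at h1
  simp only [nonsing_inv_eq_ringInverse] at h1 ⊢
  exact h1.comp_hasDerivAt t h

theorem contDiff_det : ContDiff ℝ ∞ (fun A : Matrix n n ℝ => A.det) := by
  simp only [det_apply]
  refine ContDiff.sum fun σ _ => ContDiff.const_smul _ (contDiff_prod fun i _ => ?_)
  exact contDiff_linearMap (entryLinearMap ℝ ℝ (σ i) i)

/-- By Cramer's rule, the determinant with row `i` replaced is the pairing of the new row with
column `i` of the adjugate. -/
theorem sum_det_updateRow (A B : Matrix n n ℝ) :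
    ∑ i, (A.updateRow i (B i)).det = (A.adjugate * B).trace := by
  have h : ∀ i, (A.updateRow i (B i)).det = ∑ j, A.adjugate j i * B i j := fun i => by
    rw [← det_transpose, ← updateCol_transpose, ← cramer_apply, cramer_eq_adjugate_mulVec,
      ← adjugate_transpose]
    rfl
  simp only [h, trace, diag, mul_apply]
  exact Finset.sum_comm

/-- Jacobi's formula. -/
theorem hasDerivAt_det {A : ℝ → Matrix n n ℝ} {A' : Matrix n n ℝ} {t : ℝ}
    (h : HasDerivAt A A' t) : HasDerivAt (fun s => (A s).det) ((A t).adjugate * A').trace t := by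
  -- The determinant is multilinear in the rows, so its derivative is the sum of the determinants
  -- with one row replaced.
  let f : ContinuousMultilinearMap ℝ (fun _ : n => n → ℝ) ℝ :=
    ⟨(detRowAlternating (R := ℝ) (n := n)).toMultilinearMap, by
      exact Continuous.matrix_det continuous_id⟩
  have h1 := hasDerivAt_linearMap (ofLinearEquiv (m := n) (n := n) (α := ℝ) ℝ).symm.toLinearMap h
  have h2 := (f.hasFDerivAt ((ofLinearEquiv ℝ).symm (A t))).comp_hasDerivAt t h1
  rw [← sum_det_updateRow]
  convert! h2 using 1
  rw [ContinuousMultilinearMap.linearDeriv_apply]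
  rfl

theorem adjugate_eq_det_smul_inv {A : Matrix n n ℝ} (hA : IsUnit A.det) :
    A.adjugate = A.det • A⁻¹ := by
  rw [inv_def, smul_smul, Ring.mul_inverse_cancel _ hA, one_smul]

theorem hasDerivAt_log_det {A : ℝ → Matrix n n ℝ} {A' : Matrix n n ℝ} {t : ℝ}
    (h : HasDerivAt A A' t) (hA : IsUnit (A t).det) :
    HasDerivAt (fun s => Real.log (A s).det) ((A t)⁻¹ * A').trace t := by
  convert! (hasDerivAt_det h).log hA.ne_zero using 1
  rw [adjugate_eq_det_smul_inv hA, smul_mul, trace_smul, smul_eq_mul,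
    mul_div_cancel_left₀ _ hA.ne_zero]

/-! ### Symmetric matrices -/

/-- The projection of a matrix to its symmetric part. -/
noncomputable def toSym : Matrix n n ℝ →ₗ[ℝ] Sym n where
  toFun A := ⟨(1 / 2 : ℝ) • (A + Aᵀ), by
    change ((1 / 2 : ℝ) • (A + Aᵀ))ᵀ = _
    rw [transpose_smul, transpose_add, transpose_transpose, add_comm]⟩
  map_add' A B := by
    ext1
    simp only [transpose_add, Submodule.coe_add, ← smul_add]
    congr 1
    abel
  map_smul' c A := by
    ext1
    simp only [transpose_smul, Submodule.coe_smul, RingHom.id_apply, ← smul_add]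
    rw [smul_comm]

theorem toSym_coe (A : Sym n) : toSym (A : Matrix n n ℝ) = A := by
  ext1
  have h : (A : Matrix n n ℝ)ᵀ = A := A.2
  change (1 / 2 : ℝ) • ((A : Matrix n n ℝ) + (A : Matrix n n ℝ)ᵀ) = A
  rw [h, ← two_smul ℝ, smul_smul]
  norm_num

theorem coe_transpose (A : Sym n) : (A : Matrix n n ℝ)ᵀ = A := A.2

theorem hasDerivAt_coe {A : ℝ → Sym n} {A' : Sym n} {t : ℝ} (h : HasDerivAt A A' t) :
    HasDerivAt (fun s => (A s : Matrix n n ℝ)) (A' : Matrix n n ℝ) t :=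
  hasDerivAt_linearMap (Sym n).subtype h

theorem contDiff_coe : ContDiff ℝ ∞ (fun A : Sym n => (A : Matrix n n ℝ)) :=
  contDiff_linearMap (Sym n).subtype

/-- Symmetrization is a linear retraction onto the symmetric matrices, so smoothness may be checked
in the space of all matrices. -/
theorem contDiffAt_sym_of_coe {f : E → Sym n} {x : E}
    (h : ContDiffAt ℝ ∞ (fun y => (f y : Matrix n n ℝ)) x) : ContDiffAt ℝ ∞ f x := by
  have := (contDiff_linearMap (toSym (n := n))).contDiffAt.comp x h
  simpa only [Function.comp_def, toSym_coe] using this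

/-- By compactness of the unit sphere the quadratic form stays positive on it for all matrices near
`A`, and homogeneity gives the other vectors. Symmetry is not an open condition and has to be
supplied for each `B`. -/
theorem eventually_posDef {A : Matrix n n ℝ} (hA : A.PosDef) :
    ∀ᶠ B in 𝓝 A, Bᵀ = B → B.PosDef := by
  have hc : Continuous (fun q : Matrix n n ℝ × (n → ℝ) => q.2 ⬝ᵥ q.1 *ᵥ q.2) := by
    fun_prop
  have hK : IsCompact (Metric.sphere (0 : n → ℝ) 1) := isCompact_sphere 0 1
  have h := hK.eventually_forall_of_forall_eventually (x₀ := A)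
    (P := fun B x => 0 < x ⬝ᵥ B *ᵥ x) fun x hx =>
      hc.continuousAt.eventually (lt_mem_nhds ((posDef_iff_real.1 hA).2 x
        (by rintro rfl; simp at hx)))
  filter_upwards [h] with B hB hs
  refine posDef_iff_real.2 ⟨hs, fun x hx => ?_⟩
  have hn : 0 < ‖x‖ := norm_pos_iff.2 hx
  have h1 := hB (‖x‖⁻¹ • x) (by simp [norm_smul, hn.ne'])
  rw [mulVec_smul, dotProduct_smul, smul_dotProduct, smul_smul, smul_eq_mul] at h1
  exact (pos_iff_pos_of_mul_pos h1).1 (by positivity)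

theorem isOpen_SPD : IsOpen (SPD n) := by
  rw [isOpen_iff_mem_nhds]
  intro A hA
  filter_upwards [(contDiff_coe (n := n)).continuous.continuousAt.eventually (eventually_posDef hA)] with B hB
  exact hB B.2

end Calculus

/-! ### Smoothness and derivatives of the two roots. -/

section SquareRoots

variable {n : Type} [Fintype n] [DecidableEq n]

/-- Implicit function theorem for `Y² = A`: the linearization `w ↦ X w + w X` is injective by the
Sylvester lemma. -/
theorem contDiffAt_symmSqrt {K : Sym n} (hK : K ∈ SPD n) :
    ContDiffAt ℝ ∞ (fun A : Sym n => symmSqrt (A : Matrix n n ℝ)) K := by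
  set X := symmSqrt (K : Matrix n n ℝ) with hX
  have hXp : X.PosDef := symmSqrt_posDef hK
  have hXX : X * X = K := symmSqrt_mul_self hK
  let Φ : Sym n × Matrix n n ℝ → Matrix n n ℝ := fun v => v.2 * v.2 - (v.1 : Matrix n n ℝ)
  have hΦ : ContDiff ℝ ∞ Φ :=
    (contDiff_snd.mul contDiff_snd).sub (contDiff_coe.comp contDiff_fst)
  obtain ⟨ψ, hψ, hψ0, hψ1, hψ2⟩ := exists_implicit (Φ := Φ) (u := (K, X)) hΦ.contDiffAt
    (sub_eq_zero.2 hXX) (by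
      intro w hw
      have h2 := hasDerivAt_line_self X w 0
      have h3 := (h2.mul h2).sub_const (K : Matrix n n ℝ)
      have h4 := fderiv_apply_eq_of_hasDerivAt (hΦ.differentiable (by simp) (K, X))
        ((hasDerivAt_const 0 K).prodMk h2) (by simp) h3
      simp only [zero_smul, add_zero] at h4
      exact sylvester_eq_zero hXp hXp (by rw [add_comm]; exact h4.symm.trans hw))
  simp only at hψ hψ0 hψ1
  have hcont : ContinuousAt ψ K := hψ.continuousAt
  -- The unknown ranges over all matrices. The transpose of a root of a symmetric matrix is again a
  -- root near `X`, so local uniqueness makes `ψ A` symmetric.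
  have htr : ∀ᶠ A in 𝓝 K, (ψ A)ᵀ = ψ A := by
    have hT : Filter.Tendsto (fun A => (A, (ψ A)ᵀ)) (𝓝 K) (𝓝 (K, X)) := by
      have h1 : Filter.Tendsto (fun A => (ψ A)ᵀ) (𝓝 K) (𝓝 (ψ K)ᵀ) :=
        (continuous_id.matrix_transpose.tendsto (ψ K)).comp hcont
      rw [hψ0, hXp.transpose_eq] at h1
      exact Filter.tendsto_id.prodMk_nhds h1
    filter_upwards [hT.eventually hψ2, hψ1] with A h1 h2
    refine (h1 ?_).symm
    have h3 : (Φ (A, ψ A))ᵀ = 0 := by rw [h2, transpose_zero]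
    rw [← h3]
    simp only [Φ, transpose_sub, transpose_mul, coe_transpose]
  have hpd : ∀ᶠ A in 𝓝 K, (ψ A).PosDef := by
    have h1 := hcont.eventually (hψ0 ▸ eventually_posDef hXp)
    filter_upwards [h1, htr] with A h2 h3 using h2 h3
  refine hψ.congr_of_eventuallyEq ?_
  filter_upwards [hpd, hψ1] with A h1 h2
  exact symmSqrt_eq ⟨h1, sub_eq_zero.1 h2⟩

/-- A lower triangular matrix is determined by its symmetric part. -/
theorem lower_eq_of_add_transpose {α : Type} [LinearOrder α] {b : n → α}
    (hb : Function.Injective b) {N W : Matrix n n ℝ} (hN : ∀ i j, b i < b j → N i j = 0)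
    (h : N + Nᵀ = W) :
    N = of fun i j => if b j < b i then W i j else if i = j then W i j / 2 else 0 := by
  ext i j
  have hij : N i j + N j i = W i j := by rw [← h]; rfl
  rw [of_apply]
  rcases lt_trichotomy (b i) (b j) with h | h | h
  · rw [if_neg h.not_gt, if_neg (fun e => by rw [e] at h; exact lt_irrefl _ h), hN _ _ h]
  · have e := hb h
    subst e
    rw [if_neg (lt_irrefl _), if_pos rfl]
    linarith
  · rw [if_pos h, ← hij, hN _ _ h, add_zero]

/-- The linear map that takes the strictly upper triangular part from the second matrix and the
rest from the first one. -/
def spliceUpper {α : Type} [LinearOrder α] (b : n → α) :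
    Matrix n n ℝ × Matrix n n ℝ →ₗ[ℝ] Matrix n n ℝ where
  toFun v := of fun i j => if b i < b j then v.2 i j else v.1 i j
  map_add' v w := by
    ext i j
    by_cases h : b i < b j <;> simp [h]
  map_smul' c v := by
    ext i j
    by_cases h : b i < b j <;> simp [h]

/-- A symmetric matrix is determined by its entries on and below the diagonal, so the upper slots
are free to hold the triangularity conditions. -/
theorem spliceUpper_eq_zero {α : Type} [LinearOrder α] {b : n → α} {Y X : Matrix n n ℝ}
    (hY : Yᵀ = Y) (h : spliceUpper b (Y, X) = 0) : Y = 0 ∧ ∀ i j, b i < b j → X i j = 0 := by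
  have h1 : ∀ i j, (if b i < b j then X i j else Y i j) = 0 := fun i j => congr_fun₂ h i j
  refine ⟨?_, fun i j hij => by simpa [hij] using h1 i j⟩
  ext i j
  rcases lt_or_ge (b i) (b j) with hij | hij
  · rw [← hY]
    simpa [hij.not_gt] using h1 j i
  · simpa [hij.not_gt] using h1 i j

theorem spliceUpper_eq_zero_of {α : Type} [LinearOrder α] {b : n → α} {X : Matrix n n ℝ}
    (hX : ∀ i j, b i < b j → X i j = 0) : spliceUpper b (0, X) = 0 := by
  ext i j
  change (if b i < b j then X i j else 0) = 0
  split_ifs with h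
  · exact hX i j h
  · rfl

/-- The equation `X Xᵀ = A` is symmetric and leaves the strictly upper slots redundant. Filling them
with the upper entries of `X` gives as many equations as unknowns and encodes triangularity at the
same time. -/
theorem contDiffAt_choleskyFactor {α : Type} [LinearOrder α] {b : n → α}
    (hb : Function.Injective b) {K : Sym n} (hK : K ∈ SPD n) :
    ContDiffAt ℝ ∞ (fun A : Sym n => choleskyFactor b (A : Matrix n n ℝ)) K := by
  set X := choleskyFactor b (K : Matrix n n ℝ) with hX
  have hXs : IsCholesky b K X := choleskyFactor_spec hb hK
  have uX := isUnit_det_of_isCholesky hK hXs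
  let Φ : Sym n × Matrix n n ℝ → Matrix n n ℝ :=
    fun v => spliceUpper b (v.2 * v.2ᵀ - (v.1 : Matrix n n ℝ), v.2)
  have hΦ : ContDiff ℝ ∞ Φ := by
    refine (contDiff_linearMap (spliceUpper b)).comp (ContDiff.prodMk ?_ contDiff_snd)
    exact (contDiff_snd.mul ((contDiff_linearMap
      (transposeLinearEquiv n n ℝ ℝ).toLinearMap).comp contDiff_snd)).sub
      (contDiff_coe.comp contDiff_fst)
  obtain ⟨ψ, hψ, hψ0, hψ1, -⟩ := exists_implicit (Φ := Φ) (u := (K, X)) hΦ.contDiffAt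
    (by simp only [Φ, sub_eq_zero.2 hXs.2.2]; exact spliceUpper_eq_zero_of hXs.1) (by
      intro w hw
      have h2 := hasDerivAt_line_self X w 0
      have h3 := (h2.mul (hasDerivAt_transpose h2)).sub_const (K : Matrix n n ℝ)
      have h4 := fderiv_apply_eq_of_hasDerivAt (hΦ.differentiable (by simp) (K, X))
        ((hasDerivAt_const 0 K).prodMk h2) (by simp)
        (hasDerivAt_linearMap (spliceUpper b) (h3.prodMk h2))
      simp only [zero_smul, add_zero] at h4
      replace hw := h4.symm.trans hw
      obtain ⟨h3, h4⟩ := spliceUpper_eq_zero (by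
        rw [transpose_add, transpose_mul, transpose_mul, transpose_transpose,
          transpose_transpose, add_comm]) hw
      -- For `w` in the kernel of the linearization, `X⁻¹ w` is both lower triangular and
      -- antisymmetric, hence zero.
      have h5 : X⁻¹ * w + (X⁻¹ * w)ᵀ = 0 := by
        have uXt : IsUnit Xᵀ.det := by rwa [det_transpose]
        have h6 : X⁻¹ * (w * Xᵀ + X * wᵀ) * Xᵀ⁻¹ = X⁻¹ * w + wᵀ * Xᵀ⁻¹ := by
          rw [Matrix.mul_add, Matrix.add_mul, nonsing_inv_mul_cancel_left _ _ uX,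
            ← Matrix.mul_assoc, mul_nonsing_inv_cancel_right _ _ uXt]
        rw [transpose_mul, transpose_nonsing_inv, ← h6, h3]
        simp
      have h6 := lower_eq_of_add_transpose hb
        (lower_mul (fun i j => isCholesky_inv_lower hXs.1 uX) h4) h5
      have h7 : X⁻¹ * w = 0 := by
        rw [h6]; ext i j; simp
      rw [← mul_nonsing_inv_cancel_left X w uX, h7, Matrix.mul_zero])
  simp only at hψ hψ0 hψ1
  have hcont : ContinuousAt ψ K := hψ.continuousAt
  have hdiag : ∀ᶠ A in 𝓝 K, ∀ i, 0 < ψ A i i := by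
    rw [Filter.eventually_all]
    intro i
    have hc : Continuous (fun A : Matrix n n ℝ => A i i) := continuous_id.matrix_elem i i
    exact (hc.continuousAt.comp hcont).eventually (lt_mem_nhds (by
      simpa [hψ0] using hXs.2.1 i))
  refine hψ.congr_of_eventuallyEq ?_
  filter_upwards [hdiag, hψ1, isOpen_SPD.mem_nhds hK] with A h1 h2 h3
  obtain ⟨h4, h5⟩ := spliceUpper_eq_zero (by
    rw [transpose_sub, transpose_mul, transpose_transpose, coe_transpose]) h2
  exact choleskyFactor_eq hb h3 ⟨h5, h1, sub_eq_zero.1 h4⟩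

/-- The derivative of the Cholesky factor. -/
theorem inv_mul_fderiv_choleskyFactor {α : Type} [LinearOrder α] {b : n → α}
    (hb : Function.Injective b) {K : Sym n} (hK : K ∈ SPD n) (W : Sym n) :
    let L := choleskyFactor b (K : Matrix n n ℝ)
    let Z := L⁻¹ * (W : Matrix n n ℝ) * L⁻¹ᵀ
    L⁻¹ * fderiv ℝ (fun A : Sym n => choleskyFactor b (A : Matrix n n ℝ)) K W
      = of fun i j => if b j < b i then Z i j else if i = j then Z i j / 2 else 0 := by
  intro L Z
  set D := fderiv ℝ (fun A : Sym n => choleskyFactor b (A : Matrix n n ℝ)) K W with hD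
  have hLs : IsCholesky b K L := choleskyFactor_spec hb hK
  have uL : IsUnit L.det := isUnit_det_of_isCholesky hK hLs
  have h1 : HasDerivAt (fun t : ℝ => choleskyFactor b ((K + t • W : Sym n) : Matrix n n ℝ)) D 0 :=
    hasDerivAt_line W ((contDiffAt_choleskyFactor hb hK).differentiableAt (by simp))
  have hev : ∀ᶠ t : ℝ in 𝓝 0, K + t • W ∈ SPD n :=
    (tendsto_line K W).eventually (isOpen_SPD.mem_nhds hK)
  have hlow : ∀ i j, b i < b j → D i j = 0 := by
    intro i j hij
    have h2 := hasDerivAt_linearMap (entryLinearMap ℝ ℝ i j) h1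
    refine h2.unique ((hasDerivAt_const (0 : ℝ) (0 : ℝ)).congr_of_eventuallyEq ?_)
    filter_upwards [hev] with t ht
    exact (choleskyFactor_spec hb ht).1 i j hij
  have hsum : D * Lᵀ + L * Dᵀ = W := by
    have h2 := h1.mul (hasDerivAt_transpose h1)
    simp only [zero_smul, add_zero] at h2
    refine h2.unique ((hasDerivAt_line_self (K : Matrix n n ℝ) W 0).congr_of_eventuallyEq ?_)
    filter_upwards [hev] with t ht
    exact (choleskyFactor_spec hb ht).2.2
  -- `L⁻¹ D` is lower triangular, and differentiating `L Lᵀ = K + t W` shows that it and its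
  -- transpose add up to `L⁻¹ W L⁻ᵀ`.
  refine lower_eq_of_add_transpose hb
    (lower_mul (fun i j => isCholesky_inv_lower hLs.1 uL) hlow) ?_
  have uLt : IsUnit Lᵀ.det := by rwa [det_transpose]
  simp only [Z]
  rw [← hsum, transpose_mul, transpose_nonsing_inv, Matrix.mul_add, Matrix.add_mul,
    nonsing_inv_mul_cancel_left _ _ uL, ← Matrix.mul_assoc,
    mul_nonsing_inv_cancel_right _ _ uLt]

/-- The derivative of the symmetric square root solves a Sylvester equation. -/
theorem fderiv_symmSqrt_sylvester {K : Sym n} (hK : K ∈ SPD n) (W : Sym n) :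
    fderiv ℝ (fun A : Sym n => symmSqrt (A : Matrix n n ℝ)) K W * symmSqrt (K : Matrix n n ℝ)
      + symmSqrt (K : Matrix n n ℝ) * fderiv ℝ (fun A : Sym n => symmSqrt (A : Matrix n n ℝ)) K W
      = W := by
  have h1 := hasDerivAt_line W ((contDiffAt_symmSqrt hK).differentiableAt (by simp))
  have h2 := h1.mul h1
  simp only [zero_smul, add_zero] at h2
  refine h2.unique ((hasDerivAt_line_self (K : Matrix n n ℝ) W 0).congr_of_eventuallyEq ?_)
  filter_upwards [(tendsto_line K W).eventually (isOpen_SPD.mem_nhds hK)] with t ht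
  exact symmSqrt_mul_self ht

end SquareRoots

/-! ### Partial contractions and core matrices. -/

section Contractions

variable {p₁ p₂ : ℕ}

/-- The contraction of the second factor of `C` against `B`. -/
def contract₁ : Matrix (Idx p₁ p₂) (Idx p₁ p₂) ℝ →ₗ[ℝ] Matrix (Fin p₂) (Fin p₂) ℝ →ₗ[ℝ]
    Matrix (Fin p₁) (Fin p₁) ℝ :=
  LinearMap.mk₂ ℝ (fun C B => ∑ i, ∑ j, B i j • block C j i)
    (fun C C' B => by
      ext a c
      simp [block, Matrix.sum_apply, mul_add, Finset.sum_add_distrib])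
    (fun k C B => by
      ext a c
      simp [block, Matrix.sum_apply, Finset.mul_sum, mul_left_comm])
    (fun C B B' => by
      ext a c
      simp [block, Matrix.sum_apply, add_mul, Finset.sum_add_distrib])
    (fun k C B => by
      ext a c
      simp [block, Matrix.sum_apply, Finset.mul_sum, mul_assoc])

/-- The contraction of the first factor of `C` against `A`. -/
def contract₂ : Matrix (Idx p₁ p₂) (Idx p₁ p₂) ℝ →ₗ[ℝ] Matrix (Fin p₁) (Fin p₁) ℝ →ₗ[ℝ]
    Matrix (Fin p₂) (Fin p₂) ℝ :=
  LinearMap.mk₂ ℝ (fun C A => of fun i j => (block C i j * A).trace)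
    (fun C C' B => by
      ext a c
      simp [block, trace, mul_apply, add_mul, Finset.sum_add_distrib])
    (fun k C B => by
      ext a c
      simp [block, trace, mul_apply, Finset.mul_sum, mul_assoc])
    (fun C B B' => by
      ext a c
      simp [block, trace, mul_apply, mul_add, Finset.sum_add_distrib])
    (fun k C B => by
      ext a c
      simp [block, trace, mul_apply, Finset.mul_sum])

theorem contract₁_apply (C : Matrix (Idx p₁ p₂) (Idx p₁ p₂) ℝ) (B : Matrix (Fin p₂) (Fin p₂) ℝ) :
    contract₁ C B = ∑ i, ∑ j, B i j • block C j i := rfl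

theorem contract₂_apply (C : Matrix (Idx p₁ p₂) (Idx p₁ p₂) ℝ) (A : Matrix (Fin p₁) (Fin p₁) ℝ) :
    contract₂ C A = of fun i j => (block C i j * A).trace := rfl

/-- Contraction is adjoint to the Kronecker product for the trace pairing. This and its companion
reduce identities between contractions to identities of traces, by nondegeneracy of the pairing. -/
theorem trace_mul_kronecker₂ (C : Matrix (Idx p₁ p₂) (Idx p₁ p₂) ℝ)
    (B : Matrix (Fin p₂) (Fin p₂) ℝ) (A : Matrix (Fin p₁) (Fin p₁) ℝ) :
    (C * (B ⊗ₖ A)).trace = (contract₂ C A * B).trace := by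
  simp only [trace, diag, mul_apply, contract₂_apply, of_apply, block, Fintype.sum_prod_type,
    kroneckerMap_apply, Finset.sum_mul]
  refine Finset.sum_congr rfl fun i _ => ?_
  rw [Finset.sum_comm]
  refine Finset.sum_congr rfl fun j _ => Finset.sum_congr rfl fun a _ =>
    Finset.sum_congr rfl fun c _ => by ring

theorem trace_mul_kronecker₁ (C : Matrix (Idx p₁ p₂) (Idx p₁ p₂) ℝ)
    (B : Matrix (Fin p₂) (Fin p₂) ℝ) (A : Matrix (Fin p₁) (Fin p₁) ℝ) :
    (C * (B ⊗ₖ A)).trace = (contract₁ C B * A).trace := by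
  rw [trace_mul_kronecker₂]
  have h : contract₁ C B * A = ∑ i, ∑ j, B i j • (block C j i * A) := by
    simp only [contract₁_apply, Finset.sum_mul, smul_mul]
  rw [h, trace_sum]
  simp only [trace_sum, trace_smul, smul_eq_mul]
  rw [Finset.sum_comm]
  simp only [trace, diag, mul_apply, contract₂_apply, of_apply, mul_comm]

/-- Cyclicity of the trace moves the separable factors onto the test matrix `B ⊗ A`, where they act
on each tensor factor separately. -/
theorem contract₁_congr (C : Matrix (Idx p₁ p₂) (Idx p₁ p₂) ℝ)
    (P₂ Q₂ B : Matrix (Fin p₂) (Fin p₂) ℝ) (P₁ Q₁ : Matrix (Fin p₁) (Fin p₁) ℝ) :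
    contract₁ ((P₂ ⊗ₖ P₁) * C * (Q₂ ⊗ₖ Q₁)) B = P₁ * contract₁ C (Q₂ * B * P₂) * Q₁ := by
  refine ext_iff_trace_mul_right.2 fun A => ?_
  rw [← trace_mul_kronecker₁]
  calc ((P₂ ⊗ₖ P₁) * C * (Q₂ ⊗ₖ Q₁) * (B ⊗ₖ A)).trace
      = (C * ((Q₂ ⊗ₖ Q₁) * (B ⊗ₖ A) * (P₂ ⊗ₖ P₁))).trace := by
        simp only [Matrix.mul_assoc]; rw [trace_mul_comm]; simp only [Matrix.mul_assoc]
    _ = (contract₁ C (Q₂ * B * P₂) * (Q₁ * A * P₁)).trace := by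
        rw [← mul_kronecker_mul, ← mul_kronecker_mul, trace_mul_kronecker₁]
    _ = (P₁ * contract₁ C (Q₂ * B * P₂) * Q₁ * A).trace := by
        simp only [Matrix.mul_assoc]; rw [trace_mul_comm P₁]; simp only [Matrix.mul_assoc]

theorem contract₂_congr (C : Matrix (Idx p₁ p₂) (Idx p₁ p₂) ℝ)
    (P₂ Q₂ : Matrix (Fin p₂) (Fin p₂) ℝ) (P₁ Q₁ A : Matrix (Fin p₁) (Fin p₁) ℝ) :
    contract₂ ((P₂ ⊗ₖ P₁) * C * (Q₂ ⊗ₖ Q₁)) A = P₂ * contract₂ C (Q₁ * A * P₁) * Q₂ := by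
  refine ext_iff_trace_mul_right.2 fun B => ?_
  rw [← trace_mul_kronecker₂]
  calc ((P₂ ⊗ₖ P₁) * C * (Q₂ ⊗ₖ Q₁) * (B ⊗ₖ A)).trace
      = (C * ((Q₂ ⊗ₖ Q₁) * (B ⊗ₖ A) * (P₂ ⊗ₖ P₁))).trace := by
        simp only [Matrix.mul_assoc]; rw [trace_mul_comm]; simp only [Matrix.mul_assoc]
    _ = (contract₂ C (Q₁ * A * P₁) * (Q₂ * B * P₂)).trace := by
        rw [← mul_kronecker_mul, ← mul_kronecker_mul, trace_mul_kronecker₂]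
    _ = (P₂ * contract₂ C (Q₁ * A * P₁) * Q₂ * B).trace := by
        simp only [Matrix.mul_assoc]; rw [trace_mul_comm P₂]; simp only [Matrix.mul_assoc]

theorem trace_mul_kronecker_transpose (C : Matrix (Idx p₁ p₂) (Idx p₁ p₂) ℝ)
    (B : Matrix (Fin p₂) (Fin p₂) ℝ) (A : Matrix (Fin p₁) (Fin p₁) ℝ) :
    (Cᵀ * (Bᵀ ⊗ₖ Aᵀ)).trace = (C * (B ⊗ₖ A)).trace := by
  rw [kroneckerMap_transpose, ← transpose_mul, trace_transpose, trace_mul_comm]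

theorem contract₁_transpose {C : Matrix (Idx p₁ p₂) (Idx p₁ p₂) ℝ} (hC : Cᵀ = C)
    (B : Matrix (Fin p₂) (Fin p₂) ℝ) : (contract₁ C B)ᵀ = contract₁ C Bᵀ := by
  refine ext_iff_trace_mul_right.2 fun A => ?_
  rw [← trace_transpose, transpose_mul, transpose_transpose, trace_mul_comm,
    ← trace_mul_kronecker₁, ← trace_mul_kronecker₁, ← trace_mul_kronecker_transpose, hC,
    transpose_transpose]

theorem contract₂_transpose {C : Matrix (Idx p₁ p₂) (Idx p₁ p₂) ℝ} (hC : Cᵀ = C)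
    (A : Matrix (Fin p₁) (Fin p₁) ℝ) : (contract₂ C A)ᵀ = contract₂ C Aᵀ := by
  refine ext_iff_trace_mul_right.2 fun B => ?_
  rw [← trace_transpose, transpose_mul, transpose_transpose, trace_mul_comm,
    ← trace_mul_kronecker₂, ← trace_mul_kronecker₂, ← trace_mul_kronecker_transpose, hC,
    transpose_transpose]

theorem ptrace₁_eq (C : Matrix (Idx p₁ p₂) (Idx p₁ p₂) ℝ) : ptrace₁ C = contract₁ C 1 := by
  rw [contract₁_apply, ptrace₁]
  refine Finset.sum_congr rfl fun i _ => ?_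
  rw [Finset.sum_eq_single i]
  · simp
  · intro j _ hj
    rw [one_apply_ne hj.symm, zero_smul]
  · simp

theorem ptrace₂_eq (C : Matrix (Idx p₁ p₂) (Idx p₁ p₂) ℝ) : ptrace₂ C = contract₂ C 1 := by
  rw [contract₂_apply, ptrace₂]
  simp

theorem trace_contract₁ (C : Matrix (Idx p₁ p₂) (Idx p₁ p₂) ℝ)
    (B : Matrix (Fin p₂) (Fin p₂) ℝ) : (contract₁ C B).trace = (contract₂ C 1 * B).trace := by
  rw [← trace_mul_kronecker₂, trace_mul_kronecker₁, Matrix.mul_one]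

theorem trace_contract₂ (C : Matrix (Idx p₁ p₂) (Idx p₁ p₂) ℝ)
    (A : Matrix (Fin p₁) (Fin p₁) ℝ) : (contract₂ C A).trace = (contract₁ C 1 * A).trace := by
  rw [← trace_mul_kronecker₁, trace_mul_kronecker₂, Matrix.mul_one]

theorem trace_contract₁_one (C : Matrix (Idx p₁ p₂) (Idx p₁ p₂) ℝ) :
    (contract₁ C 1).trace = C.trace := by
  have h := trace_mul_kronecker₁ C 1 1
  rwa [one_kronecker_one, Matrix.mul_one, Matrix.mul_one, eq_comm] at h

theorem trace_contract₂_one (C : Matrix (Idx p₁ p₂) (Idx p₁ p₂) ℝ) :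
    (contract₂ C 1).trace = C.trace := by
  have h := trace_mul_kronecker₂ C 1 1
  rwa [one_kronecker_one, Matrix.mul_one, Matrix.mul_one, eq_comm] at h

/-- Positive definite matrices whose partial traces are those of the identity. -/
structure IsCoreMatrix (C : Matrix (Idx p₁ p₂) (Idx p₁ p₂) ℝ) : Prop where
  posDef : C.PosDef
  contract₁_one : contract₁ C 1 = (p₂ : ℝ) • 1
  contract₂_one : contract₂ C 1 = (p₁ : ℝ) • 1

/-- The objective as a function of the inverse factors. -/
noncomputable def dualObjective (S : Matrix (Idx p₁ p₂) (Idx p₁ p₂) ℝ) (A : Pair p₁ p₂) : ℝ :=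
  (S * (A.2 ⊗ₖ A.1)).trace - p₁ * Real.log A.2.det - p₂ * Real.log A.1.det

/-- In the inverse factors the trace term is bilinear, which makes both the variations and the
compactness estimates direct. -/
theorem klObjective_eq (S : Sym (Idx p₁ p₂)) (X : Pair p₁ p₂) :
    klObjective S X = dualObjective (S : Matrix (Idx p₁ p₂) (Idx p₁ p₂) ℝ) (X.1⁻¹, X.2⁻¹) := by
  simp only [klObjective, dualObjective, inv_kronecker, det_nonsing_inv, Ring.inverse_eq_inv',
    Real.log_inv]
  ring

theorem dualObjective_eq (S : Sym (Idx p₁ p₂)) {A : Pair p₁ p₂} (h₁ : A.1.PosDef)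
    (h₂ : A.2.PosDef) :
    dualObjective (S : Matrix (Idx p₁ p₂) (Idx p₁ p₂) ℝ) A = klObjective S (A.1⁻¹, A.2⁻¹) := by
  rw [klObjective_eq]
  simp only [nonsing_inv_nonsing_inv _ h₁.isUnit_det, nonsing_inv_nonsing_inv _ h₂.isUnit_det]

theorem det_orthogonal_diagonal {n : Type} [Fintype n] [DecidableEq n] {O : Matrix n n ℝ}
    (hO : O * Oᵀ = 1) (d : n → ℝ) : (O * diagonal d * Oᵀ).det = ∏ i, d i := by
  rw [det_mul, det_mul, mul_right_comm, ← det_mul, hO, det_one, one_mul, det_diagonal]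

theorem trace_orthogonal_diagonal {n : Type} [Fintype n] [DecidableEq n] {O : Matrix n n ℝ}
    (hO : Oᵀ * O = 1) (d : n → ℝ) : (O * diagonal d * Oᵀ).trace = ∑ i, d i := by
  rw [Matrix.mul_assoc, trace_mul_comm, Matrix.mul_assoc, hO, Matrix.mul_one, trace_diagonal]

theorem IsCoreMatrix.congr_orthogonal {C : Matrix (Idx p₁ p₂) (Idx p₁ p₂) ℝ} (hC : IsCoreMatrix C)
    {O₁ : Matrix (Fin p₁) (Fin p₁) ℝ} {O₂ : Matrix (Fin p₂) (Fin p₂) ℝ}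
    (h₁ : O₁ * O₁ᵀ = 1) (h₂ : O₂ * O₂ᵀ = 1) :
    IsCoreMatrix ((O₂ ⊗ₖ O₁) * C * (O₂ᵀ ⊗ₖ O₁ᵀ)) where
  posDef := by
    rw [kroneckerMap_transpose]
    exact hC.posDef.congr (isUnit_det_of_mul_transpose (by
      rw [← kroneckerMap_transpose, ← mul_kronecker_mul, h₁, h₂, one_kronecker_one]))
  contract₁_one := by
    rw [contract₁_congr, Matrix.mul_one, mul_eq_one_comm.1 h₂, hC.contract₁_one, Matrix.mul_smul,
      Matrix.mul_one, smul_mul, h₁]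
  contract₂_one := by
    rw [contract₂_congr, Matrix.mul_one, mul_eq_one_comm.1 h₁, hC.contract₂_one, Matrix.mul_smul,
      Matrix.mul_one, smul_mul, h₂]

theorem IsCoreMatrix.sum_diag₁ {C : Matrix (Idx p₁ p₂) (Idx p₁ p₂) ℝ} (hC : IsCoreMatrix C)
    (a : Fin p₁) : ∑ i, C (i, a) (i, a) = p₂ := by
  have h := congr_fun₂ hC.contract₁_one a a
  rw [← ptrace₁_eq, ptrace₁, Matrix.sum_apply] at h
  simpa [block] using h

theorem IsCoreMatrix.sum_diag₂ {C : Matrix (Idx p₁ p₂) (Idx p₁ p₂) ℝ} (hC : IsCoreMatrix C)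
    (i : Fin p₂) : ∑ a, C (i, a) (i, a) = p₁ := by
  have h := congr_fun₂ hC.contract₂_one i i
  rw [← ptrace₂_eq, ptrace₂] at h
  simpa [block, trace] using h

/-- The objective of a core matrix is minimal exactly at the identity. -/
theorem IsCoreMatrix.le_dualObjective {C : Matrix (Idx p₁ p₂) (Idx p₁ p₂) ℝ}
    (hC : IsCoreMatrix C) {A : Pair p₁ p₂} (h₁ : A.1.PosDef) (h₂ : A.2.PosDef) :
    (p₁ : ℝ) * p₂ ≤ dualObjective C A ∧
      (dualObjective C A ≤ (p₁ : ℝ) * p₂ → A.2 ⊗ₖ A.1 = 1) := by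
  obtain ⟨O₁, α, a1, a2, hα, hA₁⟩ := exists_orthogonal_diagonal_pos h₁
  obtain ⟨O₂, β, b1, b2, hβ, hA₂⟩ := exists_orthogonal_diagonal_pos h₂
  -- In the eigenbases of the inverse factors only the diagonal of the rotated matrix enters, and
  -- the rotated matrix is again a core matrix.
  set C' := (O₂ᵀ ⊗ₖ O₁ᵀ) * C * (O₂ ⊗ₖ O₁) with hC'
  have hcore : IsCoreMatrix C' := by
    have := hC.congr_orthogonal (O₁ := O₁ᵀ) (O₂ := O₂ᵀ) (by rwa [transpose_transpose])
      (by rwa [transpose_transpose])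
    rwa [transpose_transpose, transpose_transpose] at this
  have htr : (C * (A.2 ⊗ₖ A.1)).trace = ∑ i, ∑ a, C' (i, a) (i, a) * (β i * α a) := by
    have e : A.2 ⊗ₖ A.1 = (O₂ ⊗ₖ O₁) * (diagonal β ⊗ₖ diagonal α) * (O₂ᵀ ⊗ₖ O₁ᵀ) := by
      rw [hA₁, hA₂, mul_kronecker_mul, mul_kronecker_mul]
    have e2 : (C * (A.2 ⊗ₖ A.1)).trace = (C' * (diagonal β ⊗ₖ diagonal α)).trace := by
      rw [e, hC', ← Matrix.mul_assoc, trace_mul_comm]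
      simp only [Matrix.mul_assoc]
    rw [e2, diagonal_kronecker_diagonal]
    simp only [trace, diag, mul_diagonal, Fintype.sum_prod_type]
  have hl₁ : Real.log A.1.det = ∑ a, Real.log (α a) := by
    rw [hA₁, det_orthogonal_diagonal a1, Real.log_prod fun i _ => (hα i).ne']
  have hl₂ : Real.log A.2.det = ∑ i, Real.log (β i) := by
    rw [hA₂, det_orthogonal_diagonal b1, Real.log_prod fun i _ => (hβ i).ne']
  -- The diagonal entries of `C'` sum to `p₂` for fixed `a` and to `p₁` for fixed `i`. They serve as
  -- weights that spread the logarithms and the constant `p₁ p₂` over all pairs `(i, a)`.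
  have hs₁ : (p₂ : ℝ) * Real.log A.1.det = ∑ i, ∑ a, C' (i, a) (i, a) * Real.log (α a) := by
    rw [Finset.sum_comm, hl₁, Finset.mul_sum]
    refine Finset.sum_congr rfl fun a _ => ?_
    rw [← Finset.sum_mul, hcore.sum_diag₁]
  have hs₂ : (p₁ : ℝ) * Real.log A.2.det = ∑ i, ∑ a, C' (i, a) (i, a) * Real.log (β i) := by
    rw [hl₂, Finset.mul_sum]
    refine Finset.sum_congr rfl fun i _ => ?_
    rw [← Finset.sum_mul, hcore.sum_diag₂]
  have hs₀ : (p₁ : ℝ) * p₂ = ∑ i, ∑ a, C' (i, a) (i, a) := by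
    simp only [hcore.sum_diag₂, Finset.sum_const, Finset.card_univ, Fintype.card_fin,
      nsmul_eq_mul]
    ring
  have hdiff : dualObjective C A - p₁ * p₂ = ∑ i, ∑ a, C' (i, a) (i, a) *
      (β i * α a - 1 - Real.log (β i * α a)) := by
    rw [dualObjective, htr, hs₁, hs₂, hs₀]
    simp only [← Finset.sum_sub_distrib]
    refine Finset.sum_congr rfl fun i _ => Finset.sum_congr rfl fun a _ => ?_
    rw [Real.log_mul (hβ i).ne' (hα a).ne']
    ring
  have hpos : ∀ i a, 0 ≤ C' (i, a) (i, a) * (β i * α a - 1 - Real.log (β i * α a)) :=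
    fun i a => mul_nonneg hcore.posDef.diag_pos.le
      (by linarith [Real.log_le_sub_one_of_pos (mul_pos (hβ i) (hα a))])
  refine ⟨?_, fun hle => ?_⟩
  · have : 0 ≤ dualObjective C A - p₁ * p₂ := by
      rw [hdiff]
      exact Finset.sum_nonneg fun i _ => Finset.sum_nonneg fun a _ => hpos i a
    linarith
  · have h0 : ∑ i, ∑ a, C' (i, a) (i, a) * (β i * α a - 1 - Real.log (β i * α a)) = 0 := by
      refine le_antisymm ?_ (Finset.sum_nonneg fun i _ => Finset.sum_nonneg fun a _ => hpos i a)
      rw [← hdiff]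
      linarith
    -- The weights are positive and `log x < x - 1` for `x ≠ 1`, so in the equality case every term
    -- vanishes only at product one.
    have h1 : ∀ i a, β i * α a = 1 := by
      intro i a
      have h2 := (Finset.sum_eq_zero_iff_of_nonneg
        (fun i _ => Finset.sum_nonneg fun a _ => hpos i a)).1 h0 i (Finset.mem_univ i)
      have h3 := (Finset.sum_eq_zero_iff_of_nonneg (fun a _ => hpos i a)).1 h2 a
        (Finset.mem_univ a)
      have h4 := (mul_eq_zero.1 h3).resolve_left hcore.posDef.diag_pos.ne'
      by_contra hne
      have := Real.log_lt_sub_one_of_pos (mul_pos (hβ i) (hα a)) hne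
      linarith
    have e : diagonal β ⊗ₖ diagonal α = 1 := by
      rw [diagonal_kronecker_diagonal, ← diagonal_one]
      congr 1
      ext ⟨i, a⟩
      exact h1 i a
    rw [hA₁, hA₂, mul_kronecker_mul, mul_kronecker_mul, e, Matrix.mul_one, ← mul_kronecker_mul,
      a1, b1, one_kronecker_one]

end Contractions

/-! ### Whitening, first-order conditions and existence of minimizers. -/

section Minimizer

variable {p₁ p₂ : ℕ}

theorem isUnit_det_kronecker {B₁ : Matrix (Fin p₁) (Fin p₁) ℝ} {B₂ : Matrix (Fin p₂) (Fin p₂) ℝ}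
    (h₁ : IsUnit B₁.det) (h₂ : IsUnit B₂.det) : IsUnit (B₂ ⊗ₖ B₁).det := by
  rw [det_kronecker]
  exact (h₂.pow _).mul (h₁.pow _)

theorem symmSqrt_inv_mul_inv {n : Type} [Fintype n] [DecidableEq n] {A : Matrix n n ℝ}
    (hA : A.PosDef) : (symmSqrt A)⁻¹ * (symmSqrt A)⁻¹ = A⁻¹ := by
  rw [← Matrix.mul_inv_rev, symmSqrt_mul_self hA]

theorem symmSqrt_inv_mul {n : Type} [Fintype n] [DecidableEq n] {A : Matrix n n ℝ}
    (hA : A.PosDef) : (symmSqrt A)⁻¹ * symmSqrt A = 1 :=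
  nonsing_inv_mul _ (symmSqrt_posDef hA).isUnit_det

theorem symmSqrt_mul_inv {n : Type} [Fintype n] [DecidableEq n] {A : Matrix n n ℝ}
    (hA : A.PosDef) : symmSqrt A * (symmSqrt A)⁻¹ = 1 :=
  mul_nonsing_inv _ (symmSqrt_posDef hA).isUnit_det

theorem symmSqrt_inv_conj {n : Type} [Fintype n] [DecidableEq n] {A : Matrix n n ℝ}
    (hA : A.PosDef) : (symmSqrt A)⁻¹ * A * (symmSqrt A)⁻¹ = 1 := by
  calc (symmSqrt A)⁻¹ * A * (symmSqrt A)⁻¹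
      = (symmSqrt A)⁻¹ * (symmSqrt A * symmSqrt A) * (symmSqrt A)⁻¹ := by
        rw [symmSqrt_mul_self hA]
    _ = 1 := by
        rw [← Matrix.mul_assoc, symmSqrt_inv_mul hA, Matrix.one_mul, symmSqrt_mul_inv hA]

theorem symmSqrt_conj_inv {n : Type} [Fintype n] [DecidableEq n] {A : Matrix n n ℝ}
    (hA : A.PosDef) : symmSqrt A * A⁻¹ * symmSqrt A = 1 := by
  rw [← symmSqrt_inv_mul_inv hA, ← Matrix.mul_assoc, symmSqrt_mul_inv hA, Matrix.one_mul,
    symmSqrt_inv_mul hA]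

/-- Undoing a two-sided multiplication by the inverse of the symmetric root. -/
theorem symmSqrt_conj_cancel {n : Type} [Fintype n] [DecidableEq n] {A : Matrix n n ℝ}
    (hA : A.PosDef) (M : Matrix n n ℝ) :
    symmSqrt A * ((symmSqrt A)⁻¹ * M * (symmSqrt A)⁻¹) * symmSqrt A = M := by
  calc _ = (symmSqrt A * (symmSqrt A)⁻¹) * M * ((symmSqrt A)⁻¹ * symmSqrt A) := by
        simp only [Matrix.mul_assoc]
    _ = M := by rw [symmSqrt_inv_mul hA, symmSqrt_mul_inv hA, Matrix.one_mul, Matrix.mul_one]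

theorem symmSqrt_inv_conj_cancel {n : Type} [Fintype n] [DecidableEq n] {A : Matrix n n ℝ}
    (hA : A.PosDef) (M : Matrix n n ℝ) :
    (symmSqrt A)⁻¹ * (symmSqrt A * M * symmSqrt A) * (symmSqrt A)⁻¹ = M := by
  calc _ = ((symmSqrt A)⁻¹ * symmSqrt A) * M * (symmSqrt A * (symmSqrt A)⁻¹) := by
        simp only [Matrix.mul_assoc]
    _ = M := by rw [symmSqrt_inv_mul hA, symmSqrt_mul_inv hA, Matrix.one_mul, Matrix.mul_one]

theorem whiten_eq (X : Pair p₁ p₂) (V : Matrix (Idx p₁ p₂) (Idx p₁ p₂) ℝ) :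
    whiten X V = ((symmSqrt X.2)⁻¹ ⊗ₖ (symmSqrt X.1)⁻¹) * V
      * ((symmSqrt X.2)⁻¹ ⊗ₖ (symmSqrt X.1)⁻¹) := by
  rw [whiten, inv_kronecker]

theorem kronecker_mul_whiten_mul {X : Pair p₁ p₂} (h₁ : X.1.PosDef) (h₂ : X.2.PosDef)
    (V : Matrix (Idx p₁ p₂) (Idx p₁ p₂) ℝ) :
    (symmSqrt X.2 ⊗ₖ symmSqrt X.1) * whiten X V * (symmSqrt X.2 ⊗ₖ symmSqrt X.1) = V := by
  rw [whiten, ← symmSqrt_kronecker h₂ h₁]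
  exact symmSqrt_conj_cancel (h₂.kronecker h₁) V

theorem whiten_posDef {X : Pair p₁ p₂} (h₁ : X.1.PosDef) (h₂ : X.2.PosDef)
    {S : Matrix (Idx p₁ p₂) (Idx p₁ p₂) ℝ} (hS : S.PosDef) : (whiten X S).PosDef := by
  have hr : (symmSqrt X.2 ⊗ₖ symmSqrt X.1).PosDef :=
    (symmSqrt_posDef h₂).kronecker (symmSqrt_posDef h₁)
  have := hS.congr (B := (symmSqrt X.2 ⊗ₖ symmSqrt X.1)⁻¹) hr.inv.isUnit_det
  rwa [hr.inv.transpose_eq] at this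

theorem contract₁_whiten_one {X : Pair p₁ p₂} (h₂ : X.2.PosDef)
    (S : Matrix (Idx p₁ p₂) (Idx p₁ p₂) ℝ) :
    contract₁ (whiten X S) 1 = (symmSqrt X.1)⁻¹ * contract₁ S X.2⁻¹ * (symmSqrt X.1)⁻¹ := by
  rw [whiten_eq, contract₁_congr, Matrix.mul_one, symmSqrt_inv_mul_inv h₂]

theorem contract₂_whiten_one {X : Pair p₁ p₂} (h₁ : X.1.PosDef)
    (S : Matrix (Idx p₁ p₂) (Idx p₁ p₂) ℝ) :
    contract₂ (whiten X S) 1 = (symmSqrt X.2)⁻¹ * contract₂ S X.1⁻¹ * (symmSqrt X.2)⁻¹ := by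
  rw [whiten_eq, contract₂_congr, Matrix.mul_one, symmSqrt_inv_mul_inv h₁]

theorem isCoreMatrix_whiten {X : Pair p₁ p₂} (h₁ : X.1.PosDef) (h₂ : X.2.PosDef)
    {S : Matrix (Idx p₁ p₂) (Idx p₁ p₂) ℝ} (hS : S.PosDef)
    (hc₁ : contract₁ S X.2⁻¹ = (p₂ : ℝ) • X.1) (hc₂ : contract₂ S X.1⁻¹ = (p₁ : ℝ) • X.2) :
    IsCoreMatrix (whiten X S) where
  posDef := whiten_posDef h₁ h₂ hS
  contract₁_one := by
    rw [contract₁_whiten_one h₂, hc₁, Matrix.mul_smul, smul_mul, symmSqrt_inv_conj h₁]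
  contract₂_one := by
    rw [contract₂_whiten_one h₁, hc₂, Matrix.mul_smul, smul_mul, symmSqrt_inv_conj h₂]

theorem IsCoreMatrix.contract₁_eq {X : Pair p₁ p₂} (h₁ : X.1.PosDef) (h₂ : X.2.PosDef)
    {S : Matrix (Idx p₁ p₂) (Idx p₁ p₂) ℝ} (h : IsCoreMatrix (whiten X S)) :
    contract₁ S X.2⁻¹ = (p₂ : ℝ) • X.1 := by
  have h3 := h.contract₁_one
  rw [contract₁_whiten_one h₂] at h3
  rw [← symmSqrt_conj_cancel h₁ (contract₁ S X.2⁻¹), h3, Matrix.mul_smul, smul_mul,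
    Matrix.mul_one, symmSqrt_mul_self h₁]

theorem IsCoreMatrix.contract₂_eq {X : Pair p₁ p₂} (h₁ : X.1.PosDef) (h₂ : X.2.PosDef)
    {S : Matrix (Idx p₁ p₂) (Idx p₁ p₂) ℝ} (h : IsCoreMatrix (whiten X S)) :
    contract₂ S X.1⁻¹ = (p₁ : ℝ) • X.2 := by
  have h3 := h.contract₂_one
  rw [contract₂_whiten_one h₁] at h3
  rw [← symmSqrt_conj_cancel h₂ (contract₂ S X.1⁻¹), h3, Matrix.mul_smul, smul_mul,
    Matrix.mul_one, symmSqrt_mul_self h₂]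

theorem log_det_congr {n : Type} [Fintype n] [DecidableEq n] {A B : Matrix n n ℝ}
    (hA : A.PosDef) (hB : IsUnit B.det) :
    Real.log (Bᵀ * A * B).det = Real.log A.det + Real.log (B.det ^ 2) := by
  rw [det_mul, det_mul, det_transpose, mul_comm B.det, mul_assoc, ← sq,
    Real.log_mul hA.det_pos.ne' (pow_ne_zero _ hB.ne_zero)]

/-- The congruence passes from `S` to the inverse factors by cyclicity of the trace; the
determinants of `B₁`, `B₂` contribute a term that does not depend on `A`. -/
theorem dualObjective_congr (S : Matrix (Idx p₁ p₂) (Idx p₁ p₂) ℝ)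
    {B₁ : Matrix (Fin p₁) (Fin p₁) ℝ} {B₂ : Matrix (Fin p₂) (Fin p₂) ℝ}
    (hB₁ : IsUnit B₁.det) (hB₂ : IsUnit B₂.det) {A : Pair p₁ p₂} (h₁ : A.1.PosDef)
    (h₂ : A.2.PosDef) :
    dualObjective ((B₂ ⊗ₖ B₁) * S * (B₂ ⊗ₖ B₁)ᵀ) A
      = dualObjective S (B₁ᵀ * A.1 * B₁, B₂ᵀ * A.2 * B₂)
        + (p₁ * Real.log (B₂.det ^ 2) + p₂ * Real.log (B₁.det ^ 2)) := by
  simp only [dualObjective]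
  rw [log_det_congr h₁ hB₁, log_det_congr h₂ hB₂]
  have h : ((B₂ ⊗ₖ B₁) * S * (B₂ ⊗ₖ B₁)ᵀ * (A.2 ⊗ₖ A.1)).trace
      = (S * ((B₂ᵀ * A.2 * B₂) ⊗ₖ (B₁ᵀ * A.1 * B₁))).trace := by
    rw [mul_kronecker_mul, mul_kronecker_mul, kroneckerMap_transpose]
    simp only [Matrix.mul_assoc]
    rw [trace_mul_comm]
    simp only [Matrix.mul_assoc]
  rw [h]
  ring

theorem dualObjective_one (C : Matrix (Idx p₁ p₂) (Idx p₁ p₂) ℝ) :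
    dualObjective C (1, 1) = C.trace := by
  simp [dualObjective]

theorem IsCoreMatrix.trace_eq {C : Matrix (Idx p₁ p₂) (Idx p₁ p₂) ℝ} (hC : IsCoreMatrix C) :
    C.trace = (p₁ : ℝ) * p₂ := by
  rw [← trace_contract₁_one, hC.contract₁_one, trace_smul, trace_one, Fintype.card_fin,
    smul_eq_mul, mul_comm]

theorem dualObjective_whiten {X : Pair p₁ p₂} (h₁ : X.1.PosDef) (h₂ : X.2.PosDef)
    (S : Matrix (Idx p₁ p₂) (Idx p₁ p₂) ℝ) {A : Pair p₁ p₂} (hA₁ : A.1.PosDef)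
    (hA₂ : A.2.PosDef) :
    dualObjective S A = dualObjective (whiten X S)
        (symmSqrt X.1 * A.1 * symmSqrt X.1, symmSqrt X.2 * A.2 * symmSqrt X.2)
      + (p₁ * Real.log ((symmSqrt X.2).det ^ 2) + p₂ * Real.log ((symmSqrt X.1).det ^ 2)) := by
  have r₁ := symmSqrt_posDef h₁
  have r₂ := symmSqrt_posDef h₂
  have h := dualObjective_congr (whiten X S) r₁.isUnit_det r₂.isUnit_det hA₁ hA₂
  rwa [(r₂.kronecker r₁).transpose_eq, r₁.transpose_eq, r₂.transpose_eq,
    kronecker_mul_whiten_mul h₁ h₂] at h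

/-- If the whitened matrix is a core matrix then the objective is minimal exactly at `X`. -/
theorem IsCoreMatrix.le_dualObjective_whiten {X : Pair p₁ p₂} (h₁ : X.1.PosDef) (h₂ : X.2.PosDef)
    {S : Matrix (Idx p₁ p₂) (Idx p₁ p₂) ℝ} (hC : IsCoreMatrix (whiten X S))
    {A : Pair p₁ p₂} (hA₁ : A.1.PosDef) (hA₂ : A.2.PosDef) :
    dualObjective S (X.1⁻¹, X.2⁻¹) ≤ dualObjective S A ∧
      (dualObjective S A ≤ dualObjective S (X.1⁻¹, X.2⁻¹) →
        A.2 ⊗ₖ A.1 = X.2⁻¹ ⊗ₖ X.1⁻¹) := by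
  have r₁ := symmSqrt_posDef h₁
  have r₂ := symmSqrt_posDef h₂
  have e₁ : (symmSqrt X.1 * A.1 * symmSqrt X.1).PosDef := by
    have := hA₁.congr r₁.isUnit_det
    rwa [r₁.transpose_eq] at this
  have e₂ : (symmSqrt X.2 * A.2 * symmSqrt X.2).PosDef := by
    have := hA₂.congr r₂.isUnit_det
    rwa [r₂.transpose_eq] at this
  rw [dualObjective_whiten h₁ h₂ S hA₁ hA₂, dualObjective_whiten h₁ h₂ S h₁.inv h₂.inv]
  -- Whitening sends `X⁻¹` to the pair `(1, 1)`, whose value is `tr C = p₁ p₂`, the minimum for a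
  -- core matrix.
  simp only [symmSqrt_conj_inv h₁, symmSqrt_conj_inv h₂, dualObjective_one, hC.trace_eq]
  obtain ⟨h3, h4⟩ := hC.le_dualObjective (A := (_, _)) e₁ e₂
  refine ⟨by linarith, fun h => ?_⟩
  have h5 := h4 (by linarith)
  simp only [mul_kronecker_mul] at h5
  have h6 := symmSqrt_inv_conj_cancel (h₂.kronecker h₁) (A.2 ⊗ₖ A.1)
  rw [symmSqrt_kronecker h₂ h₁, h5, Matrix.mul_one, ← symmSqrt_kronecker h₂ h₁,
    symmSqrt_inv_mul_inv (h₂.kronecker h₁), inv_kronecker] at h6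
  exact h6.symm

/-! ### First-order conditions -/

/-- `Z` is the gradient in the first variable. It is symmetric, so moving along `Z` itself stays
positive definite for small `t`, and the vanishing derivative is `tr (Zᵀ Z)`. -/
theorem contract₁_eq_of_minimal {S : Matrix (Idx p₁ p₂) (Idx p₁ p₂) ℝ} (hS : Sᵀ = S)
    {A : Pair p₁ p₂} (hA₁ : A.1.PosDef) (hA₂ : A.2.PosDef)
    (h : ∀ B : Pair p₁ p₂, B.1.PosDef → B.2.PosDef → dualObjective S A ≤ dualObjective S B) :
    contract₁ S A.2 = (p₂ : ℝ) • A.1⁻¹ := by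
  set Z := contract₁ S A.2 - (p₂ : ℝ) • A.1⁻¹ with hZ
  have hZs : Zᵀ = Z := by
    rw [hZ, transpose_sub, transpose_smul, contract₁_transpose hS, hA₂.transpose_eq,
      hA₁.inv.transpose_eq]
  have hd : HasDerivAt (fun t : ℝ => dualObjective S (A.1 + t • Z, A.2))
      ((S * (A.2 ⊗ₖ Z)).trace - 0 - p₂ * (A.1⁻¹ * Z).trace) 0 := by
    have h1 := hasDerivAt_line_self A.1 Z 0
    have h2 := hasDerivAt_trace ((hasDerivAt_kronecker
      (hasDerivAt_const (0 : ℝ) A.2) h1).const_mul S)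
    have h3 := hasDerivAt_log_det h1 (by simpa using hA₁.isUnit_det)
    simp only [zero_smul, add_zero, zero_kronecker, zero_add] at h2 h3
    exact (h2.sub (hasDerivAt_const (0 : ℝ) ((p₁ : ℝ) * Real.log A.2.det))).sub
      (h3.const_mul (p₂ : ℝ))
  have hmin : IsLocalMin (fun t : ℝ => dualObjective S (A.1 + t • Z, A.2)) 0 := by
    filter_upwards [(tendsto_line A.1 Z).eventually (eventually_posDef hA₁)] with t ht
    simp only [zero_smul, add_zero]
    exact h (_, _) (ht (by rw [transpose_add, transpose_smul, hZs, hA₁.transpose_eq])) hA₂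
  have h0 := hmin.hasDerivAt_eq_zero hd
  have : (Zᵀ * Z).trace = 0 := by
    rw [hZs]
    conv_lhs => rw [hZ, Matrix.sub_mul, trace_sub, ← trace_mul_kronecker₁, smul_mul, trace_smul]
    simpa using h0
  exact sub_eq_zero.1 (eq_zero_of_trace_transpose_mul_self this)

theorem contract₂_eq_of_minimal {S : Matrix (Idx p₁ p₂) (Idx p₁ p₂) ℝ} (hS : Sᵀ = S)
    {A : Pair p₁ p₂} (hA₁ : A.1.PosDef) (hA₂ : A.2.PosDef)
    (h : ∀ B : Pair p₁ p₂, B.1.PosDef → B.2.PosDef → dualObjective S A ≤ dualObjective S B) :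
    contract₂ S A.1 = (p₁ : ℝ) • A.2⁻¹ := by
  set Z := contract₂ S A.1 - (p₁ : ℝ) • A.2⁻¹ with hZ
  have hZs : Zᵀ = Z := by
    rw [hZ, transpose_sub, transpose_smul, contract₂_transpose hS, hA₁.transpose_eq,
      hA₂.inv.transpose_eq]
  have hd : HasDerivAt (fun t : ℝ => dualObjective S (A.1, A.2 + t • Z))
      ((S * (Z ⊗ₖ A.1)).trace - p₁ * (A.2⁻¹ * Z).trace - 0) 0 := by
    have h1 := hasDerivAt_line_self A.2 Z 0
    have h2 := hasDerivAt_trace ((hasDerivAt_kronecker h1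
      (hasDerivAt_const (0 : ℝ) A.1)).const_mul S)
    have h3 := hasDerivAt_log_det h1 (by simpa using hA₂.isUnit_det)
    simp only [zero_smul, add_zero, kronecker_zero] at h2 h3
    exact (h2.sub (h3.const_mul (p₁ : ℝ))).sub
      (hasDerivAt_const (0 : ℝ) ((p₂ : ℝ) * Real.log A.1.det))
  have hmin : IsLocalMin (fun t : ℝ => dualObjective S (A.1, A.2 + t • Z)) 0 := by
    filter_upwards [(tendsto_line A.2 Z).eventually (eventually_posDef hA₂)] with t ht
    simp only [zero_smul, add_zero]
    exact h (_, _) hA₁ (ht (by rw [transpose_add, transpose_smul, hZs, hA₂.transpose_eq]))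
  have h0 := hmin.hasDerivAt_eq_zero hd
  have : (Zᵀ * Z).trace = 0 := by
    rw [hZs]
    conv_lhs => rw [hZ, Matrix.sub_mul, trace_sub, ← trace_mul_kronecker₂, smul_mul, trace_smul]
    simpa using h0
  exact sub_eq_zero.1 (eq_zero_of_trace_transpose_mul_self this)

/-! ### Existence of minimizers -/

theorem exists_le_eigenvalue {n : Type} [Fintype n] [DecidableEq n] [Nonempty n]
    {S : Matrix n n ℝ} (hS : S.PosDef) : ∃ l : ℝ, 0 < l ∧ (S - l • 1).PosSemidef := by
  obtain ⟨O, d, h1, -, hd, h3⟩ := exists_orthogonal_diagonal_pos hS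
  obtain ⟨i₀, hi₀⟩ := Finite.exists_min d
  refine ⟨d i₀, hd i₀, ?_⟩
  have e : S - d i₀ • 1 = O * diagonal (fun i => d i - d i₀) * Oᵀ := by
    have : diagonal (fun i => d i - d i₀) = diagonal d - d i₀ • (1 : Matrix n n ℝ) := by
      rw [smul_one_eq_diagonal, diagonal_sub]
    rw [this, Matrix.mul_sub, Matrix.sub_mul, ← h3, Matrix.mul_smul, smul_mul, Matrix.mul_one, h1]
  rw [e, ← conjTranspose_eq_transpose_of_trivial]
  exact (PosSemidef.diagonal fun i => sub_nonneg.2 (hi₀ i)).mul_mul_conjTranspose_same O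

theorem trace_mul_nonneg {n : Type} [Fintype n] [DecidableEq n] {P Q : Matrix n n ℝ}
    (hP : P.PosSemidef) (hQ : Q.PosDef) : 0 ≤ (P * Q).trace := by
  have h := (hP.mul_mul_conjTranspose_same (symmSqrt Q)).trace_nonneg
  rwa [conjTranspose_eq_transpose_of_trivial, (symmSqrt_posDef hQ).transpose_eq,
    Matrix.mul_assoc, trace_mul_comm, Matrix.mul_assoc, symmSqrt_mul_self hQ] at h

/-- Each eigenvalue is at most the trace. This crude bound is enough, since a linear term in the
trace dominates its logarithm. -/
theorem log_det_le {n : ℕ} {A : Matrix (Fin n) (Fin n) ℝ} (hA : A.PosDef) :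
    Real.log A.det ≤ n * Real.log A.trace := by
  obtain ⟨O, d, h1, h2, hd, h3⟩ := exists_orthogonal_diagonal_pos hA
  rw [h3, det_orthogonal_diagonal h1, trace_orthogonal_diagonal h2,
    Real.log_prod fun i _ => (hd i).ne']
  calc ∑ i, Real.log (d i) ≤ ∑ _i : Fin n, Real.log (∑ j, d j) :=
        Finset.sum_le_sum fun i _ => Real.log_le_log (hd i)
          (Finset.single_le_sum (fun j _ => (hd j).le) (Finset.mem_univ i))
    _ = _ := by simp

/-- Testing the form on `e_i ± e_j` gives `2 |A i j| ≤ A i i + A j j`, and a diagonal entry is at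
most the trace. -/
theorem abs_entry_le_trace {n : Type} [Fintype n] [DecidableEq n] {A : Matrix n n ℝ}
    (hA : A.PosSemidef) (i j : n) : |A i j| ≤ A.trace := by
  have hs : A j i = A i j := congr_fun₂ hA.transpose_eq i j
  have hq : ∀ s : ℝ, 0 ≤ A i i + 2 * s * A i j + s ^ 2 * A j j := fun s => by
    have h := (posSemidef_iff_real.1 hA).2 (Pi.single i 1 + s • Pi.single j 1)
    simp only [mulVec_add, mulVec_smul, add_dotProduct, dotProduct_add, smul_dotProduct,
      dotProduct_smul, mulVec_single_one, single_one_dotProduct, col_apply, smul_eq_mul, hs] at h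
    linarith
  have hle : ∀ i, A i i ≤ A.trace := fun i =>
    Finset.single_le_sum (f := fun i => A i i) (fun j _ => hA.diag_nonneg) (Finset.mem_univ i)
  have h1 := hq 1
  have h2 := hq (-1)
  rw [abs_le]
  constructor <;> linarith [hle i, hle j]

theorem isClosed_posSemidef {n : Type} [Fintype n] [DecidableEq n] :
    IsClosed {A : Matrix n n ℝ | A.PosSemidef} := by
  simp only [posSemidef_iff_real, Set.ofPred_and, Set.ofPred_forall]
  refine (isClosed_eq (by fun_prop) (by fun_prop)).inter (isClosed_iInter fun x => ?_)
  exact isClosed_le continuous_const (by fun_prop)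

theorem isCompact_posSemidef_trace_le {n : Type} [Fintype n] [DecidableEq n] (R : ℝ) :
    IsCompact {A : Matrix n n ℝ | A.PosSemidef ∧ A.trace ≤ R} := by
  have hK : IsCompact {A : Matrix n n ℝ | ∀ i j, A i j ∈ Set.Icc (-R) R} := by
    have := isCompact_univ_pi (X := fun _ : n => n → ℝ)
      (s := fun _ => Set.univ.pi fun _ => Set.Icc (-R) R)
      fun _ => isCompact_univ_pi fun _ => isCompact_Icc
    convert! this using 1
    ext A
    exact ⟨fun h i _ j _ => h i j, fun h i j => h i trivial j trivial⟩
  refine hK.of_isClosed_subset (isClosed_posSemidef.inter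
    (isClosed_le continuous_id.matrix_trace continuous_const)) ?_
  rintro A ⟨hA, ht⟩ i j
  exact abs_le.1 ((abs_entry_le_trace hA i j).trans ht)

/-- The scaling ambiguity of the Kronecker product; it permits the normalization `tr A₁ = 1` in the
search for a minimizer. -/
theorem dualObjective_smul (S : Matrix (Idx p₁ p₂) (Idx p₁ p₂) ℝ) {A : Pair p₁ p₂}
    (h₁ : A.1.PosDef) (h₂ : A.2.PosDef) {s : ℝ} (hs : 0 < s) :
    dualObjective S (s⁻¹ • A.1, s • A.2) = dualObjective S A := by
  simp only [dualObjective]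
  rw [smul_kronecker, kronecker_smul, smul_smul, mul_inv_cancel₀ hs.ne', one_smul, det_smul,
    det_smul, Real.log_mul (pow_ne_zero _ hs.ne') h₂.det_pos.ne',
    Real.log_mul (pow_ne_zero _ (inv_ne_zero hs.ne')) h₁.det_pos.ne', Real.log_pow, Real.log_pow,
    Real.log_inv, Fintype.card_fin, Fintype.card_fin]
  ring

/-- If `S ≥ l` and `tr A₁ = 1`, the trace term is at least `l tr A₂`, while `log |A₁| ≤ 0` and `log
|A₂|` grows at most logarithmically in `tr A₂`. On a sublevel set `tr A₂` is therefore bounded and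
both determinants stay away from zero. -/
theorem exists_dual_minimizer (hp₁ : 0 < p₁) (hp₂ : 0 < p₂)
    {S : Matrix (Idx p₁ p₂) (Idx p₁ p₂) ℝ} (hS : S.PosDef) :
    ∃ A : Pair p₁ p₂, A.1.PosDef ∧ A.2.PosDef ∧
      ∀ B : Pair p₁ p₂, B.1.PosDef → B.2.PosDef → dualObjective S A ≤ dualObjective S B := by
  have : Nonempty (Fin p₁) := ⟨⟨0, hp₁⟩⟩
  have : Nonempty (Fin p₂) := ⟨⟨0, hp₂⟩⟩
  have q₁ : (0 : ℝ) < p₁ := by exact_mod_cast hp₁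
  have q₂ : (0 : ℝ) < p₂ := by exact_mod_cast hp₂
  obtain ⟨l, hl, hSl⟩ := exists_le_eigenvalue hS
  set B₀ : Pair p₁ p₂ := ((p₁ : ℝ)⁻¹ • 1, 1) with hB₀
  have hB₀₁ : B₀.1.PosDef := PosDef.one.smul (inv_pos.2 q₁)
  have hB₀₂ : B₀.2.PosDef := PosDef.one
  have htB₀ : B₀.1.trace = 1 := by simp [hB₀, q₁.ne']
  set M := dualObjective S B₀ with hM
  -- With this `δ`, the bound `log x ≤ δ x - 1 - log δ` lets `p₁ log |A₂|` absorb only half of `l tr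
  -- A₂`; the other half is then bounded by `c`.
  set δ := l / (2 * (p₁ * p₂)) with hδ
  have hδ0 : 0 < δ := by positivity
  set c := M - p₁ * p₂ - p₁ * p₂ * Real.log δ with hc
  have hlow : ∀ A : Pair p₁ p₂, A.1.PosDef → A.2.PosDef → A.1.trace = 1 → dualObjective S A ≤ M →
      A.2.trace ≤ 2 * c / l ∧ Real.exp (-c / p₂) ≤ A.1.det ∧ Real.exp (-M / p₁) ≤ A.2.det := by
    intro A h₁ h₂ ht hle
    have ht2 : 0 < A.2.trace := h₂.trace_pos
    have e1 : l * A.2.trace ≤ (S * (A.2 ⊗ₖ A.1)).trace := by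
      have := trace_mul_nonneg hSl (h₂.kronecker h₁)
      rw [Matrix.sub_mul, smul_mul, Matrix.one_mul, trace_sub, trace_smul, trace_kronecker, ht,
        mul_one, smul_eq_mul] at this
      linarith
    have e2 : Real.log A.1.det ≤ 0 := by
      have := log_det_le h₁
      rwa [ht, Real.log_one, mul_zero] at this
    have e3 := log_det_le h₂
    have e4 : Real.log A.2.trace ≤ δ * A.2.trace - 1 - Real.log δ := by
      have := Real.log_le_sub_one_of_pos (mul_pos hδ0 ht2)
      rw [Real.log_mul hδ0.ne' ht2.ne'] at this
      linarith
    have e5 : (p₁ : ℝ) * Real.log A.2.det ≤ l / 2 * A.2.trace - p₁ * p₂ - p₁ * p₂ * Real.log δ := by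
      calc (p₁ : ℝ) * Real.log A.2.det ≤ p₁ * (p₂ * (δ * A.2.trace - 1 - Real.log δ)) := by
            gcongr
            exact e3.trans (by gcongr)
        _ = (p₁ * p₂ * δ) * A.2.trace - p₁ * p₂ - p₁ * p₂ * Real.log δ := by ring
        _ = _ := by
            have : (p₁ : ℝ) * p₂ * δ = l / 2 := by rw [hδ]; field_simp
            rw [this]
    have e6 : (p₂ : ℝ) * Real.log A.1.det ≤ 0 := mul_nonpos_of_nonneg_of_nonpos q₂.le e2
    rw [dualObjective] at hle
    refine ⟨?_, ?_, ?_⟩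
    · rw [le_div_iff₀ hl]
      linarith
    · rw [← Real.le_log_iff_exp_le h₁.det_pos, div_le_iff₀ q₂]
      have : 0 < l * A.2.trace := mul_pos hl ht2
      linarith
    · rw [← Real.le_log_iff_exp_le h₂.det_pos, div_le_iff₀ q₁]
      have : 0 < l * A.2.trace := mul_pos hl ht2
      linarith
  -- The determinant bounds keep the logarithms continuous and turn semidefinite limits into
  -- definite ones. The trace normalization may be relaxed to an inequality, since `𝒦` only has to
  -- contain the normalized sublevel set.
  set 𝒦 : Set (Pair p₁ p₂) := ({A | A.PosSemidef ∧ A.trace ≤ 1} ×ˢ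
      {A | A.PosSemidef ∧ A.trace ≤ 2 * c / l}) ∩
    {A | Real.exp (-c / p₂) ≤ A.1.det ∧ Real.exp (-M / p₁) ≤ A.2.det} with hK
  have hKc : IsCompact 𝒦 := by
    refine ((isCompact_posSemidef_trace_le 1).prod (isCompact_posSemidef_trace_le _)).inter_right ?_
    exact (isClosed_le continuous_const continuous_fst.matrix_det).inter
      (isClosed_le continuous_const continuous_snd.matrix_det)
  have hmem : ∀ A : Pair p₁ p₂, A.1.PosDef → A.2.PosDef → A.1.trace = 1 →
      dualObjective S A ≤ M → A ∈ 𝒦 := fun A h₁ h₂ ht hle => by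
    obtain ⟨a, b, d⟩ := hlow A h₁ h₂ ht hle
    exact ⟨⟨⟨h₁.posSemidef, ht.le⟩, ⟨h₂.posSemidef, a⟩⟩, b, d⟩
  have hcont : ContinuousOn (dualObjective S) 𝒦 := by
    have hc1 : Continuous fun A : Pair p₁ p₂ => A.1.det := by fun_prop
    have hc2 : Continuous fun A : Pair p₁ p₂ => A.2.det := by fun_prop
    have hk : Continuous fun A : Pair p₁ p₂ => A.2 ⊗ₖ A.1 :=
      continuous_matrix fun i j => by
        simp only [kroneckerMap_apply]
        exact (continuous_snd.matrix_elem _ _).mul (continuous_fst.matrix_elem _ _)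
    have hc3 : Continuous fun A : Pair p₁ p₂ => (S * (A.2 ⊗ₖ A.1)).trace :=
      (continuous_const.matrix_mul hk).matrix_trace
    exact (hc3.continuousOn.sub (continuousOn_const.mul
      (hc2.continuousOn.log fun A hA => ((Real.exp_pos _).trans_le hA.2.2).ne'))).sub
      (continuousOn_const.mul
        (hc1.continuousOn.log fun A hA => ((Real.exp_pos _).trans_le hA.2.1).ne'))
  obtain ⟨A, hAK, hAmin⟩ := hKc.exists_isMinOn ⟨B₀, hmem B₀ hB₀₁ hB₀₂ htB₀ le_rfl⟩ hcont
  refine ⟨A, hAK.1.1.1.posDef_iff_det_ne_zero.2 ((Real.exp_pos _).trans_le hAK.2.1).ne',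
    hAK.1.2.1.posDef_iff_det_ne_zero.2 ((Real.exp_pos _).trans_le hAK.2.2).ne', fun B h₁ h₂ => ?_⟩
  have hs : 0 < B.1.trace := h₁.trace_pos
  rw [← dualObjective_smul S h₁ h₂ hs]
  -- A normalized competitor outside the sublevel set has value at least `M`, which is the value at
  -- `B₀ ∈ 𝒦`.
  rcases le_total (dualObjective S (B.1.trace⁻¹ • B.1, B.1.trace • B.2)) M with h | h
  · refine hAmin (hmem _ (h₁.smul (inv_pos.2 hs)) (h₂.smul hs) ?_ h)
    simp [trace_smul, hs.ne']
  · exact le_trans (hAmin (hmem B₀ hB₀₁ hB₀₂ htB₀ le_rfl)) h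

end Minimizer

/-! ### The Kronecker map, its normalized factors and its equations. -/

section KroneckerMap

variable {p₁ p₂ : ℕ}

theorem log_det_kronecker {X : Pair p₁ p₂} (h₁ : X.1.PosDef) (h₂ : X.2.PosDef) :
    Real.log (X.2 ⊗ₖ X.1).det = p₁ * Real.log X.2.det + p₂ * Real.log X.1.det := by
  rw [det_kronecker, Real.log_mul (pow_ne_zero _ h₂.det_pos.ne') (pow_ne_zero _ h₁.det_pos.ne'),
    Real.log_pow, Real.log_pow, Fintype.card_fin, Fintype.card_fin]

theorem klObjective_eq_of_kronecker_eq (S : Sym (Idx p₁ p₂)) {X Y : Pair p₁ p₂}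
    (hX₁ : X.1.PosDef) (hX₂ : X.2.PosDef) (hY₁ : Y.1.PosDef) (hY₂ : Y.2.PosDef)
    (h : X.2 ⊗ₖ X.1 = Y.2 ⊗ₖ Y.1) : klObjective S X = klObjective S Y := by
  rw [klObjective, klObjective, add_assoc, add_assoc, ← log_det_kronecker hX₁ hX₂,
    ← log_det_kronecker hY₁ hY₂, h]

theorem isCoreMatrix_of_minimal {S : Sym (Idx p₁ p₂)} (hS : S ∈ SPD (Idx p₁ p₂))
    {X : Pair p₁ p₂} (h₁ : X.1.PosDef) (h₂ : X.2.PosDef)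
    (h : ∀ Y : Pair p₁ p₂, Y.1.PosDef → Y.2.PosDef → klObjective S X ≤ klObjective S Y) :
    IsCoreMatrix (whiten X (S : Matrix (Idx p₁ p₂) (Idx p₁ p₂) ℝ)) := by
  have hmin : ∀ B : Pair p₁ p₂, B.1.PosDef → B.2.PosDef →
      dualObjective (S : Matrix (Idx p₁ p₂) (Idx p₁ p₂) ℝ) (X.1⁻¹, X.2⁻¹) ≤ dualObjective S B := by
    intro B hB₁ hB₂
    rw [← klObjective_eq, dualObjective_eq S hB₁ hB₂]
    exact h _ hB₁.inv hB₂.inv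
  have e₁ := contract₁_eq_of_minimal (coe_transpose S) (A := (X.1⁻¹, X.2⁻¹)) h₁.inv h₂.inv hmin
  have e₂ := contract₂_eq_of_minimal (coe_transpose S) (A := (X.1⁻¹, X.2⁻¹)) h₁.inv h₂.inv hmin
  simp only [nonsing_inv_nonsing_inv _ h₁.isUnit_det, nonsing_inv_nonsing_inv _ h₂.isUnit_det]
    at e₁ e₂
  exact isCoreMatrix_whiten h₁ h₂ hS e₁ e₂

/-- Together with `isCoreMatrix_of_minimal` this replaces the minimization by the partial trace
equations. -/
theorem IsCoreMatrix.minimal {S : Sym (Idx p₁ p₂)} {X : Pair p₁ p₂} (h₁ : X.1.PosDef)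
    (h₂ : X.2.PosDef) (h : IsCoreMatrix (whiten X (S : Matrix (Idx p₁ p₂) (Idx p₁ p₂) ℝ)))
    {Y : Pair p₁ p₂} (hY₁ : Y.1.PosDef) (hY₂ : Y.2.PosDef) :
    klObjective S X ≤ klObjective S Y ∧
      (klObjective S Y ≤ klObjective S X → Y.2 ⊗ₖ Y.1 = X.2 ⊗ₖ X.1) := by
  rw [klObjective_eq, klObjective_eq]
  obtain ⟨h3, h4⟩ := h.le_dualObjective_whiten h₁ h₂ (A := (Y.1⁻¹, Y.2⁻¹)) hY₁.inv hY₂.inv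
  refine ⟨h3, fun h5 => ?_⟩
  have h6 := h4 h5
  simp only [← inv_kronecker] at h6
  exact inv_inj h6 (hY₂.kronecker hY₁).isUnit_det

theorem exists_isCoreMatrix_whiten (hp₁ : 0 < p₁) (hp₂ : 0 < p₂) {S : Sym (Idx p₁ p₂)}
    (hS : S ∈ SPD (Idx p₁ p₂)) : ∃ X : Pair p₁ p₂, X.1.PosDef ∧ X.2.PosDef ∧
      IsCoreMatrix (whiten X (S : Matrix (Idx p₁ p₂) (Idx p₁ p₂) ℝ)) := by
  obtain ⟨A, h₁, h₂, h⟩ := exists_dual_minimizer hp₁ hp₂ hS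
  refine ⟨(A.1⁻¹, A.2⁻¹), h₁.inv, h₂.inv, isCoreMatrix_of_minimal hS h₁.inv h₂.inv
    fun Y hY₁ hY₂ => ?_⟩
  rw [← dualObjective_eq S h₁ h₂, klObjective_eq]
  exact h _ hY₁.inv hY₂.inv

theorem isKronMinimizer_unique {S K K' : Sym (Idx p₁ p₂)} (hS : S ∈ SPD (Idx p₁ p₂))
    (hK : IsKronMinimizer S K) (hK' : IsKronMinimizer S K') : K = K' := by
  obtain ⟨X, hX₁, hX₂, hKX, hX⟩ := hK
  obtain ⟨Y, hY₁, hY₂, hKY, hY⟩ := hK'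
  ext1
  rw [hKX, hKY]
  exact (((isCoreMatrix_of_minimal hS hX₁ hX₂ hX).minimal hX₁ hX₂ hY₁ hY₂).2
    (hY X hX₁ hX₂)).symm

theorem exists_isKronMinimizer (hp₁ : 0 < p₁) (hp₂ : 0 < p₂) {S : Sym (Idx p₁ p₂)}
    (hS : S ∈ SPD (Idx p₁ p₂)) : ∃ K, IsKronMinimizer S K := by
  obtain ⟨X, h₁, h₂, h⟩ := exists_isCoreMatrix_whiten hp₁ hp₂ hS
  exact ⟨⟨X.2 ⊗ₖ X.1, (h₂.kronecker h₁).transpose_eq⟩, X, h₁, h₂, rfl,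
    fun Y hY₁ hY₂ => (h.minimal h₁ h₂ hY₁ hY₂).1⟩

theorem kronMap_spec (hp₁ : 0 < p₁) (hp₂ : 0 < p₂) {S : Sym (Idx p₁ p₂)}
    (hS : S ∈ SPD (Idx p₁ p₂)) : IsKronMinimizer S (kronMap S) :=
  Classical.epsilon_spec (exists_isKronMinimizer hp₁ hp₂ hS)

theorem kronMap_eq_of_isCoreMatrix {S : Sym (Idx p₁ p₂)} (hS : S ∈ SPD (Idx p₁ p₂))
    {X : Pair p₁ p₂} (h₁ : X.1.PosDef) (h₂ : X.2.PosDef)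
    (h : IsCoreMatrix (whiten X (S : Matrix (Idx p₁ p₂) (Idx p₁ p₂) ℝ))) :
    (kronMap S : Matrix (Idx p₁ p₂) (Idx p₁ p₂) ℝ) = X.2 ⊗ₖ X.1 := by
  have hK : IsKronMinimizer S ⟨X.2 ⊗ₖ X.1, (h₂.kronecker h₁).transpose_eq⟩ :=
    ⟨X, h₁, h₂, rfl, fun Y hY₁ hY₂ => (h.minimal h₁ h₂ hY₁ hY₂).1⟩
  have hk : IsKronMinimizer S (kronMap S) := Classical.epsilon_spec ⟨_, hK⟩
  rw [isKronMinimizer_unique hS hk hK]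

theorem isCoreMatrix_of_kronMap_eq (hp₁ : 0 < p₁) (hp₂ : 0 < p₂) {S : Sym (Idx p₁ p₂)}
    (hS : S ∈ SPD (Idx p₁ p₂)) {X : Pair p₁ p₂} (h₁ : X.1.PosDef) (h₂ : X.2.PosDef)
    (h : (kronMap S : Matrix (Idx p₁ p₂) (Idx p₁ p₂) ℝ) = X.2 ⊗ₖ X.1) :
    IsCoreMatrix (whiten X (S : Matrix (Idx p₁ p₂) (Idx p₁ p₂) ℝ)) := by
  obtain ⟨Y, hY₁, hY₂, hK, hY⟩ := kronMap_spec hp₁ hp₂ hS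
  refine isCoreMatrix_of_minimal hS h₁ h₂ fun Z hZ₁ hZ₂ => ?_
  rw [klObjective_eq_of_kronecker_eq S h₁ h₂ hY₁ hY₂ (h.symm.trans hK)]
  exact hY Z hZ₁ hZ₂

theorem exists_factors {X : Pair p₁ p₂} (hp₁ : 0 < p₁) (h₁ : X.1.PosDef) (h₂ : X.2.PosDef) :
    ∃ Y ∈ Factors p₁ p₂, Y.2 ⊗ₖ Y.1 = X.2 ⊗ₖ X.1 := by
  -- The scale that gives `s⁻¹ X₁` determinant one.
  set s := X.1.det ^ (1 / (p₁ : ℝ)) with hs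
  have hs0 : 0 < s := Real.rpow_pos_of_pos h₁.det_pos _
  have hsp : s ^ p₁ = X.1.det := by
    rw [hs, ← Real.rpow_natCast, ← Real.rpow_mul h₁.det_pos.le, one_div,
      inv_mul_cancel₀ (by exact_mod_cast hp₁.ne'), Real.rpow_one]
  refine ⟨(s⁻¹ • X.1, s • X.2), ⟨h₁.smul (inv_pos.2 hs0), ?_, h₂.smul hs0⟩, ?_⟩
  · rw [det_smul, Fintype.card_fin, inv_pow, hsp, inv_mul_cancel₀ h₁.det_pos.ne']
  · rw [smul_kronecker, kronecker_smul, smul_smul, mul_inv_cancel₀ hs0.ne', one_smul]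

/-- Comparing the blocks at one diagonal entry of the second factors gives `X₁ = s Y₁` with `s > 0`,
and the determinants force `s ^ p₁ = 1`. -/
theorem factors_unique (hp₁ : 0 < p₁) (hp₂ : 0 < p₂) {X Y : Pair p₁ p₂} (hX : X ∈ Factors p₁ p₂)
    (hY : Y ∈ Factors p₁ p₂) (h : X.2 ⊗ₖ X.1 = Y.2 ⊗ₖ Y.1) : X = Y := by
  have he : ∀ i j a b, X.2 i j * X.1 a b = Y.2 i j * Y.1 a b := fun i j a b =>
    congr_fun₂ h (i, a) (j, b)
  let i₀ : Fin p₂ := ⟨0, hp₂⟩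
  let a₀ : Fin p₁ := ⟨0, hp₁⟩
  have hx : 0 < X.2 i₀ i₀ := hX.2.2.diag_pos
  have hy : 0 < Y.2 i₀ i₀ := hY.2.2.diag_pos
  set s := Y.2 i₀ i₀ / X.2 i₀ i₀ with hs
  have hs0 : 0 < s := div_pos hy hx
  have h1 : X.1 = s • Y.1 := by
    ext a b
    rw [Matrix.smul_apply, smul_eq_mul, hs, div_mul_eq_mul_div, ← he, mul_div_cancel_left₀ _ hx.ne']
  have hs1 : s = 1 := by
    have h2 := hX.2.1
    rw [h1, det_smul, hY.2.1, mul_one, Fintype.card_fin] at h2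
    exact (pow_eq_one_iff_of_nonneg hs0.le hp₁.ne').1 h2
  have h11 : X.1 = Y.1 := by rw [h1, hs1, one_smul]
  have h22 : X.2 = Y.2 := by
    ext i j
    have := he i j a₀ a₀
    rw [h11] at this
    exact mul_right_cancel₀ hY.1.diag_pos.ne' this
  exact Prod.ext h11 h22

theorem existsUnique_factors (hp₁ : 0 < p₁) (hp₂ : 0 < p₂) {S : Sym (Idx p₁ p₂)}
    (hS : S ∈ SPD (Idx p₁ p₂)) : ∃! X : Pair p₁ p₂, X ∈ Factors p₁ p₂ ∧
      (kronMap S : Matrix (Idx p₁ p₂) (Idx p₁ p₂) ℝ) = X.2 ⊗ₖ X.1 := by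
  obtain ⟨X, h₁, h₂, hK, -⟩ := kronMap_spec hp₁ hp₂ hS
  obtain ⟨Y, hY, hYX⟩ := exists_factors hp₁ h₁ h₂
  exact ⟨Y, ⟨hY, hK.trans hYX.symm⟩, fun Z hZ =>
    factors_unique hp₁ hp₂ hZ.1 hY (hZ.2.symm.trans (hK.trans hYX.symm))⟩

theorem kronMap_mem_KronSPD (hp₁ : 0 < p₁) (hp₂ : 0 < p₂) {S : Sym (Idx p₁ p₂)}
    (hS : S ∈ SPD (Idx p₁ p₂)) : kronMap S ∈ KronSPD p₁ p₂ := by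
  obtain ⟨X, h₁, h₂, hK, -⟩ := kronMap_spec hp₁ hp₂ hS
  exact ⟨X, h₁, h₂, hK⟩

theorem KronSPD_subset_SPD : KronSPD p₁ p₂ ⊆ SPD (Idx p₁ p₂) := by
  rintro K ⟨X, h₁, h₂, hK⟩
  change (K : Matrix (Idx p₁ p₂) (Idx p₁ p₂) ℝ).PosDef
  rw [hK]
  exact h₂.kronecker h₁

theorem kronMap_mem_SPD (hp₁ : 0 < p₁) (hp₂ : 0 < p₂) {S : Sym (Idx p₁ p₂)}
    (hS : S ∈ SPD (Idx p₁ p₂)) : kronMap S ∈ SPD (Idx p₁ p₂) :=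
  KronSPD_subset_SPD (kronMap_mem_KronSPD hp₁ hp₂ hS)

theorem congruence_mem_SPD {n : Type} [Fintype n] [DecidableEq n] {B : Matrix n n ℝ}
    (hB : IsUnit B.det) {S : Sym n} (hS : S ∈ SPD n) : congruence B S ∈ SPD n :=
  Matrix.PosDef.congr hS hB

theorem transpose_mul_inv_congr_mul {n : Type} [Fintype n] [DecidableEq n] {B X : Matrix n n ℝ}
    (hB : IsUnit B.det) : Bᵀ * (B * X * Bᵀ)⁻¹ * B = X⁻¹ := by
  have hBt : IsUnit Bᵀ.det := by rwa [det_transpose]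
  rw [Matrix.mul_inv_rev, Matrix.mul_inv_rev, mul_nonsing_inv_cancel_left _ _ hBt,
    Matrix.mul_assoc, nonsing_inv_mul _ hB, Matrix.mul_one]

/-- Equivariance of the Kronecker map under separable congruences. -/
theorem kronMap_congruence (hp₁ : 0 < p₁) (hp₂ : 0 < p₂) {S : Sym (Idx p₁ p₂)}
    (hS : S ∈ SPD (Idx p₁ p₂)) {B₁ : Matrix (Fin p₁) (Fin p₁) ℝ}
    {B₂ : Matrix (Fin p₂) (Fin p₂) ℝ} (hB₁ : IsUnit B₁.det) (hB₂ : IsUnit B₂.det) :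
    kronMap (congruence (B₂ ⊗ₖ B₁) S) = congruence (B₂ ⊗ₖ B₁) (kronMap S) := by
  obtain ⟨X, h₁, h₂, hK, -⟩ := kronMap_spec hp₁ hp₂ hS
  have hc := isCoreMatrix_of_kronMap_eq hp₁ hp₂ hS h₁ h₂ hK
  have hS' := congruence_mem_SPD (isUnit_det_kronecker hB₁ hB₂) hS
  have hc' : IsCoreMatrix (whiten (B₁ * X.1 * B₁ᵀ, B₂ * X.2 * B₂ᵀ)
      (congruence (B₂ ⊗ₖ B₁) S : Sym (Idx p₁ p₂))) := by
    refine isCoreMatrix_whiten (h₁.congr hB₁) (h₂.congr hB₂) hS' ?_ ?_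
    · simp only [congruence, ← kroneckerMap_transpose, contract₁_congr]
      rw [transpose_mul_inv_congr_mul hB₂, hc.contract₁_eq h₁ h₂, Matrix.mul_smul, smul_mul]
    · simp only [congruence, ← kroneckerMap_transpose, contract₂_congr]
      rw [transpose_mul_inv_congr_mul hB₁, hc.contract₂_eq h₁ h₂, Matrix.mul_smul, smul_mul]
  ext1
  rw [kronMap_eq_of_isCoreMatrix hS' (h₁.congr hB₁) (h₂.congr hB₂) hc']
  simp only [congruence]
  rw [hK, ← kroneckerMap_transpose, mul_kronecker_mul, mul_kronecker_mul]

/-! ### The linearized stationarity conditions -/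

/-- In `W Wᵀ` the two pure terms see only the partial traces of `C`, which are those of the
identity; the mixed terms give the contractions. -/
theorem IsCoreMatrix.trace_energy {C : Matrix (Idx p₁ p₂) (Idx p₁ p₂) ℝ} (hC : IsCoreMatrix C)
    (u₁ : Matrix (Fin p₁) (Fin p₁) ℝ) (u₂ : Matrix (Fin p₂) (Fin p₂) ℝ) :
    ((u₂ ⊗ₖ 1 + 1 ⊗ₖ u₁)ᵀ * C * (u₂ ⊗ₖ 1 + 1 ⊗ₖ u₁)).trace
      = p₁ * (u₂ * u₂ᵀ).trace + p₂ * (u₁ * u₁ᵀ).trace + (contract₁ C u₂ * u₁ᵀ).trace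
        + (contract₂ C u₁ * u₂ᵀ).trace := by
  have hW : (u₂ ⊗ₖ 1 + 1 ⊗ₖ u₁) * (u₂ ⊗ₖ (1 : Matrix (Fin p₁) (Fin p₁) ℝ) + 1 ⊗ₖ u₁)ᵀ
      = (u₂ * u₂ᵀ) ⊗ₖ 1 + u₂ ⊗ₖ u₁ᵀ + u₂ᵀ ⊗ₖ u₁ + 1 ⊗ₖ (u₁ * u₁ᵀ) := by
    rw [transpose_add, ← kroneckerMap_transpose, ← kroneckerMap_transpose, Matrix.add_mul,
      Matrix.mul_add, Matrix.mul_add]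
    simp only [← mul_kronecker_mul, transpose_one, Matrix.mul_one, Matrix.one_mul]
    abel
  rw [Matrix.mul_assoc, trace_mul_comm, Matrix.mul_assoc, hW]
  simp only [Matrix.mul_add, trace_add]
  rw [trace_mul_kronecker₂ C (u₂ * u₂ᵀ) 1, trace_mul_kronecker₁ C u₂ u₁ᵀ,
    trace_mul_kronecker₂ C u₂ᵀ u₁, trace_mul_kronecker₁ C 1 (u₁ * u₁ᵀ), hC.contract₁_one,
    hC.contract₂_one, smul_mul, smul_mul, Matrix.one_mul, Matrix.one_mul, trace_smul, trace_smul,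
    smul_eq_mul, smul_eq_mul]
  ring

/-- The trace over the first factor removes `u₁` and leaves `p₁ u₂`. Without `tr u₁ = 0`, the pair
`(-s I, s I)` would also solve the equation. -/
theorem kronecker_sum_eq_zero (hp₁ : 0 < p₁) (hp₂ : 0 < p₂) {u₁ : Matrix (Fin p₁) (Fin p₁) ℝ}
    {u₂ : Matrix (Fin p₂) (Fin p₂) ℝ} (ht : u₁.trace = 0)
    (h : u₂ ⊗ₖ (1 : Matrix (Fin p₁) (Fin p₁) ℝ) + (1 : Matrix (Fin p₂) (Fin p₂) ℝ) ⊗ₖ u₁ = 0) :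
    u₁ = 0 ∧ u₂ = 0 := by
  have he : ∀ i j a b, u₂ i j * (1 : Matrix (Fin p₁) (Fin p₁) ℝ) a b
      + (1 : Matrix (Fin p₂) (Fin p₂) ℝ) i j * u₁ a b = 0 := fun i j a b =>
    congr_fun₂ h (i, a) (j, b)
  have q₁ : (p₁ : ℝ) ≠ 0 := by exact_mod_cast hp₁.ne'
  have h2 : u₂ = 0 := by
    ext i j
    have hsum : ∑ a, (u₂ i j * (1 : Matrix (Fin p₁) (Fin p₁) ℝ) a a
      + (1 : Matrix (Fin p₂) (Fin p₂) ℝ) i j * u₁ a a) = 0 :=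
      Finset.sum_eq_zero fun a _ => he i j a a
    have ht' : ∑ a, u₁ a a = 0 := ht
    rw [Finset.sum_add_distrib, ← Finset.mul_sum, ← Finset.mul_sum, ht'] at hsum
    simpa [q₁] using hsum
  refine ⟨?_, h2⟩
  ext a b
  simpa [h2] using he ⟨0, hp₂⟩ ⟨0, hp₂⟩ a b

/-- Pairing the equations with `p₂ u₁ᵀ` and `p₁ u₂ᵀ` and adding gives `tr (Wᵀ C W) = 0` for the
Kronecker sum `W`; the multiple of the identity drops out because `tr u₁ = 0`. Symmetry of `u₁`,
`u₂` is not assumed, since the implicit function theorem is applied in the space of all matrices. -/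
theorem IsCoreMatrix.linearized_eq_zero (hp₁ : 0 < p₁) (hp₂ : 0 < p₂)
    {C : Matrix (Idx p₁ p₂) (Idx p₁ p₂) ℝ} (hC : IsCoreMatrix C)
    {u₁ : Matrix (Fin p₁) (Fin p₁) ℝ} {u₂ : Matrix (Fin p₂) (Fin p₂) ℝ} (ht : u₁.trace = 0)
    {s : ℝ} (h₁ : u₁ + (1 / (p₂ : ℝ)) • contract₁ C u₂ + s • 1 = 0)
    (h₂ : u₂ + (1 / (p₁ : ℝ)) • contract₂ C u₁ = 0) : u₁ = 0 ∧ u₂ = 0 := by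
  have q₁ : (p₁ : ℝ) ≠ 0 := by exact_mod_cast hp₁.ne'
  have q₂ : (p₂ : ℝ) ≠ 0 := by exact_mod_cast hp₂.ne'
  have e₁ : p₂ * (u₁ * u₁ᵀ).trace + (contract₁ C u₂ * u₁ᵀ).trace = 0 := by
    have h := congrArg (fun M => (p₂ : ℝ) * (M * u₁ᵀ).trace) h₁
    simp only [Matrix.add_mul, smul_mul, trace_add, trace_smul, smul_eq_mul, Matrix.one_mul,
      trace_transpose, ht, mul_zero, add_zero, Matrix.zero_mul, trace_zero, mul_add] at h
    rwa [← mul_assoc, mul_one_div_cancel q₂, one_mul] at h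
  have e₂ : p₁ * (u₂ * u₂ᵀ).trace + (contract₂ C u₁ * u₂ᵀ).trace = 0 := by
    have h := congrArg (fun M => (p₁ : ℝ) * (M * u₂ᵀ).trace) h₂
    simp only [Matrix.add_mul, smul_mul, trace_add, trace_smul, smul_eq_mul,
      mul_zero, Matrix.zero_mul, trace_zero, mul_add] at h
    rwa [← mul_assoc, mul_one_div_cancel q₁, one_mul] at h
  refine kronecker_sum_eq_zero hp₁ hp₂ ht (eq_zero_of_trace_conj hC.posDef ?_)
  rw [hC.trace_energy]
  linarith

theorem IsCoreMatrix.trace_contract₁ {C : Matrix (Idx p₁ p₂) (Idx p₁ p₂) ℝ}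
    (hC : IsCoreMatrix C) (u₂ : Matrix (Fin p₂) (Fin p₂) ℝ) :
    (contract₁ C u₂).trace = p₁ * u₂.trace := by
  rw [KroneckerCore.trace_contract₁, hC.contract₂_one, smul_mul, Matrix.one_mul, trace_smul,
    smul_eq_mul]

theorem IsCoreMatrix.trace_contract₂ {C : Matrix (Idx p₁ p₂) (Idx p₁ p₂) ℝ}
    (hC : IsCoreMatrix C) (u₁ : Matrix (Fin p₁) (Fin p₁) ℝ) :
    (contract₂ C u₁).trace = p₂ * u₁.trace := by
  rw [KroneckerCore.trace_contract₂, hC.contract₁_one, smul_mul, Matrix.one_mul, trace_smul,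
    smul_eq_mul]

/-- The equations of the normalized factors of the minimizer; the last term of the first component
encodes the normalization. -/
noncomputable def stationarity (S : Matrix (Idx p₁ p₂) (Idx p₁ p₂) ℝ) (K : Pair p₁ p₂) :
    Pair p₁ p₂ :=
  (K.1 - (1 / (p₂ : ℝ)) • contract₁ S K.2⁻¹ + (K.1.det - 1) • K.1,
   K.2 - (1 / (p₁ : ℝ)) • contract₂ S K.1⁻¹)

theorem stationarity_transpose {S : Matrix (Idx p₁ p₂) (Idx p₁ p₂) ℝ} (hS : Sᵀ = S)
    (K : Pair p₁ p₂) :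
    stationarity S (K.1ᵀ, K.2ᵀ) = ((stationarity S K).1ᵀ, (stationarity S K).2ᵀ) := by
  simp only [stationarity, transpose_add, transpose_sub, transpose_smul, det_transpose,
    contract₁_transpose hS, contract₂_transpose hS, transpose_nonsing_inv]

theorem stationarity_eq_zero {S : Matrix (Idx p₁ p₂) (Idx p₁ p₂) ℝ} {X : Pair p₁ p₂}
    (hp₁ : 0 < p₁) (hp₂ : 0 < p₂) (hX : X ∈ Factors p₁ p₂) (hC : IsCoreMatrix (whiten X S)) :
    stationarity S X = 0 := by
  have q₁ : (p₁ : ℝ) ≠ 0 := by exact_mod_cast hp₁.ne'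
  have q₂ : (p₂ : ℝ) ≠ 0 := by exact_mod_cast hp₂.ne'
  rw [stationarity, hC.contract₁_eq hX.1 hX.2.2, hC.contract₂_eq hX.1 hX.2.2, hX.2.1, smul_smul,
    smul_smul, one_div_mul_cancel q₁, one_div_mul_cancel q₂]
  simp

/-- Computing `tr (S (X₂⁻¹ ⊗ X₁⁻¹))` through either contraction gives `p₁ p₂ |X₁| = p₁ p₂`. So the
normalization term forces determinant one, and then it disappears from the equations. -/
theorem factors_of_stationarity {S : Matrix (Idx p₁ p₂) (Idx p₁ p₂) ℝ} (hS : S.PosDef)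
    {X : Pair p₁ p₂} (hp₁ : 0 < p₁) (hp₂ : 0 < p₂) (h₁ : X.1.PosDef) (h₂ : X.2.PosDef)
    (h : stationarity S X = 0) : X ∈ Factors p₁ p₂ ∧ IsCoreMatrix (whiten X S) := by
  have q₁ : (p₁ : ℝ) ≠ 0 := by exact_mod_cast hp₁.ne'
  have q₂ : (p₂ : ℝ) ≠ 0 := by exact_mod_cast hp₂.ne'
  have e₁ : contract₁ S X.2⁻¹ = ((p₂ : ℝ) * X.1.det) • X.1 := by
    have h3 := congrArg (fun Z : Pair p₁ p₂ => (p₂ : ℝ) • Z.1) h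
    simp only [stationarity, Prod.fst_zero, smul_zero, smul_add, smul_sub, smul_smul, one_smul,
      sub_smul, mul_one_div_cancel q₂] at h3
    rw [eq_comm, ← sub_eq_zero, ← h3]
    abel
  have e₂ : contract₂ S X.1⁻¹ = (p₁ : ℝ) • X.2 := by
    have h3 := congrArg (fun Z : Pair p₁ p₂ => (p₁ : ℝ) • Z.2) h
    simp only [stationarity, Prod.snd_zero, smul_zero, smul_sub, smul_smul, one_smul,
      mul_one_div_cancel q₁] at h3
    exact (sub_eq_zero.1 h3).symm
  have hdet : X.1.det = 1 := by
    have h3 := trace_mul_kronecker₁ S X.2⁻¹ X.1⁻¹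
    rw [trace_mul_kronecker₂, e₁, e₂, smul_mul, smul_mul, mul_nonsing_inv _ h₁.isUnit_det,
      mul_nonsing_inv _ h₂.isUnit_det, trace_smul, trace_smul, trace_one, trace_one,
      Fintype.card_fin, Fintype.card_fin, smul_eq_mul, smul_eq_mul] at h3
    have h4 : (p₁ : ℝ) * p₂ * (X.1.det - 1) = 0 := by linear_combination -h3
    linarith [(mul_eq_zero.1 h4).resolve_left (mul_ne_zero q₁ q₂)]
  rw [hdet, mul_one] at e₁
  exact ⟨⟨h₁, hdet, h₂⟩, isCoreMatrix_whiten h₁ h₂ hS e₁ e₂⟩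

theorem hasDerivAt_stationarity {S : ℝ → Matrix (Idx p₁ p₂) (Idx p₁ p₂) ℝ}
    {V : Matrix (Idx p₁ p₂) (Idx p₁ p₂) ℝ} {K : ℝ → Pair p₁ p₂} {U : Pair p₁ p₂} {t : ℝ}
    (hS : HasDerivAt S V t) (hK : HasDerivAt K U t) (h₁ : IsUnit (K t).1.det)
    (h₂ : IsUnit (K t).2.det) :
    HasDerivAt (fun s => stationarity (S s) (K s))
      (U.1 - (1 / (p₂ : ℝ)) • (contract₁ V (K t).2⁻¹
            + contract₁ (S t) (-((K t).2⁻¹ * U.2 * (K t).2⁻¹)))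
          + (((K t).1.det - 1) • U.1 + ((K t).1.adjugate * U.1).trace • (K t).1),
        U.2 - (1 / (p₁ : ℝ)) • (contract₂ V (K t).1⁻¹
            + contract₂ (S t) (-((K t).1⁻¹ * U.1 * (K t).1⁻¹)))) t := by
  have hK₁ : HasDerivAt (fun s => (K s).1) U.1 t := hK.fst
  have hK₂ : HasDerivAt (fun s => (K s).2) U.2 t := hK.snd
  have a₁ := hasDerivAt_bilinear contract₁ hS (hasDerivAt_matrix_inv hK₂ h₂)
  have a₂ := hasDerivAt_bilinear contract₂ hS (hasDerivAt_matrix_inv hK₁ h₁)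
  have a₃ := ((hasDerivAt_det hK₁).sub_const 1).smul hK₁
  exact ((hK₁.sub (a₁.const_smul (1 / (p₂ : ℝ)))).add a₃).prodMk
    (hK₂.sub (a₂.const_smul (1 / (p₁ : ℝ))))

theorem contDiffAt_stationarity {S : Sym (Idx p₁ p₂)} {X : Pair p₁ p₂} (h₁ : IsUnit X.1.det)
    (h₂ : IsUnit X.2.det) :
    ContDiffAt ℝ ∞ (fun v : Sym (Idx p₁ p₂) × Pair p₁ p₂ => stationarity v.1 v.2) (S, X) := by
  have c₀ : ContDiffAt ℝ ∞ (fun v : Sym (Idx p₁ p₂) × Pair p₁ p₂ =>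
      (v.1 : Matrix (Idx p₁ p₂) (Idx p₁ p₂) ℝ)) (S, X) :=
    ((contDiff_coe (n := Idx p₁ p₂)).comp contDiff_fst).contDiffAt
  have c₁ : ContDiffAt ℝ ∞ (fun v : Sym (Idx p₁ p₂) × Pair p₁ p₂ => v.2.1) (S, X) :=
    (contDiff_fst.comp contDiff_snd).contDiffAt
  have c₂ : ContDiffAt ℝ ∞ (fun v : Sym (Idx p₁ p₂) × Pair p₁ p₂ => v.2.2) (S, X) :=
    (contDiff_snd.comp contDiff_snd).contDiffAt
  have a₁ := contDiffAt_bilinear contract₁ c₀ (contDiffAt_matrix_inv c₂ h₂)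
  have a₂ := contDiffAt_bilinear contract₂ c₀ (contDiffAt_matrix_inv c₁ h₁)
  have a₃ := ((contDiff_det.contDiffAt.comp (S, X) c₁).sub
    (contDiffAt_const (c := (1 : ℝ)))).smul c₁
  exact ((c₁.sub (a₁.const_smul (1 / (p₂ : ℝ)))).add a₃).prodMk
    (c₂.sub (a₂.const_smul (1 / (p₁ : ℝ))))

end KroneckerMap

/-! ### Smoothness and differential of the Kronecker map. -/

section Differential

variable {p₁ p₂ : ℕ}

theorem opM₁_eq (X : Pair p₁ p₂) (C : Matrix (Idx p₁ p₂) (Idx p₁ p₂) ℝ) (U : Pair p₁ p₂) :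
    opM₁ X C U = contract₁ C ((symmSqrt X.2)⁻¹ * U.2 * (symmSqrt X.2)⁻¹) := rfl

theorem opM₂_eq (X : Pair p₁ p₂) (C : Matrix (Idx p₁ p₂) (Idx p₁ p₂) ℝ) (U : Pair p₁ p₂) :
    opM₂ X C U = contract₂ C ((symmSqrt X.1)⁻¹ * U.1 * (symmSqrt X.1)⁻¹) := rfl

theorem symmSqrt_inv_unwhiten {n : Type} [Fintype n] [DecidableEq n] {A : Matrix n n ℝ}
    (hA : A.PosDef) (U : Matrix n n ℝ) :
    symmSqrt A * (A⁻¹ * U * A⁻¹) * symmSqrt A = (symmSqrt A)⁻¹ * U * (symmSqrt A)⁻¹ := by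
  rw [← symmSqrt_inv_mul_inv hA]
  calc _ = (symmSqrt A * (symmSqrt A)⁻¹) * (symmSqrt A)⁻¹ * U * (symmSqrt A)⁻¹
        * ((symmSqrt A)⁻¹ * symmSqrt A) := by simp only [Matrix.mul_assoc]
    _ = _ := by rw [symmSqrt_inv_mul hA, symmSqrt_mul_inv hA, Matrix.one_mul, Matrix.mul_one]

/-- Identifies the linearization of the inverse in the stationarity equations with the off-diagonal
part of `R_C`, for `C` the whitened `S`. -/
theorem contract₁_inv_conj {X : Pair p₁ p₂} (h₁ : X.1.PosDef) (h₂ : X.2.PosDef)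
    (S : Matrix (Idx p₁ p₂) (Idx p₁ p₂) ℝ) (U : Pair p₁ p₂) :
    contract₁ S (X.2⁻¹ * U.2 * X.2⁻¹)
      = symmSqrt X.1 * opM₁ X (whiten X S) U * symmSqrt X.1 := by
  conv_lhs => rw [← kronecker_mul_whiten_mul h₁ h₂ S]
  rw [contract₁_congr, symmSqrt_inv_unwhiten h₂, opM₁_eq]

theorem contract₂_inv_conj {X : Pair p₁ p₂} (h₁ : X.1.PosDef) (h₂ : X.2.PosDef)
    (S : Matrix (Idx p₁ p₂) (Idx p₁ p₂) ℝ) (U : Pair p₁ p₂) :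
    contract₂ S (X.1⁻¹ * U.1 * X.1⁻¹)
      = symmSqrt X.2 * opM₂ X (whiten X S) U * symmSqrt X.2 := by
  conv_lhs => rw [← kronecker_mul_whiten_mul h₁ h₂ S]
  rw [contract₂_congr, symmSqrt_inv_unwhiten h₁, opM₂_eq]

theorem contract₁_inv {X : Pair p₁ p₂} (h₁ : X.1.PosDef) (h₂ : X.2.PosDef)
    (V : Matrix (Idx p₁ p₂) (Idx p₁ p₂) ℝ) :
    contract₁ V X.2⁻¹ = symmSqrt X.1 * ptrace₁ (whiten X V) * symmSqrt X.1 := by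
  rw [ptrace₁_eq, contract₁_whiten_one h₂, symmSqrt_conj_cancel h₁]

theorem contract₂_inv {X : Pair p₁ p₂} (h₁ : X.1.PosDef) (h₂ : X.2.PosDef)
    (V : Matrix (Idx p₁ p₂) (Idx p₁ p₂) ℝ) :
    contract₂ V X.1⁻¹ = symmSqrt X.2 * ptrace₂ (whiten X V) * symmSqrt X.2 := by
  rw [ptrace₂_eq, contract₂_whiten_one h₁, symmSqrt_conj_cancel h₂]

theorem trace_inv_mul {n : Type} [Fintype n] [DecidableEq n] {A : Matrix n n ℝ}
    (hA : A.PosDef) (U : Matrix n n ℝ) :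
    (A⁻¹ * U).trace = ((symmSqrt A)⁻¹ * U * (symmSqrt A)⁻¹).trace := by
  rw [← symmSqrt_inv_mul_inv hA, trace_mul_comm ((symmSqrt A)⁻¹ * U), Matrix.mul_assoc]

theorem eq_zero_of_symmSqrt_inv_conj {n : Type} [Fintype n] [DecidableEq n] {A U : Matrix n n ℝ}
    (hA : A.PosDef) (h : (symmSqrt A)⁻¹ * U * (symmSqrt A)⁻¹ = 0) : U = 0 := by
  rw [← symmSqrt_conj_cancel hA U, h, Matrix.mul_zero, Matrix.zero_mul]

theorem symmSqrt_inv_conj_one {n : Type} [Fintype n] [DecidableEq n] {A : Matrix n n ℝ}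
    (hA : A.PosDef) (M : Matrix n n ℝ) {U : Matrix n n ℝ} {c s : ℝ}
    (h : U + c • (symmSqrt A * M * symmSqrt A) + s • A = 0) :
    (symmSqrt A)⁻¹ * U * (symmSqrt A)⁻¹ + c • M + s • 1 = 0 := by
  have h2 := congrArg (fun Z => (symmSqrt A)⁻¹ * Z * (symmSqrt A)⁻¹) h
  simp only [Matrix.mul_add, Matrix.add_mul, Matrix.mul_smul, smul_mul, Matrix.mul_zero,
    Matrix.zero_mul, symmSqrt_inv_conj_cancel hA, symmSqrt_inv_conj hA] at h2
  exact h2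

/-- The implicit function theorem for `stationarity`, with arbitrary pairs of square matrices as
unknowns. Zeros with positive definite components are normalized factors of the minimizer, so the
branch through `X` gives the factors of `k(T)` for `T` near `S`. -/
theorem exists_local_factors (hp₁ : 0 < p₁) (hp₂ : 0 < p₂) {S : Sym (Idx p₁ p₂)}
    (hS : S ∈ SPD (Idx p₁ p₂)) {X : Pair p₁ p₂} (hX : X ∈ Factors p₁ p₂)
    (hK : (kronMap S : Matrix (Idx p₁ p₂) (Idx p₁ p₂) ℝ) = X.2 ⊗ₖ X.1) :
    ∃ ψ : Sym (Idx p₁ p₂) → Pair p₁ p₂, ContDiffAt ℝ ∞ ψ S ∧ ψ S = X ∧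
      ∀ᶠ T in 𝓝 S, ψ T ∈ Factors p₁ p₂ ∧ stationarity (T : Sym (Idx p₁ p₂)) (ψ T) = 0 ∧
        (kronMap T : Matrix (Idx p₁ p₂) (Idx p₁ p₂) ℝ) = (ψ T).2 ⊗ₖ (ψ T).1 := by
  have q₁ : (p₁ : ℝ) ≠ 0 := by exact_mod_cast hp₁.ne'
  have q₂ : (p₂ : ℝ) ≠ 0 := by exact_mod_cast hp₂.ne'
  have hC := isCoreMatrix_of_kronMap_eq hp₁ hp₂ hS hX.1 hX.2.2 hK
  have hsm := contDiffAt_stationarity (S := S) hX.1.isUnit_det hX.2.2.isUnit_det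
  obtain ⟨ψ, hψ, hψ0, hψ1, hψ2⟩ := exists_implicit hsm (stationarity_eq_zero hp₁ hp₂ hX hC) (by
    intro U hU
    have h1 := hasDerivAt_stationarity (hasDerivAt_const (0 : ℝ)
      (S : Matrix (Idx p₁ p₂) (Idx p₁ p₂) ℝ)) (hasDerivAt_line_self X U 0)
      (by simpa using hX.1.isUnit_det) (by simpa using hX.2.2.isUnit_det)
    have h2 := fderiv_apply_eq_of_hasDerivAt (hsm.differentiableAt (by simp))
      ((hasDerivAt_const (0 : ℝ) S).prodMk (hasDerivAt_line_self X U 0)) (by simp) h1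
    simp only [zero_smul, add_zero] at h2
    replace hU := h2.symm.trans hU
    have e₁ := congrArg Prod.fst hU
    have e₂ := congrArg Prod.snd hU
    simp only [map_zero, LinearMap.zero_apply, zero_add, map_neg, smul_neg, sub_neg_eq_add,
      hX.2.1, sub_self, zero_smul, contract₁_inv_conj hX.1 hX.2.2,
      contract₂_inv_conj hX.1 hX.2.2, adjugate_eq_det_smul_inv hX.1.isUnit_det, one_smul,
      trace_inv_mul hX.1, Prod.fst_zero, Prod.snd_zero] at e₁ e₂
    replace e₁ := symmSqrt_inv_conj_one hX.1 _ e₁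
    replace e₂ := symmSqrt_inv_conj_one hX.2.2 (opM₂ X (whiten X S) U) (U := U.2)
      (c := 1 / (p₁ : ℝ)) (s := 0) (by rw [zero_smul, add_zero]; exact e₂)
    rw [zero_smul, add_zero] at e₂
    rw [opM₁_eq] at e₁
    rw [opM₂_eq] at e₂
    set u₁ := (symmSqrt X.1)⁻¹ * U.1 * (symmSqrt X.1)⁻¹ with hu₁
    set u₂ := (symmSqrt X.2)⁻¹ * U.2 * (symmSqrt X.2)⁻¹ with hu₂
    -- The determinant term enters the first equation as `tr u₁ • 1`. The traces of the two
    -- equations then agree up to a nonzero multiple of `tr u₁`.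
    have ht : u₁.trace = 0 := by
      have t₁ := congrArg trace e₁
      have t₂ := congrArg trace e₂
      simp only [trace_add, trace_smul, hC.trace_contract₁, hC.trace_contract₂, smul_eq_mul,
        trace_one, Fintype.card_fin, trace_zero] at t₁ t₂
      have t₃ : (p₂ : ℝ) * u₁.trace + p₁ * u₂.trace + p₂ * p₁ * u₁.trace = 0 := by
        field_simp at t₁
        linarith
      have t₄ : (p₁ : ℝ) * u₂.trace + p₂ * u₁.trace = 0 := by
        field_simp at t₂
        linarith
      have t₅ : ((p₂ : ℝ) * p₁) * u₁.trace = 0 := by linarith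
      exact (mul_eq_zero.1 t₅).resolve_left (mul_ne_zero q₂ q₁)
    obtain ⟨z₁, z₂⟩ := hC.linearized_eq_zero hp₁ hp₂ ht e₁ e₂
    exact Prod.ext (eq_zero_of_symmSqrt_inv_conj hX.1 z₁)
      (eq_zero_of_symmSqrt_inv_conj hX.2.2 z₂))
  simp only at hψ hψ0 hψ1
  have hcont : ContinuousAt ψ S := hψ.continuousAt
  -- For symmetric `T` the transposed pair solves the same equations, so local uniqueness gives
  -- symmetry.
  have htr : ∀ᶠ T in 𝓝 S, ((ψ T).1ᵀ, (ψ T).2ᵀ) = ψ T := by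
    have hT : Filter.Tendsto (fun T => (T, ((ψ T).1ᵀ, (ψ T).2ᵀ))) (𝓝 S) (𝓝 (S, X)) := by
      have hc : Continuous fun Z : Pair p₁ p₂ => (Z.1ᵀ, Z.2ᵀ) := by fun_prop
      have h1 : Filter.Tendsto (fun T => ((ψ T).1ᵀ, (ψ T).2ᵀ)) (𝓝 S)
          (𝓝 ((ψ S).1ᵀ, (ψ S).2ᵀ)) := (hc.tendsto (ψ S)).comp hcont
      rw [hψ0, hX.1.transpose_eq, hX.2.2.transpose_eq] at h1
      exact Filter.tendsto_id.prodMk_nhds h1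
    filter_upwards [hT.eventually hψ2, hψ1] with T h1 h2
    refine (h1 ?_).symm
    simp only [stationarity_transpose (coe_transpose T), h2]
    simp
  have hpd₁ : ∀ᶠ T in 𝓝 S, (ψ T).1.PosDef := by
    have h1 := (continuous_fst.continuousAt.comp hcont).eventually
      ((by rw [Function.comp_apply, hψ0]; exact eventually_posDef hX.1) :
        ∀ᶠ B in 𝓝 ((Prod.fst ∘ ψ) S), Bᵀ = B → B.PosDef)
    filter_upwards [h1, htr] with T h2 h3 using h2 (congrArg Prod.fst h3)
  have hpd₂ : ∀ᶠ T in 𝓝 S, (ψ T).2.PosDef := by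
    have h1 := (continuous_snd.continuousAt.comp hcont).eventually
      ((by rw [Function.comp_apply, hψ0]; exact eventually_posDef hX.2.2) :
        ∀ᶠ B in 𝓝 ((Prod.snd ∘ ψ) S), Bᵀ = B → B.PosDef)
    filter_upwards [h1, htr] with T h2 h3 using h2 (congrArg Prod.snd h3)
  refine ⟨ψ, hψ, hψ0, ?_⟩
  filter_upwards [hpd₁, hpd₂, hψ1, isOpen_SPD.mem_nhds hS] with T h₁ h₂ h3 hT
  obtain ⟨h4, h5⟩ := factors_of_stationarity hT hp₁ hp₂ h₁ h₂ h3
  exact ⟨h4, h3, kronMap_eq_of_isCoreMatrix hT h₁ h₂ h5⟩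

theorem contDiffAt_kronMap (hp₁ : 0 < p₁) (hp₂ : 0 < p₂) {S : Sym (Idx p₁ p₂)}
    (hS : S ∈ SPD (Idx p₁ p₂)) : ContDiffAt ℝ ∞ (kronMap (p₁ := p₁) (p₂ := p₂)) S := by
  obtain ⟨X, ⟨hX, hK⟩, -⟩ := existsUnique_factors hp₁ hp₂ hS
  obtain ⟨ψ, hψ, -, hev⟩ := exists_local_factors hp₁ hp₂ hS hX hK
  refine contDiffAt_sym_of_coe ?_
  refine (contDiffAt_kronecker (contDiffAt_snd.comp S hψ)
    (contDiffAt_fst.comp S hψ)).congr_of_eventuallyEq ?_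
  filter_upwards [hev] with T hT using hT.2.2

/-- The differential of the Kronecker map. -/
theorem exists_dk_eq (hp₁ : 0 < p₁) (hp₂ : 0 < p₂) {S : Sym (Idx p₁ p₂)}
    (hS : S ∈ SPD (Idx p₁ p₂)) {X : Pair p₁ p₂} (hX : X ∈ Factors p₁ p₂)
    (hK : (kronMap S : Matrix (Idx p₁ p₂) (Idx p₁ p₂) ℝ) = X.2 ⊗ₖ X.1) (V : Sym (Idx p₁ p₂)) :
    ∃ U ∈ tangent X, opR X (whiten X S) U = rhs X V ∧ dk S V = kronTangent X U := by
  have q₁ : (p₁ : ℝ) ≠ 0 := by exact_mod_cast hp₁.ne'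
  have q₂ : (p₂ : ℝ) ≠ 0 := by exact_mod_cast hp₂.ne'
  have hC := isCoreMatrix_of_kronMap_eq hp₁ hp₂ hS hX.1 hX.2.2 hK
  obtain ⟨ψ, hψ, hψ0, hev⟩ := exists_local_factors hp₁ hp₂ hS hX hK
  set U := fderiv ℝ ψ S V with hU
  have hd : HasDerivAt (fun t : ℝ => ψ (S + t • V)) U 0 :=
    hasDerivAt_line V (hψ.differentiableAt (by simp))
  have hd₁ : HasDerivAt (fun t : ℝ => (ψ (S + t • V)).1) U.1 0 := hd.fst
  have hd₂ : HasDerivAt (fun t : ℝ => (ψ (S + t • V)).2) U.2 0 := hd.snd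
  replace hev := (tendsto_line S V).eventually hev
  have hsym₁ : U.1ᵀ = U.1 := by
    refine (hasDerivAt_transpose hd₁).unique (hd₁.congr_of_eventuallyEq ?_)
    filter_upwards [hev] with t ht using ht.1.1.transpose_eq
  have hsym₂ : U.2ᵀ = U.2 := by
    refine (hasDerivAt_transpose hd₂).unique (hd₂.congr_of_eventuallyEq ?_)
    filter_upwards [hev] with t ht using ht.1.2.2.transpose_eq
  have htr : (X.1⁻¹ * U.1).trace = 0 := by
    have h1 := hasDerivAt_det hd₁
    simp only [zero_smul, add_zero, hψ0, adjugate_eq_det_smul_inv hX.1.isUnit_det, hX.2.1,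
      one_smul] at h1
    refine h1.unique ((hasDerivAt_const (0 : ℝ) (1 : ℝ)).congr_of_eventuallyEq ?_)
    filter_upwards [hev] with t ht using ht.1.2.1
  -- The stationarity equations hold along `S + t V`; their derivative at `0` is the linear equation
  -- for `U`.
  have hst := hasDerivAt_stationarity
    (hasDerivAt_line_self (S : Matrix (Idx p₁ p₂) (Idx p₁ p₂) ℝ) V 0) hd
    (by simpa [hψ0] using hX.1.isUnit_det) (by simpa [hψ0] using hX.2.2.isUnit_det)
  simp only [zero_smul, add_zero, hψ0] at hst
  have h0 := hst.unique ((hasDerivAt_const (0 : ℝ) (0 : Pair p₁ p₂)).congr_of_eventuallyEq (by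
    filter_upwards [hev] with t ht using ht.2.1))
  have e₁ := congrArg Prod.fst h0
  have e₂ := congrArg Prod.snd h0
  simp only [map_neg, hX.2.1, sub_self, zero_smul, contract₁_inv_conj hX.1 hX.2.2,
    contract₂_inv_conj hX.1 hX.2.2, contract₁_inv hX.1 hX.2.2, contract₂_inv hX.1 hX.2.2,
    adjugate_eq_det_smul_inv hX.1.isUnit_det, one_smul, htr, add_zero, Prod.fst_zero,
    Prod.snd_zero] at e₁ e₂
  have htr₁ : ((symmSqrt X.1)⁻¹ * U.1 * (symmSqrt X.1)⁻¹).trace = 0 := by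
    rw [← trace_inv_mul hX.1, htr]
  -- The trace of the second equation fixes `tr u₂`. Hence the multiples of `Σ₁` subtracted in `opR`
  -- and in `rhs` to stay tangent are the same and cancel.
  have htr₂ : ((symmSqrt X.2)⁻¹ * U.2 * (symmSqrt X.2)⁻¹).trace
      = (whiten X (V : Matrix (Idx p₁ p₂) (Idx p₁ p₂) ℝ)).trace / p₁ := by
    have h1 := congrArg (fun M => ((symmSqrt X.2)⁻¹ * M * (symmSqrt X.2)⁻¹).trace) e₂
    simp only [Matrix.mul_sub, Matrix.sub_mul, Matrix.mul_add, Matrix.add_mul, Matrix.mul_smul,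
      smul_mul, Matrix.mul_neg, Matrix.neg_mul, symmSqrt_inv_conj_cancel hX.2.2, trace_sub,
      trace_smul, trace_add, trace_neg, opM₂_eq, hC.trace_contract₂, htr₁, Matrix.mul_zero,
      Matrix.zero_mul, trace_zero, smul_eq_mul, ptrace₂_eq, trace_contract₂_one] at h1
    rw [div_eq_mul_one_div]
    linarith
  refine ⟨U, ⟨hsym₁, htr, hsym₂⟩, ?_, ?_⟩
  · refine Prod.ext ?_ ?_
    · simp only [opR, rhs, htr₂]
      rw [Matrix.mul_sub, Matrix.sub_mul, Matrix.mul_smul, smul_mul, Matrix.mul_one,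
        symmSqrt_mul_self hX.1, smul_sub, smul_smul, one_div_mul_eq_div]
      rw [smul_add, smul_neg] at e₁
      rw [sub_left_inj, ← sub_eq_zero, ← e₁]
      abel
    · simp only [opR, rhs]
      rw [smul_add, smul_neg] at e₂
      rw [← sub_eq_zero, ← e₂]
      abel
  · have h1 : HasDerivAt (fun t : ℝ =>
        ((kronMap (S + t • V) : Sym (Idx p₁ p₂)) : Matrix (Idx p₁ p₂) (Idx p₁ p₂) ℝ))
        (dk S V) 0 :=
      hasDerivAt_coe (hasDerivAt_line V ((contDiffAt_kronMap hp₁ hp₂ hS).differentiableAt (by simp)))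
    have h2 := hasDerivAt_kronecker hd₂ hd₁
    simp only [zero_smul, add_zero, hψ0] at h2
    refine h1.unique (h2.congr_of_eventuallyEq ?_)
    filter_upwards [hev] with t ht using ht.2.2

end Differential

/-! ### The core map and the diffeomorphism. -/

section CoreMap

variable {p₁ p₂ : ℕ}

theorem isSqrt_sqrtMap (κ : SqrtKind) {K : Sym (Idx p₁ p₂)} (hK : K ∈ SPD (Idx p₁ p₂)) :
    IsSqrt κ (K : Matrix (Idx p₁ p₂) (Idx p₁ p₂) ℝ) (sqrtMap κ K) := by
  cases κ
  · exact symmSqrt_spec hK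
  · exact choleskyFactor_spec (toLex_idx_injective p₁ p₂) hK

theorem contDiffAt_sqrtMap (κ : SqrtKind) {K : Sym (Idx p₁ p₂)} (hK : K ∈ SPD (Idx p₁ p₂)) :
    ContDiffAt ℝ ∞ (sqrtMap κ) K := by
  cases κ
  · exact contDiffAt_symmSqrt hK
  · exact contDiffAt_choleskyFactor (toLex_idx_injective p₁ p₂) hK

theorem sqrtMap_mul_transpose (κ : SqrtKind) {K : Sym (Idx p₁ p₂)} (hK : K ∈ SPD (Idx p₁ p₂)) :
    sqrtMap κ K * (sqrtMap κ K)ᵀ = K := by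
  cases κ
  · change symmSqrt (K : Matrix (Idx p₁ p₂) (Idx p₁ p₂) ℝ) * (symmSqrt _)ᵀ = _
    rw [(symmSqrt_posDef hK).transpose_eq, symmSqrt_mul_self hK]
  · exact (choleskyFactor_spec (toLex_idx_injective p₁ p₂) hK).2.2

theorem isUnit_det_sqrtMap (κ : SqrtKind) {K : Sym (Idx p₁ p₂)} (hK : K ∈ SPD (Idx p₁ p₂)) :
    IsUnit (sqrtMap κ K).det := by
  have h := Matrix.PosDef.det_pos (show (K : Matrix (Idx p₁ p₂) (Idx p₁ p₂) ℝ).PosDef from hK)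
  rw [← sqrtMap_mul_transpose κ hK, det_mul] at h
  exact (left_ne_zero_of_mul h.ne').isUnit

/-- Besides smoothness and `H Hᵀ = K`, separability of `H` is the only property of the root that the
diffeomorphism needs. -/
theorem exists_sqrtMap_eq_kronecker (κ : SqrtKind) {K : Sym (Idx p₁ p₂)}
    (hK : K ∈ KronSPD p₁ p₂) : ∃ (B₁ : Matrix (Fin p₁) (Fin p₁) ℝ)
      (B₂ : Matrix (Fin p₂) (Fin p₂) ℝ), IsUnit B₁.det ∧ IsUnit B₂.det ∧
        sqrtMap κ K = B₂ ⊗ₖ B₁ := by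
  obtain ⟨X, h₁, h₂, hKX⟩ := hK
  cases κ
  · refine ⟨symmSqrt X.1, symmSqrt X.2, (symmSqrt_posDef h₁).isUnit_det,
      (symmSqrt_posDef h₂).isUnit_det, ?_⟩
    change symmSqrt (K : Matrix (Idx p₁ p₂) (Idx p₁ p₂) ℝ) = _
    rw [hKX, symmSqrt_kronecker h₂ h₁]
  · refine ⟨choleskyFactor id X.1, choleskyFactor id X.2,
      isUnit_det_of_isCholesky h₁ (choleskyFactor_spec Function.injective_id h₁),
      isUnit_det_of_isCholesky h₂ (choleskyFactor_spec Function.injective_id h₂), ?_⟩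
    change choleskyFactor (fun x : Idx p₁ p₂ => toLex x)
      (K : Matrix (Idx p₁ p₂) (Idx p₁ p₂) ℝ) = _
    rw [hKX, choleskyFactor_kronecker h₁ h₂]

theorem congruence_congruence {n : Type} [Fintype n] [DecidableEq n] (A B : Matrix n n ℝ)
    (S : Sym n) : congruence A (congruence B S) = congruence (A * B) S := by
  ext1
  simp only [congruence, transpose_mul, Matrix.mul_assoc]

theorem congruence_one {n : Type} [Fintype n] [DecidableEq n] (S : Sym n) :
    congruence 1 S = S := by
  ext1
  simp [congruence]

theorem coe_coreMap (κ : SqrtKind) (S : Sym (Idx p₁ p₂)) :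
    (coreMap κ S : Matrix (Idx p₁ p₂) (Idx p₁ p₂) ℝ)
      = (sqrtMap κ (kronMap S))⁻¹ * (S : Matrix (Idx p₁ p₂) (Idx p₁ p₂) ℝ)
        * (sqrtMap κ (kronMap S))⁻¹ᵀ := rfl

/-- A congruence by a separable root of `K` maps the core matrices to the matrices with Kronecker
part `K`. -/
theorem kronMap_congruence_sqrtMap (hp₁ : 0 < p₁) (hp₂ : 0 < p₂) (κ : SqrtKind)
    {K C : Sym (Idx p₁ p₂)} (hK : K ∈ KronSPD p₁ p₂) (hC : C ∈ Core p₁ p₂) :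
    kronMap (congruence (sqrtMap κ K) C) = K := by
  obtain ⟨B₁, B₂, hB₁, hB₂, hB⟩ := exists_sqrtMap_eq_kronecker κ hK
  rw [hB, kronMap_congruence hp₁ hp₂ hC.1 hB₁ hB₂, ← hB]
  ext1
  simp only [congruence]
  rw [hC.2, Matrix.mul_one, sqrtMap_mul_transpose κ (KronSPD_subset_SPD hK)]

theorem inv_conj_mul_transpose {n : Type} [Fintype n] [DecidableEq n] {H : Matrix n n ℝ}
    (hH : IsUnit H.det) : H⁻¹ * (H * Hᵀ) * H⁻¹ᵀ = 1 := by
  have hHt : IsUnit Hᵀ.det := by rwa [det_transpose]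
  rw [nonsing_inv_mul_cancel_left _ _ hH, transpose_nonsing_inv, mul_nonsing_inv _ hHt]

/-- Equivariance under the separable matrix `H⁻¹` gives `k(c(S)) = H⁻¹ k(S) H⁻ᵀ = I`. -/
theorem coreMap_mem_Core (hp₁ : 0 < p₁) (hp₂ : 0 < p₂) (κ : SqrtKind) {S : Sym (Idx p₁ p₂)}
    (hS : S ∈ SPD (Idx p₁ p₂)) : coreMap κ S ∈ Core p₁ p₂ := by
  have hK := kronMap_mem_KronSPD hp₁ hp₂ hS
  have hu := isUnit_det_sqrtMap κ (KronSPD_subset_SPD hK)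
  obtain ⟨B₁, B₂, hB₁, hB₂, hB⟩ := exists_sqrtMap_eq_kronecker κ hK
  refine ⟨congruence_mem_SPD ((isUnit_nonsing_inv_det_iff).2 hu) hS, ?_⟩
  have h : kronMap (coreMap κ S) = congruence (sqrtMap κ (kronMap S))⁻¹ (kronMap S) := by
    rw [coreMap, hB, inv_kronecker]
    exact kronMap_congruence hp₁ hp₂ hS ((isUnit_nonsing_inv_det_iff).2 hB₁)
      ((isUnit_nonsing_inv_det_iff).2 hB₂)
  rw [h]
  simp only [congruence]
  conv_lhs => enter [1, 2]; rw [← sqrtMap_mul_transpose κ (KronSPD_subset_SPD hK)]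
  exact inv_conj_mul_transpose hu

theorem isCoreMatrix_of_mem_Core (hp₁ : 0 < p₁) (hp₂ : 0 < p₂) {C : Sym (Idx p₁ p₂)}
    (hC : C ∈ Core p₁ p₂) : IsCoreMatrix (C : Matrix (Idx p₁ p₂) (Idx p₁ p₂) ℝ) := by
  have h := isCoreMatrix_of_kronMap_eq hp₁ hp₂ hC.1 (X := (1, 1)) PosDef.one PosDef.one
    (by rw [hC.2, one_kronecker_one])
  simpa [whiten, symmSqrt_one] using h

theorem congruence_sqrtMap_coreMap (hp₁ : 0 < p₁) (hp₂ : 0 < p₂) (κ : SqrtKind)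
    {S : Sym (Idx p₁ p₂)} (hS : S ∈ SPD (Idx p₁ p₂)) :
    congruence (sqrtMap κ (kronMap S)) (coreMap κ S) = S := by
  rw [coreMap, congruence_congruence,
    mul_nonsing_inv _ (isUnit_det_sqrtMap κ (kronMap_mem_SPD hp₁ hp₂ hS)), congruence_one]

theorem coreMap_symmetric {S : Sym (Idx p₁ p₂)} {X : Pair p₁ p₂} (h₁ : X.1.PosDef)
    (h₂ : X.2.PosDef) (hK : (kronMap S : Matrix (Idx p₁ p₂) (Idx p₁ p₂) ℝ) = X.2 ⊗ₖ X.1) :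
    (coreMap .symmetric S : Matrix (Idx p₁ p₂) (Idx p₁ p₂) ℝ) = whiten X S := by
  have h : sqrtMap .symmetric (kronMap S) = symmSqrt X.2 ⊗ₖ symmSqrt X.1 := by
    change symmSqrt (kronMap S : Matrix (Idx p₁ p₂) (Idx p₁ p₂) ℝ) = _
    rw [hK, symmSqrt_kronecker h₂ h₁]
  rw [coe_coreMap, h, whiten,
    ((symmSqrt_posDef h₂).kronecker (symmSqrt_posDef h₁)).inv.transpose_eq]

theorem contDiffAt_sqrtMap_kronMap (hp₁ : 0 < p₁) (hp₂ : 0 < p₂) (κ : SqrtKind)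
    {S : Sym (Idx p₁ p₂)} (hS : S ∈ SPD (Idx p₁ p₂)) :
    ContDiffAt ℝ ∞ (fun T : Sym (Idx p₁ p₂) => sqrtMap κ (kronMap T)) S :=
  (contDiffAt_sqrtMap κ (kronMap_mem_SPD hp₁ hp₂ hS)).comp S (contDiffAt_kronMap hp₁ hp₂ hS)

theorem contDiffAt_coreMap (hp₁ : 0 < p₁) (hp₂ : 0 < p₂) (κ : SqrtKind)
    {S : Sym (Idx p₁ p₂)} (hS : S ∈ SPD (Idx p₁ p₂)) :
    ContDiffAt ℝ ∞ (coreMap (p₁ := p₁) (p₂ := p₂) κ) S := by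
  refine contDiffAt_sym_of_coe ?_
  have h := contDiffAt_matrix_inv (contDiffAt_sqrtMap_kronMap hp₁ hp₂ κ hS)
    (isUnit_det_sqrtMap κ (kronMap_mem_SPD hp₁ hp₂ hS))
  exact (h.mul contDiff_coe.contDiffAt).mul ((contDiff_linearMap
    (transposeLinearEquiv (Idx p₁ p₂) (Idx p₁ p₂) ℝ ℝ).toLinearMap).contDiffAt.comp S h)

theorem contDiffAt_kcd (hp₁ : 0 < p₁) (hp₂ : 0 < p₂) (κ : SqrtKind)
    {S : Sym (Idx p₁ p₂)} (hS : S ∈ SPD (Idx p₁ p₂)) :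
    ContDiffAt ℝ ∞ (kcd (p₁ := p₁) (p₂ := p₂) κ) S :=
  (contDiffAt_kronMap hp₁ hp₂ hS).prodMk (contDiffAt_coreMap hp₁ hp₂ κ hS)

theorem contDiffAt_kcdInv (κ : SqrtKind) {v : Sym (Idx p₁ p₂) × Sym (Idx p₁ p₂)}
    (hv : v.1 ∈ SPD (Idx p₁ p₂)) : ContDiffAt ℝ ∞ (kcdInv (p₁ := p₁) (p₂ := p₂) κ) v := by
  refine contDiffAt_sym_of_coe ?_
  have h : ContDiffAt ℝ ∞ (fun w : Sym (Idx p₁ p₂) × Sym (Idx p₁ p₂) => sqrtMap κ w.1) v :=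
    (contDiffAt_sqrtMap κ hv).comp v contDiffAt_fst
  have hc : ContDiffAt ℝ ∞ (fun w : Sym (Idx p₁ p₂) × Sym (Idx p₁ p₂) =>
      (w.2 : Matrix (Idx p₁ p₂) (Idx p₁ p₂) ℝ)) v :=
    ((contDiff_coe (n := Idx p₁ p₂)).comp contDiff_snd).contDiffAt
  exact (h.mul hc).mul ((contDiff_linearMap
    (transposeLinearEquiv (Idx p₁ p₂) (Idx p₁ p₂) ℝ ℝ).toLinearMap).contDiffAt.comp v h)

theorem isDiffeo_kcd (hp₁ : 0 < p₁) (hp₂ : 0 < p₂) (κ : SqrtKind) :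
    IsDiffeoWithInverse (kcd (p₁ := p₁) (p₂ := p₂) κ) (kcdInv κ)
      (SPD (Idx p₁ p₂)) (KronSPD p₁ p₂ ×ˢ Core p₁ p₂) where
  mapsTo := fun S hS => ⟨kronMap_mem_KronSPD hp₁ hp₂ hS, coreMap_mem_Core hp₁ hp₂ κ hS⟩
  mapsTo_inv := fun v hv => congruence_mem_SPD
    (isUnit_det_sqrtMap κ (KronSPD_subset_SPD hv.1)) hv.2.1
  left_inv := fun S hS => congruence_sqrtMap_coreMap hp₁ hp₂ κ hS
  right_inv := by
    rintro ⟨K, C⟩ ⟨hK, hC⟩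
    have h := kronMap_congruence_sqrtMap hp₁ hp₂ κ hK hC
    refine Prod.ext h ?_
    change congruence (sqrtMap κ (kronMap (congruence (sqrtMap κ K) C)))⁻¹ (congruence _ C) = C
    rw [h, congruence_congruence,
      nonsing_inv_mul _ (isUnit_det_sqrtMap κ (KronSPD_subset_SPD hK)), congruence_one]
  smooth := fun S hS => ⟨SPD (Idx p₁ p₂), isOpen_SPD, hS, kcd κ,
    fun T hT => (contDiffAt_kcd hp₁ hp₂ κ hT).contDiffWithinAt, fun _ _ => rfl⟩
  -- `g` is smooth on the open set of pairs with positive definite first component, so no manifold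
  -- structure on the target is required.
  smooth_inv := fun v hv => ⟨Prod.fst ⁻¹' SPD (Idx p₁ p₂), isOpen_SPD.preimage continuous_fst,
    KronSPD_subset_SPD hv.1, kcdInv κ,
    fun w hw => (contDiffAt_kcdInv κ hw).contDiffWithinAt, fun _ _ => rfl⟩

theorem fderiv_kcd (hp₁ : 0 < p₁) (hp₂ : 0 < p₂) (κ : SqrtKind) {S : Sym (Idx p₁ p₂)}
    (hS : S ∈ SPD (Idx p₁ p₂)) (V : Sym (Idx p₁ p₂)) :
    fderiv ℝ (kcd κ) S V = (fderiv ℝ kronMap S V, fderiv ℝ (coreMap κ) S V) := by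
  have h := ((contDiffAt_kronMap hp₁ hp₂ hS).differentiableAt (by simp)).hasFDerivAt.prodMk
    ((contDiffAt_coreMap hp₁ hp₂ κ hS).differentiableAt (by simp)).hasFDerivAt
  have h2 : fderiv ℝ (kcd κ) S = _ := h.fderiv
  rw [h2]
  rfl

/-- The product rule is applied to `S = H c(S) Hᵀ` and solved for the derivative of the middle
factor, which avoids differentiating `H⁻¹`. -/
theorem dc_eq (hp₁ : 0 < p₁) (hp₂ : 0 < p₂) (κ : SqrtKind) {S : Sym (Idx p₁ p₂)}
    (hS : S ∈ SPD (Idx p₁ p₂)) (V : Sym (Idx p₁ p₂)) :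
    dc κ S V
      = (sqrtMap κ (kronMap S))⁻¹ * (V : Matrix (Idx p₁ p₂) (Idx p₁ p₂) ℝ)
          * (sqrtMap κ (kronMap S))⁻¹.transpose
        - (sqrtMap κ (kronMap S))⁻¹
          * (fderiv ℝ (sqrtMap κ) (kronMap S) (fderiv ℝ kronMap S V)) * (coreMap κ S)
        - (coreMap κ S : Matrix (Idx p₁ p₂) (Idx p₁ p₂) ℝ)
          * (fderiv ℝ (sqrtMap κ) (kronMap S) (fderiv ℝ kronMap S V)).transpose
          * (sqrtMap κ (kronMap S))⁻¹.transpose := by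
  set D := fderiv ℝ (sqrtMap κ) (kronMap S) (fderiv ℝ kronMap S V) with hD
  have hu := isUnit_det_sqrtMap κ (kronMap_mem_SPD hp₁ hp₂ hS)
  have hk := hasDerivAt_line V ((contDiffAt_kronMap hp₁ hp₂ hS).differentiableAt (by simp))
  have hH : HasDerivAt (fun t : ℝ => sqrtMap κ (kronMap (S + t • V))) D 0 := by
    have h := (contDiffAt_sqrtMap κ (kronMap_mem_SPD hp₁ hp₂ hS)).differentiableAt (by simp)
    have h2 : HasFDerivAt (sqrtMap κ) (fderiv ℝ (sqrtMap κ) (kronMap S))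
        (kronMap (S + (0 : ℝ) • V)) := by
      rw [zero_smul, add_zero]
      exact h.hasFDerivAt
    exact h2.comp_hasDerivAt (0 : ℝ) hk
  have hc : HasDerivAt (fun t : ℝ =>
      ((coreMap κ (S + t • V) : Sym (Idx p₁ p₂)) : Matrix (Idx p₁ p₂) (Idx p₁ p₂) ℝ))
      (dc κ S V) 0 :=
    hasDerivAt_coe (hasDerivAt_line V
      ((contDiffAt_coreMap hp₁ hp₂ κ hS).differentiableAt (by simp)))
  have hprod := (hH.mul hc).mul (hasDerivAt_transpose hH)
  simp only [Pi.mul_apply, zero_smul, add_zero] at hprod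
  set H := sqrtMap κ (kronMap S) with hHdef
  have hHt : IsUnit Hᵀ.det := by rwa [det_transpose]
  have hV := hprod.unique ((hasDerivAt_line_self
    (S : Matrix (Idx p₁ p₂) (Idx p₁ p₂) ℝ) V 0).congr_of_eventuallyEq (by
      filter_upwards [(tendsto_line S V).eventually (isOpen_SPD.mem_nhds hS)] with t ht
      exact congrArg Subtype.val (congruence_sqrtMap_coreMap hp₁ hp₂ κ ht)))
  rw [← hV, transpose_nonsing_inv]
  simp only [Matrix.mul_add, Matrix.add_mul, Matrix.mul_assoc, mul_nonsing_inv _ hHt,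
    Matrix.mul_one, nonsing_inv_mul_cancel_left _ _ hu]
  abel

theorem coreMap_eq_one_iff (hp₁ : 0 < p₁) (hp₂ : 0 < p₂) (κ : SqrtKind) {S : Sym (Idx p₁ p₂)}
    (hS : S ∈ SPD (Idx p₁ p₂)) :
    (coreMap κ S : Matrix (Idx p₁ p₂) (Idx p₁ p₂) ℝ) = 1 ↔ S = kronMap S := by
  have hK := kronMap_mem_SPD hp₁ hp₂ hS
  constructor
  · intro h
    have h2 := congrArg Subtype.val (congruence_sqrtMap_coreMap hp₁ hp₂ κ hS)
    simp only [congruence] at h2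
    rw [h, Matrix.mul_one, sqrtMap_mul_transpose κ hK] at h2
    exact Subtype.ext h2.symm
  · intro h
    rw [coe_coreMap]
    have h2 : (S : Matrix (Idx p₁ p₂) (Idx p₁ p₂) ℝ)
        = sqrtMap κ (kronMap S) * (sqrtMap κ (kronMap S))ᵀ := by
      rw [sqrtMap_mul_transpose κ hK, ← h]
    conv_lhs => enter [1, 2]; rw [h2]
    exact inv_conj_mul_transpose (isUnit_det_sqrtMap κ hK)

end CoreMap

/-! ### The operator `R_C` in whitened coordinates. -/

section HessianOperator

variable {p₁ p₂ : ℕ}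

/-- The vector `r₁⁻¹ U₁ r₁⁻¹` with `r₁` the symmetric root of `X₁`. -/
noncomputable abbrev white₁ (X U : Pair p₁ p₂) : Matrix (Fin p₁) (Fin p₁) ℝ :=
  (symmSqrt X.1)⁻¹ * U.1 * (symmSqrt X.1)⁻¹

/-- The vector `r₂⁻¹ U₂ r₂⁻¹` with `r₂` the symmetric root of `X₂`. -/
noncomputable abbrev white₂ (X U : Pair p₁ p₂) : Matrix (Fin p₂) (Fin p₂) ℝ :=
  (symmSqrt X.2)⁻¹ * U.2 * (symmSqrt X.2)⁻¹

theorem transpose_symmSqrt_inv_conj {n : Type} [Fintype n] [DecidableEq n] {A U : Matrix n n ℝ}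
    (hA : A.PosDef) (hU : Uᵀ = U) :
    ((symmSqrt A)⁻¹ * U * (symmSqrt A)⁻¹)ᵀ = (symmSqrt A)⁻¹ * U * (symmSqrt A)⁻¹ := by
  rw [transpose_mul, transpose_mul, (symmSqrt_posDef hA).inv.transpose_eq, hU, Matrix.mul_assoc]

theorem transpose_symmSqrt_conj {n : Type} [Fintype n] [DecidableEq n] {A U : Matrix n n ℝ}
    (hA : A.PosDef) (hU : Uᵀ = U) :
    (symmSqrt A * U * symmSqrt A)ᵀ = symmSqrt A * U * symmSqrt A := by
  rw [transpose_mul, transpose_mul, (symmSqrt_posDef hA).transpose_eq, hU, Matrix.mul_assoc]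

/-- In whitened coordinates the base point disappears, and `R_C U = 0` becomes the system of
`IsCoreMatrix.linearized_eq_zero`. -/
theorem white₁_opR {X : Pair p₁ p₂} (h₁ : X.1.PosDef) (C : Matrix (Idx p₁ p₂) (Idx p₁ p₂) ℝ)
    (U : Pair p₁ p₂) : white₁ X (opR X C U)
      = white₁ X U + (1 / (p₂ : ℝ)) • contract₁ C (white₂ X U)
        - ((white₂ X U).trace / p₂) • 1 := by
  simp only [white₁, opR, Matrix.mul_add, Matrix.add_mul, Matrix.mul_sub, Matrix.sub_mul,
    Matrix.mul_smul, smul_mul, symmSqrt_inv_conj_cancel h₁, symmSqrt_inv_conj h₁, opM₁_eq]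

theorem white₂_opR {X : Pair p₁ p₂} (h₂ : X.2.PosDef) (C : Matrix (Idx p₁ p₂) (Idx p₁ p₂) ℝ)
    (U : Pair p₁ p₂) : white₂ X (opR X C U)
      = white₂ X U + (1 / (p₁ : ℝ)) • contract₂ C (white₁ X U) := by
  simp only [white₂, opR, Matrix.mul_add, Matrix.add_mul, Matrix.mul_smul, smul_mul,
    symmSqrt_inv_conj_cancel h₂, opM₂_eq]

theorem trace_white₁ {X U : Pair p₁ p₂} (h₁ : X.1.PosDef) (hU : U ∈ tangent X) :
    (white₁ X U).trace = 0 := by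
  rw [white₁, ← trace_inv_mul h₁, hU.2.1]

theorem trace_inv_mul_inv_mul {n : Type} [Fintype n] [DecidableEq n] {A : Matrix n n ℝ}
    (hA : A.PosDef) (U V : Matrix n n ℝ) : (A⁻¹ * U * A⁻¹ * V).trace
      = (((symmSqrt A)⁻¹ * U * (symmSqrt A)⁻¹) * ((symmSqrt A)⁻¹ * V * (symmSqrt A)⁻¹)).trace := by
  rw [← symmSqrt_inv_mul_inv hA]
  simp only [Matrix.mul_assoc]
  conv_lhs => rw [trace_mul_comm]
  simp only [Matrix.mul_assoc]

theorem metric_eq {X : Pair p₁ p₂} (h₁ : X.1.PosDef) (h₂ : X.2.PosDef) (U V : Pair p₁ p₂) :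
    metric X U V = p₂ * (white₁ X U * white₁ X V).trace + p₁ * (white₂ X U * white₂ X V).trace := by
  rw [metric, trace_inv_mul_inv_mul h₁, trace_inv_mul_inv_mul h₂]

theorem metric_comm {X : Pair p₁ p₂} (h₁ : X.1.PosDef) (h₂ : X.2.PosDef) (U V : Pair p₁ p₂) :
    metric X U V = metric X V U := by
  rw [metric_eq h₁ h₂, metric_eq h₁ h₂, trace_mul_comm, trace_mul_comm (white₂ X U)]

/-- The trace correction in `R_C` is a multiple of `Σ₁`, which is orthogonal to tangent vectors. -/
theorem metric_opR (hp₁ : 0 < p₁) (hp₂ : 0 < p₂) {X : Pair p₁ p₂} (h₁ : X.1.PosDef)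
    (h₂ : X.2.PosDef) (C : Matrix (Idx p₁ p₂) (Idx p₁ p₂) ℝ) (U : Pair p₁ p₂) {V : Pair p₁ p₂}
    (hV : V ∈ tangent X) : metric X (opR X C U) V
      = p₂ * (white₁ X U * white₁ X V).trace + p₁ * (white₂ X U * white₂ X V).trace
        + (contract₁ C (white₂ X U) * white₁ X V).trace
        + (contract₂ C (white₁ X U) * white₂ X V).trace := by
  have q₁ : (p₁ : ℝ) ≠ 0 := by exact_mod_cast hp₁.ne'
  have q₂ : (p₂ : ℝ) ≠ 0 := by exact_mod_cast hp₂.ne'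
  rw [metric_eq h₁ h₂, white₁_opR h₁, white₂_opR h₂, Matrix.sub_mul, Matrix.add_mul,
    Matrix.add_mul, smul_mul, smul_mul, smul_mul, Matrix.one_mul, trace_sub, trace_add, trace_add,
    trace_smul, trace_smul, trace_smul, trace_white₁ h₁ hV]
  simp only [smul_eq_mul]
  field_simp
  ring

/-- The mixed terms are `tr (C (u₂ ⊗ v₁))` and `tr (C (v₂ ⊗ u₁))`, which are exchanged when `U` and
`V` are swapped. -/
theorem opR_selfAdjoint (hp₁ : 0 < p₁) (hp₂ : 0 < p₂) {X : Pair p₁ p₂} (h₁ : X.1.PosDef)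
    (h₂ : X.2.PosDef) (C : Matrix (Idx p₁ p₂) (Idx p₁ p₂) ℝ) {U V : Pair p₁ p₂}
    (hU : U ∈ tangent X) (hV : V ∈ tangent X) :
    metric X (opR X C U) V = metric X U (opR X C V) := by
  rw [metric_comm h₁ h₂ U, metric_opR hp₁ hp₂ h₁ h₂ C U hV, metric_opR hp₁ hp₂ h₁ h₂ C V hU,
    ← trace_mul_kronecker₁, ← trace_mul_kronecker₁, ← trace_mul_kronecker₂,
    ← trace_mul_kronecker₂, trace_mul_comm (white₁ X U), trace_mul_comm (white₂ X U)]
  ring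

theorem metric_opR_self (hp₁ : 0 < p₁) (hp₂ : 0 < p₂) {X : Pair p₁ p₂} (h₁ : X.1.PosDef)
    (h₂ : X.2.PosDef) {C : Matrix (Idx p₁ p₂) (Idx p₁ p₂) ℝ} (hC : IsCoreMatrix C)
    {U : Pair p₁ p₂} (hU : U ∈ tangent X) : metric X (opR X C U) U
      = ((white₂ X U ⊗ₖ 1 + 1 ⊗ₖ white₁ X U)ᵀ * C * (white₂ X U ⊗ₖ 1 + 1 ⊗ₖ white₁ X U)).trace := by
  have t₁ : (white₁ X U)ᵀ = white₁ X U := transpose_symmSqrt_inv_conj h₁ hU.1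
  have t₂ : (white₂ X U)ᵀ = white₂ X U := transpose_symmSqrt_inv_conj h₂ hU.2.2
  rw [hC.trace_energy, metric_opR hp₁ hp₂ h₁ h₂ C U hU, t₁, t₂]
  ring

/-- For a core matrix `contract₁ C u₂` has trace `p₁ tr u₂`, which is exactly what the trace
correction cancels. -/
theorem opR_mem_tangent {X : Pair p₁ p₂} (h₁ : X.1.PosDef)
    (h₂ : X.2.PosDef) {C : Matrix (Idx p₁ p₂) (Idx p₁ p₂) ℝ} (hC : IsCoreMatrix C)
    {U : Pair p₁ p₂} (hU : U ∈ tangent X) : opR X C U ∈ tangent X := by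
  have t₁ : (white₁ X U)ᵀ = white₁ X U := transpose_symmSqrt_inv_conj h₁ hU.1
  have t₂ : (white₂ X U)ᵀ = white₂ X U := transpose_symmSqrt_inv_conj h₂ hU.2.2
  have hCt := hC.posDef.transpose_eq
  have hU₁ : U.1ᵀ = U.1 := hU.1
  have hU₂ : U.2ᵀ = U.2 := hU.2.2
  refine ⟨?_, ?_, ?_⟩
  · change (opR X C U).1ᵀ = (opR X C U).1
    simp only [opR, transpose_add, transpose_sub, transpose_smul]
    rw [transpose_symmSqrt_conj h₁ (by
      rw [opM₁_eq, contract₁_transpose hCt]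
      exact congrArg (contract₁ C) t₂), hU₁, h₁.transpose_eq]
  · rw [trace_inv_mul h₁]
    change (white₁ X (opR X C U)).trace = 0
    rw [white₁_opR h₁, trace_sub, trace_add, trace_smul, trace_smul, hC.trace_contract₁,
      trace_white₁ h₁ hU, trace_one, Fintype.card_fin, smul_eq_mul, smul_eq_mul]
    ring
  · change (opR X C U).2ᵀ = (opR X C U).2
    simp only [opR, transpose_add, transpose_smul]
    rw [transpose_symmSqrt_conj h₂ (by
      rw [opM₂_eq, contract₂_transpose hCt]
      exact congrArg (contract₂ C) t₁), hU₂]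

/-- The tangent space of the normalized factors as a subspace. -/
def tangentSpace (X : Pair p₁ p₂) : Submodule ℝ (Pair p₁ p₂) where
  carrier := tangent X
  add_mem' := by
    rintro U V ⟨a, b, c⟩ ⟨a', b', c'⟩
    refine ⟨a.add a', ?_, c.add c'⟩
    rw [Prod.fst_add, Matrix.mul_add, trace_add, b, b', add_zero]
  zero_mem' := ⟨isSymm_zero, by simp, isSymm_zero⟩
  smul_mem' := by
    rintro s U ⟨a, b, c⟩
    refine ⟨a.smul s, ?_, c.smul s⟩
    rw [Prod.smul_fst, Matrix.mul_smul, trace_smul, b, smul_zero]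

/-- The operator `R_C` as a linear map. -/
noncomputable def opRLinear (X : Pair p₁ p₂) (C : Matrix (Idx p₁ p₂) (Idx p₁ p₂) ℝ) :
    Pair p₁ p₂ →ₗ[ℝ] Pair p₁ p₂ where
  toFun := opR X C
  map_add' U V := by
    refine Prod.ext ?_ ?_ <;>
    simp only [opR, opM₁_eq, opM₂_eq, Prod.fst_add, Prod.snd_add, Matrix.mul_add, Matrix.add_mul,
      map_add, trace_add, smul_add, add_div, add_smul] <;> abel
  map_smul' s U := by
    refine Prod.ext ?_ ?_ <;>
    simp only [opR, opM₁_eq, opM₂_eq, Prod.smul_fst, Prod.smul_snd, Matrix.mul_smul, smul_mul,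
      map_smul, trace_smul, smul_eq_mul, RingHom.id_apply, smul_add, smul_sub, smul_smul,
      mul_comm, mul_div_assoc]

/-- An endomorphism of a finite-dimensional space with zero kernel; the kernel equations are the
linearized ones with `s = -tr u₂ / p₂`. -/
theorem opR_bijOn (hp₁ : 0 < p₁) (hp₂ : 0 < p₂) {X : Pair p₁ p₂} (h₁ : X.1.PosDef)
    (h₂ : X.2.PosDef) {C : Matrix (Idx p₁ p₂) (Idx p₁ p₂) ℝ} (hC : IsCoreMatrix C) :
    Set.BijOn (opR X C) (tangent X) (tangent X) := by
  have hmaps : ∀ U ∈ tangentSpace X, opRLinear X C U ∈ tangentSpace X :=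
    fun U hU => opR_mem_tangent h₁ h₂ hC hU
  have hker : ∀ U ∈ tangent X, opR X C U = 0 → U = 0 := by
    intro U hU h
    have e₁ := white₁_opR h₁ C U
    have e₂ := white₂_opR h₂ C U
    rw [h] at e₁ e₂
    simp only [white₁, white₂, Prod.fst_zero, Prod.snd_zero, Matrix.mul_zero, Matrix.zero_mul,
      sub_eq_add_neg, ← neg_smul] at e₁ e₂
    obtain ⟨z₁, z₂⟩ := hC.linearized_eq_zero hp₁ hp₂ (trace_white₁ h₁ hU) e₁.symm e₂.symm
    exact Prod.ext (eq_zero_of_symmSqrt_inv_conj h₁ z₁) (eq_zero_of_symmSqrt_inv_conj h₂ z₂)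
  have hinj : Function.Injective ((opRLinear X C).restrict hmaps) := by
    rw [← LinearMap.ker_eq_bot, LinearMap.ker_eq_bot']
    rintro ⟨U, hU⟩ h
    exact Subtype.ext (hker U hU (congrArg Subtype.val h))
  have hsurj := LinearMap.injective_iff_surjective.1 hinj
  refine ⟨fun U hU => hmaps U hU, fun U hU V hV h => ?_, fun V hV => ?_⟩
  · have := hinj (a₁ := ⟨U, hU⟩) (a₂ := ⟨V, hV⟩) (Subtype.ext h)
    exact congrArg Subtype.val this
  · obtain ⟨U, hU⟩ := hsurj ⟨V, hV⟩
    exact ⟨U, U.2, congrArg Subtype.val hU⟩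

/-! ### The separable case -/

theorem contract₁_identity (B : Matrix (Fin p₂) (Fin p₂) ℝ) :
    contract₁ (1 : Matrix (Idx p₁ p₂) (Idx p₁ p₂) ℝ) B = B.trace • 1 := by
  refine ext_iff_trace_mul_right.2 fun A => ?_
  rw [← trace_mul_kronecker₁, Matrix.one_mul, trace_kronecker, smul_mul, Matrix.one_mul,
    trace_smul, smul_eq_mul]

theorem contract₂_identity (A : Matrix (Fin p₁) (Fin p₁) ℝ) :
    contract₂ (1 : Matrix (Idx p₁ p₂) (Idx p₁ p₂) ℝ) A = A.trace • 1 := by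
  refine ext_iff_trace_mul_right.2 fun B => ?_
  rw [← trace_mul_kronecker₂, Matrix.one_mul, trace_kronecker, smul_mul, Matrix.one_mul,
    trace_smul, smul_eq_mul, mul_comm]

/-- Contracting the identity gives traces: `tr u₂` cancels the correction term, and `tr u₁`
vanishes. -/
theorem opR_one {X U : Pair p₁ p₂} (h₁ : X.1.PosDef) (hU : U ∈ tangent X) :
    opR X 1 U = U := by
  refine Prod.ext ?_ ?_
  · simp only [opR, opM₁_eq, contract₁_identity, Matrix.mul_smul, smul_mul, Matrix.mul_one,
      symmSqrt_mul_self h₁, smul_smul, one_div_mul_eq_div]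
    abel
  · have h := trace_white₁ h₁ hU
    simp only [white₁] at h
    simp [opR, opM₂_eq, contract₂_identity, h]

theorem kronTangent_rhs {X : Pair p₁ p₂} (h₁ : X.1.PosDef)
    (V : Matrix (Idx p₁ p₂) (Idx p₁ p₂) ℝ) : kronTangent X (rhs X V)
      = (1 / (p₁ : ℝ)) • ((symmSqrt X.2 * ptrace₂ (whiten X V) * symmSqrt X.2) ⊗ₖ X.1)
        + (1 / (p₂ : ℝ)) • (X.2 ⊗ₖ (symmSqrt X.1 * ptrace₁ (whiten X V) * symmSqrt X.1))
        - ((whiten X V).trace / ((p₁ : ℝ) * p₂)) • (X.2 ⊗ₖ X.1) := by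
  have hsub : ∀ (A B : Matrix (Fin p₁) (Fin p₁) ℝ), X.2 ⊗ₖ (A - B) = X.2 ⊗ₖ A - X.2 ⊗ₖ B := by
    intro A B
    rw [sub_eq_add_neg, kronecker_add, ← neg_one_smul ℝ B, kronecker_smul, neg_one_smul,
      ← sub_eq_add_neg]
  simp only [kronTangent, rhs, Matrix.mul_sub, Matrix.sub_mul, Matrix.mul_smul, smul_mul,
    Matrix.mul_one, symmSqrt_mul_self h₁, kronecker_smul, smul_kronecker, smul_sub, smul_smul,
    hsub]
  rw [add_sub_assoc]
  congr 3
  rw [one_div_mul_eq_div, div_div]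

end HessianOperator

/-! ### Geodesics, strict convexity and the Riemannian Hessian. -/

section Geodesics

variable {p₁ p₂ : ℕ}

theorem hasDerivAt_inv_mul_inv {n : Type} [Fintype n] [DecidableEq n] {g h : ℝ → Matrix n n ℝ}
    {v w : Matrix n n ℝ} {t : ℝ} (hg : HasDerivAt g v t) (hh : HasDerivAt h w t)
    (hu : IsUnit (g t).det) :
    HasDerivAt (fun s => (g s)⁻¹ * h s * (g s)⁻¹)
      ((g t)⁻¹ * w * (g t)⁻¹ - (g t)⁻¹ * v * (g t)⁻¹ * h t * (g t)⁻¹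
        - (g t)⁻¹ * h t * (g t)⁻¹ * v * (g t)⁻¹) t := by
  have hi := hasDerivAt_matrix_inv hg hu
  refine ((hi.mul hh).mul hi).congr_deriv ?_
  simp only [Pi.mul_apply, Matrix.mul_assoc, Matrix.add_mul, Matrix.neg_mul, Matrix.mul_neg]
  abel

theorem hasDerivAt_metric {γ η : ℝ → Pair p₁ p₂} {w : Pair p₁ p₂} {t : ℝ}
    (hγ : HasDerivAt γ (η t) t) (hη : HasDerivAt η w t) (h₁ : IsUnit (γ t).1.det)
    (h₂ : IsUnit (γ t).2.det) (Z : Pair p₁ p₂) :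
    HasDerivAt (fun s => metric (γ s) (η s) Z)
      (metric (γ t) (w.1 - (η t).1 * (γ t).1⁻¹ * (η t).1,
          w.2 - (η t).2 * (γ t).2⁻¹ * (η t).2) Z
        - (p₂ * ((γ t).1⁻¹ * (η t).1 * (γ t).1⁻¹ * (η t).1 * (γ t).1⁻¹ * Z.1).trace
          + p₁ * ((γ t).2⁻¹ * (η t).2 * (γ t).2⁻¹ * (η t).2 * (γ t).2⁻¹ * Z.2).trace)) t := by
  have a₁ : HasDerivAt (fun s => (γ s).1) (η t).1 t := hγ.fst
  have a₂ : HasDerivAt (fun s => (γ s).2) (η t).2 t := hγ.snd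
  have b₁ : HasDerivAt (fun s => (η s).1) w.1 t := hη.fst
  have b₂ : HasDerivAt (fun s => (η s).2) w.2 t := hη.snd
  have c₁ := hasDerivAt_trace ((hasDerivAt_inv_mul_inv a₁ b₁ h₁).mul_const Z.1)
  have c₂ := hasDerivAt_trace ((hasDerivAt_inv_mul_inv a₂ b₂ h₂).mul_const Z.2)
  refine ((c₁.const_mul (p₂ : ℝ)).add (c₂.const_mul (p₁ : ℝ))).congr_deriv ?_
  simp only [metric, Matrix.sub_mul, Matrix.mul_sub, trace_sub, Matrix.mul_assoc]
  ring

theorem hasDerivAt_metric_variation (X v Z : Pair p₁ p₂) (h₁ : IsUnit X.1.det)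
    (h₂ : IsUnit X.2.det) :
    HasDerivAt (fun ε : ℝ => metric (X + ε • Z) v v)
      (-2 * (p₂ * (X.1⁻¹ * v.1 * X.1⁻¹ * v.1 * X.1⁻¹ * Z.1).trace
          + p₁ * (X.2⁻¹ * v.2 * X.2⁻¹ * v.2 * X.2⁻¹ * Z.2).trace)) 0 := by
  have aux : ∀ {n : Type} [Fintype n] [DecidableEq n] (A V W : Matrix n n ℝ),
      IsUnit A.det → HasDerivAt (fun ε : ℝ => ((A + ε • W)⁻¹ * V * (A + ε • W)⁻¹ * V).trace)
        (-2 * (A⁻¹ * V * A⁻¹ * V * A⁻¹ * W).trace) 0 := by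
    intro n _ _ A V W hA
    have h := hasDerivAt_trace ((hasDerivAt_inv_mul_inv (hasDerivAt_line_self A W 0)
      (hasDerivAt_const (0 : ℝ) V) (by simpa using hA)).mul_const V)
    simp only [zero_smul, add_zero] at h
    refine h.congr_deriv ?_
    have e₁ : (A⁻¹ * W * A⁻¹ * V * A⁻¹ * V).trace = (A⁻¹ * V * A⁻¹ * V * A⁻¹ * W).trace := by
      rw [Matrix.mul_assoc (A⁻¹ * W * A⁻¹ * V), Matrix.mul_assoc (A⁻¹ * W * A⁻¹),
        Matrix.mul_assoc (A⁻¹ * W), trace_mul_comm]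
      simp only [Matrix.mul_assoc]
    have e₂ : (A⁻¹ * V * A⁻¹ * W * A⁻¹ * V).trace = (A⁻¹ * V * A⁻¹ * V * A⁻¹ * W).trace := by
      rw [Matrix.mul_assoc (A⁻¹ * V * A⁻¹ * W), trace_mul_comm]
      simp only [Matrix.mul_assoc]
    simp only [Matrix.sub_mul, trace_sub, e₁, e₂, Matrix.mul_zero, Matrix.zero_mul, trace_zero]
    ring
  refine (((aux X.1 v.1 Z.1 h₁).const_mul (p₂ : ℝ)).add
    ((aux X.2 v.2 Z.2 h₂).const_mul (p₁ : ℝ))).congr_deriv ?_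
  ring

/-- The Euler–Lagrange equation in terms of the covariant acceleration. -/
theorem eulerLagrange_iff {γ : ℝ → Pair p₁ p₂} {t : ℝ} (hγ : DifferentiableAt ℝ γ t)
    (hγ' : DifferentiableAt ℝ (deriv γ) t) (h₁ : IsUnit (γ t).1.det) (h₂ : IsUnit (γ t).2.det)
    (Z : Pair p₁ p₂) :
    deriv (fun s => metric (γ s) (deriv γ s) Z) t
        = (1 / 2) * deriv (fun ε : ℝ => metric (γ t + ε • Z) (deriv γ t) (deriv γ t)) 0 ↔
      metric (γ t)
        ((deriv (deriv γ) t).1 - (deriv γ t).1 * (γ t).1⁻¹ * (deriv γ t).1,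
          (deriv (deriv γ) t).2 - (deriv γ t).2 * (γ t).2⁻¹ * (deriv γ t).2) Z = 0 := by
  have aux : ∀ {x y m a : ℝ}, x = m - a → y = -2 * a → (x = 1 / 2 * y ↔ m = 0) := by
    rintro x y m a rfl rfl
    constructor <;> intro h <;> linarith
  exact aux (hasDerivAt_metric hγ.hasDerivAt hγ'.hasDerivAt h₁ h₂ Z).deriv
    (hasDerivAt_metric_variation (γ t) (deriv γ t) Z h₁ h₂).deriv

theorem eq_zero_of_metric_self (hp₁ : 0 < p₁) (hp₂ : 0 < p₂) {X U : Pair p₁ p₂}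
    (h₁ : X.1.PosDef) (h₂ : X.2.PosDef) (hU₁ : U.1ᵀ = U.1) (hU₂ : U.2ᵀ = U.2)
    (h : metric X U U = 0) : U = 0 := by
  have q₁ : (0 : ℝ) < p₁ := by exact_mod_cast hp₁
  have q₂ : (0 : ℝ) < p₂ := by exact_mod_cast hp₂
  rw [metric_eq h₁ h₂] at h
  have t₁ : (white₁ X U)ᵀ = white₁ X U := transpose_symmSqrt_inv_conj h₁ hU₁
  have t₂ : (white₂ X U)ᵀ = white₂ X U := transpose_symmSqrt_inv_conj h₂ hU₂
  have n₁ := trace_transpose_mul_self_nonneg (white₁ X U)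
  have n₂ := trace_transpose_mul_self_nonneg (white₂ X U)
  have z₁ : ((white₁ X U)ᵀ * white₁ X U).trace = 0 := by
    rw [t₁] at n₁ ⊢
    rw [t₂] at n₂
    nlinarith [mul_nonneg q₁.le n₂, mul_nonneg q₂.le n₁]
  have z₂ : ((white₂ X U)ᵀ * white₂ X U).trace = 0 := by
    rw [t₁] at n₁
    rw [t₂] at n₂ ⊢
    nlinarith [mul_nonneg q₁.le n₂, mul_nonneg q₂.le n₁]
  exact Prod.ext (eq_zero_of_symmSqrt_inv_conj h₁ (eq_zero_of_trace_transpose_mul_self z₁))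
    (eq_zero_of_symmSqrt_inv_conj h₂ (eq_zero_of_trace_transpose_mul_self z₂))

theorem IsGeodesic.hasDerivAt {I : Set ℝ} {γ : ℝ → Pair p₁ p₂} (h : IsGeodesic I γ) {t : ℝ}
    (ht : t ∈ I) : HasDerivAt γ (deriv γ t) t :=
  ((h.2.2.1.contDiffAt (h.1.mem_nhds ht)).differentiableAt (by simp)).hasDerivAt

theorem IsGeodesic.hasDerivAt_deriv {I : Set ℝ} {γ : ℝ → Pair p₁ p₂} (h : IsGeodesic I γ) {t : ℝ}
    (ht : t ∈ I) : HasDerivAt (deriv γ) (deriv (deriv γ) t) t := by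
  have h2 : ContDiffOn ℝ 1 (deriv γ) I := h.2.2.1.deriv_of_isOpen h.1 (by norm_cast)
  exact ((h2.contDiffAt (h.1.mem_nhds ht)).differentiableAt (by simp)).hasDerivAt

theorem IsGeodesic.deriv_mem_tangent {I : Set ℝ} {γ : ℝ → Pair p₁ p₂} (h : IsGeodesic I γ) {t : ℝ}
    (ht : t ∈ I) : deriv γ t ∈ tangent (γ t) := by
  have hd := h.hasDerivAt ht
  have hd₁ : HasDerivAt (fun s => (γ s).1) (deriv γ t).1 t := hd.fst
  have hd₂ : HasDerivAt (fun s => (γ s).2) (deriv γ t).2 t := hd.snd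
  have hX := h.2.2.2.1 ht
  refine ⟨?_, ?_, ?_⟩
  · refine (hasDerivAt_transpose hd₁).unique (hd₁.congr_of_eventuallyEq ?_)
    filter_upwards [h.1.mem_nhds ht] with s hs using (h.2.2.2.1 hs).1.transpose_eq
  · have h1 := hasDerivAt_det hd₁
    rw [adjugate_eq_det_smul_inv hX.1.isUnit_det, hX.2.1, one_smul] at h1
    refine h1.unique ((hasDerivAt_const t (1 : ℝ)).congr_of_eventuallyEq ?_)
    filter_upwards [h.1.mem_nhds ht] with s hs using (h.2.2.2.1 hs).2.1
  · refine (hasDerivAt_transpose hd₂).unique (hd₂.congr_of_eventuallyEq ?_)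
    filter_upwards [h.1.mem_nhds ht] with s hs using (h.2.2.2.1 hs).2.2.transpose_eq

theorem hasDerivAt_trace_inv_mul {n : Type} [Fintype n] [DecidableEq n] {g h : ℝ → Matrix n n ℝ}
    {v w : Matrix n n ℝ} {t : ℝ} (hg : HasDerivAt g v t) (hh : HasDerivAt h w t)
    (hu : IsUnit (g t).det) :
    HasDerivAt (fun s => ((g s)⁻¹ * h s).trace)
      (((g t)⁻¹ * w).trace - ((g t)⁻¹ * v * (g t)⁻¹ * h t).trace) t := by
  refine (hasDerivAt_trace ((hasDerivAt_matrix_inv hg hu).mul hh)).congr_deriv ?_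
  rw [trace_add, Matrix.neg_mul, trace_neg]
  ring

/-- The geodesic equation. -/
theorem IsGeodesic.deriv_deriv (hp₁ : 0 < p₁) (hp₂ : 0 < p₂) {I : Set ℝ} {γ : ℝ → Pair p₁ p₂}
    (h : IsGeodesic I γ) {t : ℝ} (ht : t ∈ I) :
    deriv (deriv γ) t = ((deriv γ t).1 * (γ t).1⁻¹ * (deriv γ t).1,
      (deriv γ t).2 * (γ t).2⁻¹ * (deriv γ t).2) := by
  have hd := h.hasDerivAt ht
  have hdd := h.hasDerivAt_deriv ht
  have hd₁ : HasDerivAt (fun s => (γ s).1) (deriv γ t).1 t := hd.fst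
  have hdd₁ : HasDerivAt (fun s => (deriv γ s).1) (deriv (deriv γ) t).1 t := hdd.fst
  have hdd₂ : HasDerivAt (fun s => (deriv γ s).2) (deriv (deriv γ) t).2 t := hdd.snd
  have hX := h.2.2.2.1 ht
  obtain ⟨s₁, -, s₂⟩ := h.deriv_mem_tangent ht
  have hw₁ : (deriv (deriv γ) t).1ᵀ = (deriv (deriv γ) t).1 := by
    refine (hasDerivAt_transpose hdd₁).unique (hdd₁.congr_of_eventuallyEq ?_)
    filter_upwards [h.1.mem_nhds ht] with s hs using (h.deriv_mem_tangent hs).1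
  have hw₂ : (deriv (deriv γ) t).2ᵀ = (deriv (deriv γ) t).2 := by
    refine (hasDerivAt_transpose hdd₂).unique (hdd₂.congr_of_eventuallyEq ?_)
    filter_upwards [h.1.mem_nhds ht] with s hs using (h.deriv_mem_tangent hs).2.2
  have htr : ((γ t).1⁻¹ * (deriv (deriv γ) t).1).trace
      - ((γ t).1⁻¹ * (deriv γ t).1 * (γ t).1⁻¹ * (deriv γ t).1).trace = 0 := by
    refine (hasDerivAt_trace_inv_mul hd₁ hdd₁ hX.1.isUnit_det).unique
      ((hasDerivAt_const t (0 : ℝ)).congr_of_eventuallyEq ?_)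
    filter_upwards [h.1.mem_nhds ht] with s hs using (h.deriv_mem_tangent hs).2.1
  set G : Pair p₁ p₂ :=
    ((deriv (deriv γ) t).1 - (deriv γ t).1 * (γ t).1⁻¹ * (deriv γ t).1,
      (deriv (deriv γ) t).2 - (deriv γ t).2 * (γ t).2⁻¹ * (deriv γ t).2) with hG
  have e₁ : (deriv γ t).1ᵀ = (deriv γ t).1 := s₁
  have e₂ : (deriv γ t).2ᵀ = (deriv γ t).2 := s₂
  have hG₁ : G.1ᵀ = G.1 := by
    simp only [hG, transpose_sub, transpose_mul, hw₁, e₁, hX.1.inv.transpose_eq, Matrix.mul_assoc]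
  have hG₂ : G.2ᵀ = G.2 := by
    simp only [hG, transpose_sub, transpose_mul, hw₂, e₂, hX.2.2.inv.transpose_eq,
      Matrix.mul_assoc]
  -- Differentiating `tr (γ₁⁻¹ γ₁') = 0` shows that the covariant acceleration is tangent. It may
  -- therefore be taken as the direction in the Euler–Lagrange equation, which makes its norm
  -- vanish.
  have hGt : G ∈ tangent (γ t) := by
    refine ⟨hG₁, ?_, hG₂⟩
    rw [hG, Matrix.mul_sub, trace_sub, ← htr]
    simp only [Matrix.mul_assoc]
  have hEL := (eulerLagrange_iff hd.differentiableAt hdd.differentiableAt hX.1.isUnit_det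
    hX.2.2.isUnit_det G).1 (h.2.2.2.2 t ht G hGt)
  have hG0 := eq_zero_of_metric_self hp₁ hp₂ hX.1 hX.2.2 hG₁ hG₂ hEL
  exact Prod.ext (sub_eq_zero.1 (congrArg Prod.fst hG0)) (sub_eq_zero.1 (congrArg Prod.snd hG0))

theorem hasDerivAt_klObjective (S : Sym (Idx p₁ p₂)) {γ : ℝ → Pair p₁ p₂} {v : Pair p₁ p₂} {t : ℝ}
    (hγ : HasDerivAt γ v t) (h₁ : IsUnit (γ t).1.det) (h₂ : IsUnit (γ t).2.det) :
    HasDerivAt (fun s => klObjective S (γ s))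
      (-((S : Matrix (Idx p₁ p₂) (Idx p₁ p₂) ℝ)
          * ((γ t).2⁻¹ ⊗ₖ ((γ t).1⁻¹ * v.1 * (γ t).1⁻¹)
            + ((γ t).2⁻¹ * v.2 * (γ t).2⁻¹) ⊗ₖ (γ t).1⁻¹)).trace
        + p₁ * ((γ t).2⁻¹ * v.2).trace + p₂ * ((γ t).1⁻¹ * v.1).trace) t := by
  have a₁ : HasDerivAt (fun s => (γ s).1) v.1 t := hγ.fst
  have a₂ : HasDerivAt (fun s => (γ s).2) v.2 t := hγ.snd
  have h := ((hasDerivAt_trace ((hasDerivAt_kronecker (hasDerivAt_matrix_inv a₂ h₂)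
    (hasDerivAt_matrix_inv a₁ h₁)).const_mul (S : Matrix (Idx p₁ p₂) (Idx p₁ p₂) ℝ))).add
    ((hasDerivAt_log_det a₂ h₂).const_mul (p₁ : ℝ))).add
    ((hasDerivAt_log_det a₁ h₁).const_mul (p₂ : ℝ))
  have e : (fun s => klObjective S (γ s)) = fun s =>
      ((S : Matrix (Idx p₁ p₂) (Idx p₁ p₂) ℝ) * ((γ s).2⁻¹ ⊗ₖ (γ s).1⁻¹)).trace
        + p₁ * Real.log (γ s).2.det + p₂ * Real.log (γ s).1.det := by
    ext s
    rw [klObjective, inv_kronecker]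
  rw [e]
  refine HasDerivAt.congr_deriv h ?_
  have n₁ : ∀ (A : Matrix (Fin p₂) (Fin p₂) ℝ) (B : Matrix (Fin p₁) (Fin p₁) ℝ),
      A ⊗ₖ (-B) = -(A ⊗ₖ B) := fun A B => by
    rw [← neg_one_smul ℝ B, kronecker_smul, neg_one_smul]
  have n₂ : ∀ (A : Matrix (Fin p₂) (Fin p₂) ℝ) (B : Matrix (Fin p₁) (Fin p₁) ℝ),
      (-A) ⊗ₖ B = -(A ⊗ₖ B) := fun A B => by
    rw [← neg_one_smul ℝ A, smul_kronecker, neg_one_smul]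
  simp only [n₁, n₂, Matrix.mul_add, Matrix.mul_neg, trace_add, trace_neg]
  ring

/-- The second derivative of the objective along a geodesic. -/
theorem IsGeodesic.hasDerivAt_deriv_klObjective (hp₁ : 0 < p₁) (hp₂ : 0 < p₂)
    (S : Sym (Idx p₁ p₂)) {I : Set ℝ} {γ : ℝ → Pair p₁ p₂} (h : IsGeodesic I γ) {t : ℝ}
    (ht : t ∈ I) :
    HasDerivAt (deriv fun s => klObjective S (γ s))
      ((white₂ (γ t) (deriv γ t) ⊗ₖ 1 + 1 ⊗ₖ white₁ (γ t) (deriv γ t))ᵀ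
        * whiten (γ t) S
        * (white₂ (γ t) (deriv γ t) ⊗ₖ 1 + 1 ⊗ₖ white₁ (γ t) (deriv γ t))).trace t := by
  have hd := h.hasDerivAt ht
  have hdd := h.hasDerivAt_deriv ht
  rw [h.deriv_deriv hp₁ hp₂ ht] at hdd
  have hX := h.2.2.2.1 ht
  have u₁ := hX.1.isUnit_det
  have u₂ := hX.2.2.isUnit_det
  set v := deriv γ t with hv
  have hvt : v ∈ tangent (γ t) := h.deriv_mem_tangent ht
  set A₁ := (γ t).1⁻¹ with hA₁
  set A₂ := (γ t).2⁻¹ with hA₂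
  have a₁ : HasDerivAt (fun s => (γ s).1) v.1 t := hd.fst
  have a₂ : HasDerivAt (fun s => (γ s).2) v.2 t := hd.snd
  have b₁ : HasDerivAt (fun s => (deriv γ s).1) (v.1 * A₁ * v.1) t := hdd.fst
  have b₂ : HasDerivAt (fun s => (deriv γ s).2) (v.2 * A₂ * v.2) t := hdd.snd
  have i₁ := hasDerivAt_matrix_inv a₁ u₁
  have i₂ := hasDerivAt_matrix_inv a₂ u₂
  have B₁ := hasDerivAt_inv_mul_inv a₁ b₁ u₁
  have B₂ := hasDerivAt_inv_mul_inv a₂ b₂ u₂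
  have t₁ := hasDerivAt_trace_inv_mul a₁ b₁ u₁
  have t₂ := hasDerivAt_trace_inv_mul a₂ b₂ u₂
  have hD := ((hasDerivAt_trace (((hasDerivAt_kronecker i₂ B₁).add
    (hasDerivAt_kronecker B₂ i₁)).const_mul (S : Matrix (Idx p₁ p₂) (Idx p₁ p₂) ℝ))).neg.add
    (t₂.const_mul (p₁ : ℝ))).add (t₁.const_mul (p₂ : ℝ))
  have hD' : HasDerivAt (deriv fun s => klObjective S (γ s)) _ t :=
    hD.congr_of_eventuallyEq (by
      filter_upwards [h.1.mem_nhds ht] with s hs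
      have hXs := h.2.2.2.1 hs
      exact (hasDerivAt_klObjective S (h.hasDerivAt hs) hXs.1.isUnit_det
        hXs.2.2.isUnit_det).deriv)
  refine hD'.congr_deriv ?_
  rw [← hv, ← hA₁, ← hA₂]
  have n₁ : ∀ (A : Matrix (Fin p₂) (Fin p₂) ℝ) (B : Matrix (Fin p₁) (Fin p₁) ℝ),
      A ⊗ₖ (-B) = -(A ⊗ₖ B) := fun A B => by
    rw [← neg_one_smul ℝ B, kronecker_smul, neg_one_smul]
  have n₂ : ∀ (A : Matrix (Fin p₂) (Fin p₂) ℝ) (B : Matrix (Fin p₁) (Fin p₁) ℝ),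
      (-A) ⊗ₖ B = -(A ⊗ₖ B) := fun A B => by
    rw [← neg_one_smul ℝ A, smul_kronecker, neg_one_smul]
  set r₁ := (symmSqrt (γ t).1)⁻¹ with hr₁
  set r₂ := (symmSqrt (γ t).2)⁻¹ with hr₂
  have hrr₁ : A₁ = r₁ * r₁ := (symmSqrt_inv_mul_inv hX.1).symm
  have hrr₂ : A₂ = r₂ * r₂ := (symmSqrt_inv_mul_inv hX.2.2).symm
  set w₁ := white₁ (γ t) v with hw₁
  set w₂ := white₂ (γ t) v with hw₂
  have hw₁' : w₁ = r₁ * v.1 * r₁ := rfl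
  have hw₂' : w₂ = r₂ * v.2 * r₂ := rfl
  have c₁ : A₁ * v.1 * A₁ = r₁ * w₁ * r₁ := by
    rw [hw₁', hrr₁]; simp only [Matrix.mul_assoc]
  have c₂ : A₂ * v.2 * A₂ = r₂ * w₂ * r₂ := by
    rw [hw₂', hrr₂]; simp only [Matrix.mul_assoc]
  -- By the geodesic equation one of the two quadratic terms cancels against the acceleration,
  -- leaving `r w² r`. The same equation makes the log-determinants affine, so `f₁` and `f₂` are
  -- zero.
  have d₁ : A₁ * (v.1 * A₁ * v.1) * A₁ - A₁ * v.1 * A₁ * v.1 * A₁ - A₁ * v.1 * A₁ * v.1 * A₁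
      = -(r₁ * (w₁ * w₁) * r₁) := by
    have : A₁ * v.1 * A₁ * v.1 * A₁ = r₁ * (w₁ * w₁) * r₁ := by
      rw [hw₁', hrr₁]; simp only [Matrix.mul_assoc]
    rw [← this]; simp only [Matrix.mul_assoc]; abel
  have d₂ : A₂ * (v.2 * A₂ * v.2) * A₂ - A₂ * v.2 * A₂ * v.2 * A₂ - A₂ * v.2 * A₂ * v.2 * A₂
      = -(r₂ * (w₂ * w₂) * r₂) := by
    have : A₂ * v.2 * A₂ * v.2 * A₂ = r₂ * (w₂ * w₂) * r₂ := by
      rw [hw₂', hrr₂]; simp only [Matrix.mul_assoc]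
    rw [← this]; simp only [Matrix.mul_assoc]; abel
  have f₁ : (A₁ * (v.1 * A₁ * v.1)).trace - (A₁ * v.1 * A₁ * v.1).trace = 0 := by
    simp only [Matrix.mul_assoc, sub_self]
  have f₂ : (A₂ * (v.2 * A₂ * v.2)).trace - (A₂ * v.2 * A₂ * v.2).trace = 0 := by
    simp only [Matrix.mul_assoc, sub_self]
  have s₁ : w₁ᵀ = w₁ := transpose_symmSqrt_inv_conj hX.1 hvt.1
  have s₂ : w₂ᵀ = w₂ := transpose_symmSqrt_inv_conj hX.2.2 hvt.2.2
  have hWt : (w₂ ⊗ₖ (1 : Matrix (Fin p₁) (Fin p₁) ℝ) + 1 ⊗ₖ w₁)ᵀ = w₂ ⊗ₖ 1 + 1 ⊗ₖ w₁ := by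
    rw [transpose_add, ← kroneckerMap_transpose, ← kroneckerMap_transpose, s₁, s₂, transpose_one,
      transpose_one]
  have hWW : (w₂ ⊗ₖ (1 : Matrix (Fin p₁) (Fin p₁) ℝ) + 1 ⊗ₖ w₁) * (w₂ ⊗ₖ 1 + 1 ⊗ₖ w₁)
      = (w₂ * w₂) ⊗ₖ 1 + w₂ ⊗ₖ w₁ + (w₂ ⊗ₖ w₁ + 1 ⊗ₖ (w₁ * w₁)) := by
    rw [Matrix.add_mul, Matrix.mul_add, Matrix.mul_add]
    simp only [← mul_kronecker_mul, Matrix.mul_one, Matrix.one_mul]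
  have hR : (((w₂ ⊗ₖ (1 : Matrix (Fin p₁) (Fin p₁) ℝ) + 1 ⊗ₖ w₁)ᵀ
        * whiten (γ t) S * (w₂ ⊗ₖ 1 + 1 ⊗ₖ w₁)).trace)
      = ((S : Matrix (Idx p₁ p₂) (Idx p₁ p₂) ℝ) * ((r₂ ⊗ₖ r₁)
        * ((w₂ * w₂) ⊗ₖ 1 + w₂ ⊗ₖ w₁ + (w₂ ⊗ₖ w₁ + 1 ⊗ₖ (w₁ * w₁))) * (r₂ ⊗ₖ r₁))).trace := by
    rw [Matrix.mul_assoc, trace_mul_comm, hWt, Matrix.mul_assoc, hWW, whiten_eq, ← hr₁, ← hr₂]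
    simp only [Matrix.mul_assoc]
    rw [trace_mul_comm (r₂ ⊗ₖ r₁)]
    simp only [Matrix.mul_assoc]
  rw [hR, d₁, d₂, f₁, f₂, c₁, c₂]
  simp only [n₁, n₂, Matrix.mul_add, Matrix.add_mul, ← mul_kronecker_mul, Matrix.mul_one, ← hrr₁,
    ← hrr₂, Matrix.mul_neg, trace_add, trace_neg, mul_zero, add_zero]
  ring

theorem IsGeodesic.iteratedDeriv_klObjective (hp₁ : 0 < p₁) (hp₂ : 0 < p₂)
    (S : Sym (Idx p₁ p₂)) {I : Set ℝ} {γ : ℝ → Pair p₁ p₂} (h : IsGeodesic I γ) {t : ℝ}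
    (ht : t ∈ I) :
    iteratedDeriv 2 (klObjective S ∘ γ) t
      = ((white₂ (γ t) (deriv γ t) ⊗ₖ 1 + 1 ⊗ₖ white₁ (γ t) (deriv γ t))ᵀ
        * whiten (γ t) S
        * (white₂ (γ t) (deriv γ t) ⊗ₖ 1 + 1 ⊗ₖ white₁ (γ t) (deriv γ t))).trace := by
  rw [iteratedDeriv_succ, iteratedDeriv_one]
  exact (h.hasDerivAt_deriv_klObjective hp₁ hp₂ S ht).deriv

/-- The whitened matrix is positive definite at every point of a geodesic, core or not, so the
second derivative is positive unless the Kronecker sum of the velocity, hence the velocity itself,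
is zero. -/
theorem strictGeodesicallyConvex_klObjective (hp₁ : 0 < p₁) (hp₂ : 0 < p₂)
    {S : Sym (Idx p₁ p₂)} (hS : S ∈ SPD (Idx p₁ p₂)) : StrictGeodesicallyConvex (klObjective S) := by
  intro I γ h hne
  refine strictConvexOn_of_deriv2_pos' h.2.1.convex (fun t ht => ?_) fun t ht => ?_
  · have hX := h.2.2.2.1 ht
    exact (hasDerivAt_klObjective S (h.hasDerivAt ht) hX.1.isUnit_det
      hX.2.2.isUnit_det).continuousAt.continuousWithinAt
  · have hX := h.2.2.2.1 ht
    rw [← iteratedDeriv_eq_iterate, h.iteratedDeriv_klObjective hp₁ hp₂ S ht]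
    have hC := whiten_posDef hX.1 hX.2.2 hS
    refine lt_of_le_of_ne (trace_conj_nonneg hC _) fun h0 => hne t ht ?_
    obtain ⟨z₁, z₂⟩ := kronecker_sum_eq_zero hp₁ hp₂
      (trace_white₁ hX.1 (h.deriv_mem_tangent ht)) (eq_zero_of_trace_conj hC h0.symm)
    exact Prod.ext (eq_zero_of_symmSqrt_inv_conj hX.1 z₁)
      (eq_zero_of_symmSqrt_inv_conj hX.2.2 z₂)

theorem isRiemannianHessian_opR (hp₁ : 0 < p₁) (hp₂ : 0 < p₂) {S : Sym (Idx p₁ p₂)}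
    (hS : S ∈ SPD (Idx p₁ p₂)) {X : Pair p₁ p₂} (hX : X ∈ Factors p₁ p₂)
    (hK : (kronMap S : Matrix (Idx p₁ p₂) (Idx p₁ p₂) ℝ) = X.2 ⊗ₖ X.1) :
    IsRiemannianHessian (klObjective S) X (opR X (whiten X S)) := by
  have hC := isCoreMatrix_of_kronMap_eq hp₁ hp₂ hS hX.1 hX.2.2 hK
  refine ⟨fun U hU => opR_mem_tangent hX.1 hX.2.2 hC hU, fun U hU V hV =>
    opR_selfAdjoint hp₁ hp₂ hX.1 hX.2.2 _ hU hV, fun I γ h h0 hγ => ?_⟩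
  have hv := h.deriv_mem_tangent h0
  rw [hγ] at hv
  rw [h.iteratedDeriv_klObjective hp₁ hp₂ S h0, hγ,
    metric_opR_self hp₁ hp₂ hX.1 hX.2.2 hC hv]

end Geodesics

/-! ### Matrix exponentials and explicit geodesics. -/

section Exponential

variable {n : Type} [Fintype n] [DecidableEq n]

theorem hasDerivAt_conj_exp (r u w : Matrix n n ℝ) (t : ℝ) :
    HasDerivAt (fun s : ℝ => r * (NormedSpace.exp (s • u) * w) * r)
      (r * (NormedSpace.exp (t • u) * (u * w)) * r) t := by
  have h := (((hasDerivAt_exp_smul_const (𝕂 := ℝ) u t).mul_const w).const_mul r).mul_const r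
  exact h.congr_deriv (congrArg (fun z => r * z * r) (Matrix.mul_assoc _ _ _))

/-- `exp u = e eᵀ` with `e = exp (u / 2)` symmetric and invertible. -/
theorem posDef_exp {u : Matrix n n ℝ} (hu : uᵀ = u) : (NormedSpace.exp u).PosDef := by
  have h2 : u = (1 / 2 : ℝ) • u + (1 / 2 : ℝ) • u := by rw [← add_smul]; norm_num
  have ht : (NormedSpace.exp ((1 / 2 : ℝ) • u))ᵀ = NormedSpace.exp ((1 / 2 : ℝ) • u) := by
    rw [← Matrix.exp_transpose, transpose_smul, hu]
  have h := (PosDef.one (n := n) (R := ℝ)).congr (B := NormedSpace.exp ((1 / 2 : ℝ) • u))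
    ((Matrix.isUnit_iff_isUnit_det _).1 (Matrix.isUnit_exp _))
  rw [Matrix.mul_one, ht, ← Matrix.exp_add_of_commute _ _ (Commute.refl _), ← h2] at h
  exact h

/-- By Jacobi's formula the derivative is the determinant times `tr u = 0`, so the determinant keeps
its value at `t = 0`. -/
theorem det_exp_smul_eq_one {u : Matrix n n ℝ} (hu : u.trace = 0) (t : ℝ) :
    (NormedSpace.exp (t • u)).det = 1 := by
  have hd : ∀ s : ℝ, HasDerivAt (fun s : ℝ => (NormedSpace.exp (s • u)).det) 0 s := fun s => by
    have h := hasDerivAt_det (hasDerivAt_exp_smul_const (𝕂 := ℝ) u s)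
    exact h.congr_deriv (by
      rw [← Matrix.mul_assoc, adjugate_mul, Matrix.smul_mul, Matrix.one_mul, trace_smul, hu,
        smul_zero])
  have h := is_const_of_deriv_eq_zero (fun s => (hd s).differentiableAt) (fun s => (hd s).deriv) t 0
  exact h.trans (by simp)

theorem contDiff_conj_exp (r u : Matrix n n ℝ) :
    ContDiff ℝ ∞ (fun s : ℝ => r * NormedSpace.exp (s • u) * r) := by
  have h : ContDiff ℝ ∞ (fun s : ℝ => NormedSpace.exp (s • u)) := by
    refine contDiff_iff_contDiffAt.2 fun s => ?_
    exact (NormedSpace.exp_analytic (𝕂 := ℝ) (s • u)).contDiffAt.comp s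
      (contDiff_id.smul contDiff_const).contDiffAt
  exact (contDiff_const.mul h).mul contDiff_const

/-- The velocity `v` and the acceleration `w` of `r exp(t u) r` satisfy `w = v A⁻¹ v`. -/
theorem conj_exp_acceleration {r e : Matrix n n ℝ} (u : Matrix n n ℝ) (hr : IsUnit r.det)
    (he : IsUnit e.det) :
    r * (e * (u * u)) * r - r * (e * u) * r * (r * e * r)⁻¹ * (r * (e * u) * r) = 0 := by
  rw [Matrix.mul_inv_rev, Matrix.mul_inv_rev]
  have : r * (e * u) * r * (r⁻¹ * (e⁻¹ * r⁻¹)) * (r * (e * u) * r)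
      = r * (e * u) * (r * r⁻¹) * e⁻¹ * (r⁻¹ * r) * (e * u) * r := by
    simp only [Matrix.mul_assoc]
  rw [this, mul_nonsing_inv _ hr, nonsing_inv_mul _ hr, Matrix.mul_one, Matrix.mul_one,
    Matrix.mul_assoc _ e⁻¹, ← Matrix.mul_assoc e⁻¹, nonsing_inv_mul _ he, Matrix.one_mul]
  simp only [Matrix.mul_assoc, sub_self]

end Exponential

section ExpCurve

variable {p₁ p₂ : ℕ}

theorem expCurve_eq (X W : Pair p₁ p₂) (t : ℝ) :
    expCurve X W t
      = (symmSqrt X.1 * NormedSpace.exp (t • white₁ X W) * symmSqrt X.1,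
        symmSqrt X.2 * NormedSpace.exp (t • white₂ X W) * symmSqrt X.2) := rfl

theorem hasDerivAt_expCurve (X W : Pair p₁ p₂) (t : ℝ) :
    HasDerivAt (expCurve X W)
      (symmSqrt X.1 * (NormedSpace.exp (t • white₁ X W) * white₁ X W) * symmSqrt X.1,
        symmSqrt X.2 * (NormedSpace.exp (t • white₂ X W) * white₂ X W) * symmSqrt X.2) t := by
  have h₁ := hasDerivAt_conj_exp (symmSqrt X.1) (white₁ X W) 1 t
  have h₂ := hasDerivAt_conj_exp (symmSqrt X.2) (white₂ X W) 1 t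
  simp only [Matrix.mul_one] at h₁ h₂
  exact h₁.prodMk h₂

theorem deriv_expCurve (X W : Pair p₁ p₂) :
    deriv (expCurve X W) = fun t =>
      (symmSqrt X.1 * (NormedSpace.exp (t • white₁ X W) * white₁ X W) * symmSqrt X.1,
        symmSqrt X.2 * (NormedSpace.exp (t • white₂ X W) * white₂ X W) * symmSqrt X.2) :=
  funext fun t => (hasDerivAt_expCurve X W t).deriv

theorem hasDerivAt_deriv_expCurve (X W : Pair p₁ p₂) (t : ℝ) :
    HasDerivAt (deriv (expCurve X W))
      (symmSqrt X.1 * (NormedSpace.exp (t • white₁ X W) * (white₁ X W * white₁ X W)) * symmSqrt X.1,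
        symmSqrt X.2 * (NormedSpace.exp (t • white₂ X W) * (white₂ X W * white₂ X W))
          * symmSqrt X.2) t := by
  have h := (hasDerivAt_conj_exp (symmSqrt X.1) (white₁ X W) (white₁ X W) t).prodMk
    (hasDerivAt_conj_exp (symmSqrt X.2) (white₂ X W) (white₂ X W) t)
  exact h.congr_of_eventuallyEq (Filter.Eventually.of_forall fun s =>
    congrFun (deriv_expCurve X W) s)

theorem expCurve_zero {X : Pair p₁ p₂} (h₁ : X.1.PosDef) (h₂ : X.2.PosDef) (W : Pair p₁ p₂) :
    expCurve X W 0 = X := by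
  rw [expCurve_eq, zero_smul, zero_smul, NormedSpace.exp_zero, NormedSpace.exp_zero,
    Matrix.mul_one, Matrix.mul_one, symmSqrt_mul_self h₁, symmSqrt_mul_self h₂]

theorem deriv_expCurve_zero {X : Pair p₁ p₂} (h₁ : X.1.PosDef) (h₂ : X.2.PosDef)
    (W : Pair p₁ p₂) : deriv (expCurve X W) 0 = W := by
  refine (congrFun (deriv_expCurve X W) 0).trans ?_
  simp only [zero_smul, NormedSpace.exp_zero, Matrix.one_mul]
  exact Prod.ext (symmSqrt_conj_cancel h₁ W.1) (symmSqrt_conj_cancel h₂ W.2)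

theorem conj_exp_posDef {n : Type} [Fintype n] [DecidableEq n] {r u : Matrix n n ℝ}
    (hr : r.PosDef) (hu : uᵀ = u) (t : ℝ) :
    (r * NormedSpace.exp (t • u) * r).PosDef := by
  have h := (posDef_exp (u := t • u) (by rw [transpose_smul, hu])).congr hr.isUnit_det
  rwa [hr.transpose_eq] at h

theorem expCurve_mem_Factors {X : Pair p₁ p₂} (hX : X ∈ Factors p₁ p₂) {W : Pair p₁ p₂}
    (hW : W ∈ tangent X) (t : ℝ) : expCurve X W t ∈ Factors p₁ p₂ := by
  refine ⟨conj_exp_posDef (symmSqrt_posDef hX.1) (transpose_symmSqrt_inv_conj hX.1 hW.1) t, ?_,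
    conj_exp_posDef (symmSqrt_posDef hX.2.2) (transpose_symmSqrt_inv_conj hX.2.2 hW.2.2) t⟩
  rw [expCurve_eq, det_mul, det_mul, det_exp_smul_eq_one (trace_white₁ hX.1 hW), mul_one,
    ← det_mul, symmSqrt_mul_self hX.1, hX.2.1]

/-- The covariant acceleration vanishes in each component, so the Euler–Lagrange equation holds in
every direction. -/
theorem isGeodesic_expCurve {X : Pair p₁ p₂} (hX : X ∈ Factors p₁ p₂) {W : Pair p₁ p₂}
    (hW : W ∈ tangent X) : IsGeodesic Set.univ (expCurve X W) := by
  refine ⟨isOpen_univ, Set.ordConnected_univ,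
    ((contDiff_conj_exp _ _).prodMk (contDiff_conj_exp _ _)).contDiffOn,
    fun t _ => expCurve_mem_Factors hX hW t, fun t _ Z _ => ?_⟩
  have hmem := expCurve_mem_Factors hX hW t
  refine (eulerLagrange_iff (hasDerivAt_expCurve X W t).differentiableAt
    (hasDerivAt_deriv_expCurve X W t).differentiableAt hmem.1.isUnit_det hmem.2.2.isUnit_det Z).2 ?_
  have aux : ∀ {v w : Pair p₁ p₂},
      w = (symmSqrt X.1 * (NormedSpace.exp (t • white₁ X W) * (white₁ X W * white₁ X W))
          * symmSqrt X.1,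
        symmSqrt X.2 * (NormedSpace.exp (t • white₂ X W) * (white₂ X W * white₂ X W))
          * symmSqrt X.2) →
      v = (symmSqrt X.1 * (NormedSpace.exp (t • white₁ X W) * white₁ X W) * symmSqrt X.1,
        symmSqrt X.2 * (NormedSpace.exp (t • white₂ X W) * white₂ X W) * symmSqrt X.2) →
      metric (expCurve X W t) (w.1 - v.1 * (expCurve X W t).1⁻¹ * v.1,
        w.2 - v.2 * (expCurve X W t).2⁻¹ * v.2) Z = 0 := by
    rintro v w rfl rfl
    simp only [expCurve_eq]
    rw [conj_exp_acceleration _ (symmSqrt_posDef hX.1).isUnit_det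
        ((Matrix.isUnit_iff_isUnit_det _).1 (Matrix.isUnit_exp _)),
      conj_exp_acceleration _ (symmSqrt_posDef hX.2.2).isUnit_det
        ((Matrix.isUnit_iff_isUnit_det _).1 (Matrix.isUnit_exp _))]
    simp [metric]
  exact aux (hasDerivAt_deriv_expCurve X W t).deriv (hasDerivAt_expCurve X W t).deriv

end ExpCurve

/-! ### Derivatives of the roots at separable matrices. -/

section Separable

variable {p₁ p₂ : ℕ}

/-- Conjugation by `L₂ ⊗ L₁` turns `U₂ ⊗ Σ₁ + Σ₂ ⊗ U₁` into a Kronecker sum, to which the general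
derivative of the Cholesky factor applies. -/
theorem inv_mul_fderiv_sqrtMap_cholesky {K W : Sym (Idx p₁ p₂)} {X U : Pair p₁ p₂}
    (h₁ : X.1.PosDef) (h₂ : X.2.PosDef)
    (hK : (K : Matrix (Idx p₁ p₂) (Idx p₁ p₂) ℝ) = X.2 ⊗ₖ X.1)
    (hW : (W : Matrix (Idx p₁ p₂) (Idx p₁ p₂) ℝ) = kronTangent X U) :
    (sqrtMap .cholesky K)⁻¹ * fderiv ℝ (sqrtMap .cholesky) K W = tildeRChol X U := by
  have hKP : K ∈ SPD (Idx p₁ p₂) := by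
    change (K : Matrix (Idx p₁ p₂) (Idx p₁ p₂) ℝ).PosDef
    rw [hK]
    exact h₂.kronecker h₁
  have h := inv_mul_fderiv_choleskyFactor (toLex_idx_injective p₁ p₂) hKP W
  refine Eq.trans h ?_
  have s₁ := choleskyFactor_spec (b := (id : Fin p₁ → Fin p₁)) Function.injective_id h₁
  have s₂ := choleskyFactor_spec (b := (id : Fin p₂ → Fin p₂)) Function.injective_id h₂
  have u₁ := isUnit_det_of_isCholesky h₁ s₁
  have u₂ := isUnit_det_of_isCholesky h₂ s₂
  have conj : ∀ {n : Type} [Fintype n] [DecidableEq n] {A L : Matrix n n ℝ}, IsUnit L.det →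
      L * Lᵀ = A → L⁻¹ * A * L⁻¹ᵀ = 1 := by
    rintro n _ _ A L hL rfl
    rw [← Matrix.mul_assoc, nonsing_inv_mul _ hL, Matrix.one_mul, transpose_nonsing_inv,
      mul_nonsing_inv _ (by rwa [det_transpose])]
  rw [hK, choleskyFactor_kronecker h₁ h₂, hW, kronTangent]
  simp only [tildeRChol]
  set L₁ := choleskyFactor (id : Fin p₁ → Fin p₁) X.1
  set L₂ := choleskyFactor (id : Fin p₂ → Fin p₂) X.2
  have hZ : (L₂ ⊗ₖ L₁)⁻¹ * (U.2 ⊗ₖ X.1 + X.2 ⊗ₖ U.1) * (L₂ ⊗ₖ L₁)⁻¹ᵀ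
      = 1 ⊗ₖ (L₁⁻¹ * U.1 * L₁⁻¹ᵀ) + (L₂⁻¹ * U.2 * L₂⁻¹ᵀ) ⊗ₖ 1 := by
    rw [inv_kronecker, ← kroneckerMap_transpose, Matrix.mul_add, Matrix.add_mul]
    simp only [← mul_kronecker_mul]
    rw [conj u₁ s₁.2.2, conj u₂ s₂.2.2, add_comm]
  rw [hZ]
  rfl

/-- With a diagonal coefficient the Sylvester operator multiplies entry `(x, y)` by `s x + s y`. -/
theorem sylvester_diagonal {n : Type} [Fintype n] [DecidableEq n] {s : n → ℝ}
    (hs : ∀ i, 0 < s i) (N : Matrix n n ℝ) :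
    hadamard (of fun x y => (s y + s x)⁻¹) N * diagonal s
      + diagonal s * hadamard (of fun x y => (s y + s x)⁻¹) N = N := by
  ext x y
  have h : s y + s x ≠ 0 := (add_pos (hs y) (hs x)).ne'
  simp only [Matrix.add_apply, mul_diagonal, diagonal_mul, hadamard_apply, of_apply]
  field_simp

theorem IsEigenPair.pos {X Γ : Pair p₁ p₂} {l₁ : Fin p₁ → ℝ} {l₂ : Fin p₂ → ℝ}
    (h : IsEigenPair X Γ l₁ l₂) (h₁ : X.1.PosDef) (h₂ : X.2.PosDef) :
    (∀ a, 0 < l₁ a) ∧ ∀ i, 0 < l₂ i := by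
  have aux : ∀ {n : Type} [Fintype n] [DecidableEq n] {A O : Matrix n n ℝ} {l : n → ℝ},
      A.PosDef → O ∈ orthogonalGroup n ℝ → A = O * diagonal l * Oᵀ → ∀ i, 0 < l i := by
    intro n _ _ A O l hA hO h
    have hO' : Oᵀ * O = 1 := (mem_orthogonalGroup_iff' _ _).1 hO
    have hd := hA.congr (B := Oᵀ) (isUnit_det_of_mul_transpose (by rwa [transpose_transpose]))
    rw [h, transpose_transpose] at hd
    have e : Oᵀ * (O * diagonal l * Oᵀ) * O = (Oᵀ * O) * diagonal l * (Oᵀ * O) := by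
      simp only [Matrix.mul_assoc]
    rw [e, hO', Matrix.one_mul, Matrix.mul_one] at hd
    exact posDef_diagonal_iff.1 hd
  exact ⟨aux h₁ h.1 h.2.2.1, aux h₂ h.2.1 h.2.2.2⟩

/-- In the orthonormal basis `Γ₂ ⊗ Γ₁` the root is diagonal, so the Sylvester equation for its
derivative is solved by entrywise division. The homogeneous lemma identifies this solution with the
derivative. -/
theorem inv_mul_fderiv_sqrtMap_symmetric {K W : Sym (Idx p₁ p₂)} {X U Γ : Pair p₁ p₂}
    {l₁ : Fin p₁ → ℝ} {l₂ : Fin p₂ → ℝ} (h₁ : X.1.PosDef) (h₂ : X.2.PosDef)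
    (hK : (K : Matrix (Idx p₁ p₂) (Idx p₁ p₂) ℝ) = X.2 ⊗ₖ X.1)
    (hW : (W : Matrix (Idx p₁ p₂) (Idx p₁ p₂) ℝ) = kronTangent X U)
    (hΓ : IsEigenPair X Γ l₁ l₂) :
    (sqrtMap .symmetric K)⁻¹ * fderiv ℝ (sqrtMap .symmetric) K W = tildeRSymm Γ l₁ l₂ U := by
  have hKP : K ∈ SPD (Idx p₁ p₂) := by
    change (K : Matrix (Idx p₁ p₂) (Idx p₁ p₂) ℝ).PosDef
    rw [hK]
    exact h₂.kronecker h₁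
  obtain ⟨pos₁, pos₂⟩ := hΓ.pos h₁ h₂
  obtain ⟨o₁, o₂, d₁, d₂⟩ := hΓ
  have o₁' : Γ.1ᵀ * Γ.1 = 1 := (mem_orthogonalGroup_iff' _ _).1 o₁
  have o₂' : Γ.2ᵀ * Γ.2 = 1 := (mem_orthogonalGroup_iff' _ _).1 o₂
  have q₁ : Γ.1 * Γ.1ᵀ = 1 := (mem_orthogonalGroup_iff _ _).1 o₁
  have q₂ : Γ.2 * Γ.2ᵀ = 1 := (mem_orthogonalGroup_iff _ _).1 o₂
  set G := Γ.2 ⊗ₖ Γ.1 with hG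
  have hGt : Gᵀ = Γ.2ᵀ ⊗ₖ Γ.1ᵀ := (kroneckerMap_transpose _ _ _).symm
  have hGG : G * Gᵀ = 1 := by rw [hGt, ← mul_kronecker_mul, q₁, q₂, one_kronecker_one]
  have hGG' : Gᵀ * G = 1 := by rw [hGt, ← mul_kronecker_mul, o₁', o₂', one_kronecker_one]
  set s : Idx p₁ p₂ → ℝ := fun x => Real.sqrt (l₂ x.1) * Real.sqrt (l₁ x.2) with hs
  have spos : ∀ x, 0 < s x := fun x => mul_pos (Real.sqrt_pos.2 (pos₂ _)) (Real.sqrt_pos.2 (pos₁ _))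
  have hss : (diagonal s * diagonal s : Matrix (Idx p₁ p₂) (Idx p₁ p₂) ℝ)
      = diagonal l₂ ⊗ₖ diagonal l₁ := by
    rw [diagonal_mul_diagonal, diagonal_kronecker_diagonal]
    congr 1
    ext x
    simp only [hs]
    rw [mul_mul_mul_comm, Real.mul_self_sqrt (pos₂ _).le, Real.mul_self_sqrt (pos₁ _).le]
  have cancel : ∀ A B : Matrix (Idx p₁ p₂) (Idx p₁ p₂) ℝ,
      (G * A * Gᵀ) * (G * B * Gᵀ) = G * (A * B) * Gᵀ := fun A B => by
    have : (G * A * Gᵀ) * (G * B * Gᵀ) = G * A * (Gᵀ * G) * B * Gᵀ := by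
      simp only [Matrix.mul_assoc]
    rw [this, hGG', Matrix.mul_one, Matrix.mul_assoc G A B]
  have hr : symmSqrt (K : Matrix (Idx p₁ p₂) (Idx p₁ p₂) ℝ) = G * diagonal s * Gᵀ := by
    refine symmSqrt_eq ⟨posDef_orthogonal_diagonal hGG spos, ?_⟩
    rw [cancel, hss, hK, d₁, d₂, hGt, hG, ← mul_kronecker_mul, ← mul_kronecker_mul]
  have hinv : (G * diagonal s * Gᵀ)⁻¹ = G * diagonal (fun x => (s x)⁻¹) * Gᵀ := by
    refine inv_eq_right_inv ?_
    rw [cancel, diagonal_mul_diagonal]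
    simp only [mul_inv_cancel₀ (spos _).ne', diagonal_one, Matrix.mul_one, hGG]
  set N := diagonal l₂ ⊗ₖ (Γ.1ᵀ * U.1 * Γ.1) + (Γ.2ᵀ * U.2 * Γ.2) ⊗ₖ diagonal l₁ with hN
  have hWN : (W : Matrix (Idx p₁ p₂) (Idx p₁ p₂) ℝ) = G * N * Gᵀ := by
    have c₁ : Γ.1 * (Γ.1ᵀ * U.1 * Γ.1) * Γ.1ᵀ = U.1 := by
      calc _ = (Γ.1 * Γ.1ᵀ) * U.1 * (Γ.1 * Γ.1ᵀ) := by simp only [Matrix.mul_assoc]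
        _ = U.1 := by rw [q₁, Matrix.one_mul, Matrix.mul_one]
    have c₂ : Γ.2 * (Γ.2ᵀ * U.2 * Γ.2) * Γ.2ᵀ = U.2 := by
      calc _ = (Γ.2 * Γ.2ᵀ) * U.2 * (Γ.2 * Γ.2ᵀ) := by simp only [Matrix.mul_assoc]
        _ = U.2 := by rw [q₂, Matrix.one_mul, Matrix.mul_one]
    rw [hW, kronTangent, hN, hGt, hG, Matrix.mul_add, Matrix.add_mul]
    simp only [← mul_kronecker_mul]
    rw [c₁, c₂, ← d₁, ← d₂, add_comm]
  set H := hadamard (lambdaInv l₁ l₂) N with hH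
  have hHs : H * diagonal s + diagonal s * H = N := sylvester_diagonal spos N
  have hsyl := fderiv_symmSqrt_sylvester hKP W
  set D := fderiv ℝ (fun A : Sym (Idx p₁ p₂) => symmSqrt (A : Matrix (Idx p₁ p₂) (Idx p₁ p₂) ℝ)) K W
    with hD
  have hDH : D = G * H * Gᵀ := by
    refine sub_eq_zero.1 (sylvester_eq_zero (symmSqrt_posDef hKP) (symmSqrt_posDef hKP) ?_)
    have h2 : (G * H * Gᵀ) * (G * diagonal s * Gᵀ) + (G * diagonal s * Gᵀ) * (G * H * Gᵀ) = W := by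
      rw [cancel, cancel, ← Matrix.add_mul, ← Matrix.mul_add, hHs, hWN]
    rw [← hr] at h2
    have h3 := hsyl.trans h2.symm
    rw [Matrix.mul_sub, Matrix.sub_mul, sub_add_sub_comm, add_comm _ (D * _), h3, sub_eq_zero,
      add_comm]
  have goal : (symmSqrt (K : Matrix (Idx p₁ p₂) (Idx p₁ p₂) ℝ))⁻¹ * D = tildeRSymm Γ l₁ l₂ U := by
    rw [hDH, hr, hinv, cancel, tildeRSymm, diagonal_kronecker_diagonal, ← hG, ← hN, ← hH,
      ← Matrix.mul_assoc]
    simp only [hs, mul_inv]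
  exact goal

theorem dk_eq_of_separable (hp₁ : 0 < p₁) (hp₂ : 0 < p₂) {S : Sym (Idx p₁ p₂)}
    (hS : S ∈ SPD (Idx p₁ p₂)) {X : Pair p₁ p₂} (hX : X ∈ Factors p₁ p₂)
    (hK : (kronMap S : Matrix (Idx p₁ p₂) (Idx p₁ p₂) ℝ) = X.2 ⊗ₖ X.1) (hSK : S = kronMap S)
    (V : Sym (Idx p₁ p₂)) : dk S V = kronTangent X (rhs X V) := by
  obtain ⟨U, hU, hRU, hdk⟩ := exists_dk_eq hp₁ hp₂ hS hX hK V
  rw [← coreMap_symmetric hX.1 hX.2.2 hK, (coreMap_eq_one_iff hp₁ hp₂ .symmetric hS).2 hSK,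
    opR_one hX.1 hU] at hRU
  rw [hdk, hRU]

theorem dc_eq_of_separable (hp₁ : 0 < p₁) (hp₂ : 0 < p₂) (κ : SqrtKind) {S : Sym (Idx p₁ p₂)}
    (hS : S ∈ SPD (Idx p₁ p₂)) (hSK : S = kronMap S) (V : Sym (Idx p₁ p₂))
    {R : Matrix (Idx p₁ p₂) (Idx p₁ p₂) ℝ}
    (hR : (sqrtMap κ (kronMap S))⁻¹ * fderiv ℝ (sqrtMap κ) (kronMap S) (fderiv ℝ kronMap S V) = R) :
    dc κ S V = (sqrtMap κ (kronMap S))⁻¹ * (V : Matrix (Idx p₁ p₂) (Idx p₁ p₂) ℝ)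
      * (sqrtMap κ (kronMap S))⁻¹.transpose - R - Rᵀ := by
  rw [dc_eq hp₁ hp₂ κ hS V, (coreMap_eq_one_iff hp₁ hp₂ κ hS).2 hSK, Matrix.mul_one,
    Matrix.one_mul, ← transpose_mul, hR]

end Separable

end KroneckerCore

open KroneckerCore in
theorem proposition5p1 (p₁ p₂ : ℕ) (hp₁ : 0 < p₁) (hp₂ : 0 < p₂) :
    -- the Kronecker map is well defined: `k(S)` is the unique minimizer
    (∀ S ∈ SPD (Idx p₁ p₂), IsKronMinimizer S (kronMap S) ∧
      ∀ K : Sym (Idx p₁ p₂), IsKronMinimizer S K → K = kronMap S) ∧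
    -- the square root maps are well defined and smooth
    (∀ κ : SqrtKind, ∀ K ∈ SPD (Idx p₁ p₂),
      IsSqrt κ (K : Matrix (Idx p₁ p₂) (Idx p₁ p₂) ℝ) (sqrtMap κ K) ∧
      ContDiffAt ℝ ∞ (sqrtMap κ) K) ∧
    -- `k`, `c` and `f = (k, c)` are smooth
    (∀ S ∈ SPD (Idx p₁ p₂), ContDiffAt ℝ ∞ (kronMap (p₁ := p₁) (p₂ := p₂)) S) ∧
    (∀ κ : SqrtKind, ∀ S ∈ SPD (Idx p₁ p₂),
      ContDiffAt ℝ ∞ (coreMap (p₁ := p₁) (p₂ := p₂) κ) S ∧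
      ContDiffAt ℝ ∞ (kcd (p₁ := p₁) (p₂ := p₂) κ) S) ∧
    -- `f` is a diffeomorphism with inverse `g`
    (∀ κ : SqrtKind, IsDiffeoWithInverse (kcd (p₁ := p₁) (p₂ := p₂) κ) (kcdInv κ)
      (SPD (Idx p₁ p₂)) (KronSPD p₁ p₂ ×ˢ Core p₁ p₂)) ∧
    -- geodesics of the manifold of normalized factors
    (∀ X ∈ Factors p₁ p₂, ∀ W ∈ tangent X,
      IsGeodesic Set.univ (expCurve X W) ∧ expCurve X W 0 = X ∧ deriv (expCurve X W) 0 = W) ∧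
    -- the Kullback–Leibler objective is strictly geodesically convex
    (∀ S ∈ SPD (Idx p₁ p₂), StrictGeodesicallyConvex (klObjective S)) ∧
    -- normalized factors of `k(S)`
    (∀ S ∈ SPD (Idx p₁ p₂), ∃! X : Pair p₁ p₂, X ∈ Factors p₁ p₂ ∧
      (kronMap S : Matrix (Idx p₁ p₂) (Idx p₁ p₂) ℝ) = X.2 ⊗ₖ X.1) ∧
    -- the operator `R_C` and the differentials
    (∀ S ∈ SPD (Idx p₁ p₂), ∀ X ∈ Factors p₁ p₂,
      (kronMap S : Matrix (Idx p₁ p₂) (Idx p₁ p₂) ℝ) = X.2 ⊗ₖ X.1 →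
      (∀ κ : SqrtKind, Set.BijOn (opR X (coreMap κ S)) (tangent X) (tangent X)) ∧
      IsRiemannianHessian (klObjective S) X (opR X (coreMap .symmetric S)) ∧
      (∀ V : Sym (Idx p₁ p₂), ∃! U : Pair p₁ p₂, U ∈ tangent X ∧
        opR X (coreMap .symmetric S) U = rhs X V) ∧
      (∀ V : Sym (Idx p₁ p₂), ∀ U ∈ tangent X,
        opR X (coreMap .symmetric S) U = rhs X V → dk S V = kronTangent X U) ∧
      (∀ κ : SqrtKind, ∀ V : Sym (Idx p₁ p₂),
        dc κ S V
          = (sqrtMap κ (kronMap S))⁻¹ * (V : Matrix (Idx p₁ p₂) (Idx p₁ p₂) ℝ)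
              * (sqrtMap κ (kronMap S))⁻¹.transpose
            - (sqrtMap κ (kronMap S))⁻¹
              * (fderiv ℝ (sqrtMap κ) (kronMap S) (fderiv ℝ kronMap S V)) * (coreMap κ S)
            - (coreMap κ S : Matrix (Idx p₁ p₂) (Idx p₁ p₂) ℝ)
              * (fderiv ℝ (sqrtMap κ) (kronMap S) (fderiv ℝ kronMap S V)).transpose
              * (sqrtMap κ (kronMap S))⁻¹.transpose) ∧
      (∀ κ : SqrtKind, ∀ V : Sym (Idx p₁ p₂),
        fderiv ℝ (kcd κ) S V = (fderiv ℝ kronMap S V, fderiv ℝ (coreMap κ) S V)) ∧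
      -- the case `C = I`, that is, `S = k(S)`
      (∀ κ : SqrtKind,
        (coreMap κ S : Matrix (Idx p₁ p₂) (Idx p₁ p₂) ℝ) = 1 ↔ S = kronMap S) ∧
      (S = kronMap S →
        (∀ κ : SqrtKind, ∀ U ∈ tangent X, opR X (coreMap κ S) U = U) ∧
        (∀ V : Sym (Idx p₁ p₂),
          dk S V = kronTangent X (rhs X V) ∧
          dk S V
            = (1 / (p₁ : ℝ)) •
                ((symmSqrt X.2 * ptrace₂ (whiten X V) * symmSqrt X.2) ⊗ₖ X.1)
              + (1 / (p₂ : ℝ)) •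
                (X.2 ⊗ₖ (symmSqrt X.1 * ptrace₁ (whiten X V) * symmSqrt X.1))
              - ((whiten X V).trace / ((p₁ : ℝ) * p₂)) •
                (S : Matrix (Idx p₁ p₂) (Idx p₁ p₂) ℝ) ∧
          dc .cholesky S V
            = (sqrtMap .cholesky (kronMap S))⁻¹ * (V : Matrix (Idx p₁ p₂) (Idx p₁ p₂) ℝ)
                * (sqrtMap .cholesky (kronMap S))⁻¹.transpose
              - tildeRChol X (rhs X V) - (tildeRChol X (rhs X V)).transpose ∧
          (∀ (Γ : Pair p₁ p₂) (l₁ : Fin p₁ → ℝ) (l₂ : Fin p₂ → ℝ), IsEigenPair X Γ l₁ l₂ →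
            dc .symmetric S V
              = (sqrtMap .symmetric (kronMap S))⁻¹ * (V : Matrix (Idx p₁ p₂) (Idx p₁ p₂) ℝ)
                  * (sqrtMap .symmetric (kronMap S))⁻¹.transpose
                - tildeRSymm Γ l₁ l₂ (rhs X V)
                - (tildeRSymm Γ l₁ l₂ (rhs X V)).transpose)))) := by
  refine ⟨fun S hS => ⟨kronMap_spec hp₁ hp₂ hS,
      fun K hK => isKronMinimizer_unique hS hK (kronMap_spec hp₁ hp₂ hS)⟩,
    fun κ K hK => ⟨isSqrt_sqrtMap κ hK, contDiffAt_sqrtMap κ hK⟩,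
    fun S hS => contDiffAt_kronMap hp₁ hp₂ hS,
    fun κ S hS => ⟨contDiffAt_coreMap hp₁ hp₂ κ hS, contDiffAt_kcd hp₁ hp₂ κ hS⟩,
    isDiffeo_kcd hp₁ hp₂,
    fun X hX W hW => ⟨isGeodesic_expCurve hX hW, expCurve_zero hX.1 hX.2.2 W,
      deriv_expCurve_zero hX.1 hX.2.2 W⟩,
    fun S hS => strictGeodesicallyConvex_klObjective hp₁ hp₂ hS,
    fun S hS => existsUnique_factors hp₁ hp₂ hS,
    fun S hS X hX hK => ?_⟩
  have hbij : ∀ κ : SqrtKind, Set.BijOn (opR X (coreMap κ S)) (tangent X) (tangent X) :=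
    fun κ => opR_bijOn hp₁ hp₂ hX.1 hX.2.2
      (isCoreMatrix_of_mem_Core hp₁ hp₂ (coreMap_mem_Core hp₁ hp₂ κ hS))
  have hsymm := coreMap_symmetric hX.1 hX.2.2 hK
  refine ⟨hbij, ?_, fun V => ?_, fun V U hU hRU => ?_, fun κ V => dc_eq hp₁ hp₂ κ hS V,
    fun κ V => fderiv_kcd hp₁ hp₂ κ hS V, fun κ => coreMap_eq_one_iff hp₁ hp₂ κ hS,
    fun hSK => ⟨fun κ U hU => ?_, fun V => ?_⟩⟩
  · rw [hsymm]
    exact isRiemannianHessian_opR hp₁ hp₂ hS hX hK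
  · obtain ⟨U, hU, hRU, -⟩ := exists_dk_eq hp₁ hp₂ hS hX hK V
    rw [← hsymm] at hRU
    exact ⟨U, ⟨hU, hRU⟩, fun U' h' =>
      (hbij .symmetric).injOn h'.1 hU (h'.2.trans hRU.symm)⟩
  · obtain ⟨U', hU', hRU', hdk⟩ := exists_dk_eq hp₁ hp₂ hS hX hK V
    rw [← hsymm] at hRU'
    rw [hdk, (hbij .symmetric).injOn hU' hU (hRU'.trans hRU.symm)]
  · rw [(coreMap_eq_one_iff hp₁ hp₂ κ hS).2 hSK, opR_one hX.1 hU]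
  · have hdk := dk_eq_of_separable hp₁ hp₂ hS hX hK hSK V
    have hSX : (S : Matrix (Idx p₁ p₂) (Idx p₁ p₂) ℝ) = X.2 ⊗ₖ X.1 :=
      (congrArg Subtype.val hSK).trans hK
    refine ⟨hdk, ?_, dc_eq_of_separable hp₁ hp₂ .cholesky hS hSK V
        (inv_mul_fderiv_sqrtMap_cholesky hX.1 hX.2.2 hK hdk),
      fun Γ l₁ l₂ hΓ => dc_eq_of_separable hp₁ hp₂ .symmetric hS hSK V
        (inv_mul_fderiv_sqrtMap_symmetric hX.1 hX.2.2 hK hdk hΓ)⟩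
    rw [hdk, hSX]
    exact kronTangent_rhs hX.1 V
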